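/- \textbf{Conventions.} A $2$-category is strict, and so are $2$-functors. Fix a universe of small sets; $2$-categories may be large, and a $2$-category is \emph{locally small} if all its hom-categories are small. For $2$-functors $F,G\colon X\to C$, a \emph{lax natural transformation} $\psi\colon F\Rightarrow G$ has components $\psi_x\colon Fx\to Gx$ and cells $\psi_s\colon Gs\circ\psi_x\Rightarrow\psi_y\circ Fs$ for $s\colon x\to y$, natural in $s$ and compatible with identities and composition. It is $2$-natural if all $\psi_s$ are identities. For $f\colon A\to C$ and $g\colon B\to C$ the \emph{lax comma $2$-category} $f/g$ has as objects the triples $(a,\,u\colon fa\to gb,\,b)$, as morphisms $(a_0,u_0,b_0)\to(a_1,u_1,b_1)$ the triples $(s,\zeta,t)$ with $s\colon a_0\to a_1$, $t\colon b_0\to b_1$ and $\zeta\colon gt\circ u_0\Rightarrow u_1\circ fs$, and as cells $(s,\zeta,t)\Rightarrow(s',\zeta',t')$ the pairs $(\alpha\colon s\Rightarrow s',\ \beta\colon t\Rightarrow t')$ with $(u_1\circ f\alpha)\cdot\zeta=\zeta'\cdot(g\beta\circ u_0)$. A lax natural transformation $\psi\colon fh\Rightarrow gk$, with $h\colon X\to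 A$ and $k\colon X\to B$, induces a $2$-functor $X\to f/g$ over $A$ and $B$. \textbf{Two-sided $2$-fibrations.} A \emph{split two-sided $2$-fibration} $J=[A\xleftarrow{p}J\xrightarrow{q}B]$ is a span of $2$-functors with the following chosen lifts. \begin{itemize} \item For $i\in J$ and $u\colon a\to pi$ a lift $\lambda(u,i)\colon u^*i\to i$ of $u$ that is cartesian for $p$ (in the $1$- and the $2$-dimensional sense), and for $s\colon i\to j$ and $\alpha\colon ps\Rightarrow v$ a lift $\lambda(s,\alpha)\colon s\Rightarrow\alpha_!s$ of $\alpha$ that is opcartesian for the $1$-functor $J(i,j)\to A(pi,pj)$. The functor $q$ maps these lifts to identities. \item For $i\in J$ and $v\colon qi\to b$ a lift $\rho(i,v)\colon i\to v_!i$ of $v$ that is opcartesian for $q$ (in the $1$- and the $2$-dimensional sense), and for $s\colon i\to j$ and $\beta\colon u\Rightarrow qs$ a lift $\rho(\beta,s)\colon\beta^*s\Rightarrow s$ of $\beta$ that is cartesian for $J(i,j)\to B(qi,qj)$. The functor $p$ maps these lifts to identities. \end{itemize} The lifts of morphisms preserve composition and identities. The lifts of cells preserve vertical composition, vertical identities and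 horizontal composition. The lifts commute: $u^*(v_!i)=v_!(u^*i)$ and $\rho(i,v)\circ\lambda(u,i)=\lambda(u,v_!i)\circ\rho(u^*i,v)$, and likewise $\alpha_!(\beta^*s)=\beta^*(\alpha_!s)$ and $\lambda(s,\alpha)\cdot\rho(\beta,s)=\rho(\beta,\alpha_!s)\cdot\lambda(\beta^*s,\alpha)$. Such a $J$ is \emph{locally discrete} if every cell $\sigma$ of $J$ for which $p\sigma$ and $q\sigma$ are identity cells is itself an identity cell. In that case the fibre $J_{(a,b)}$ over $a\in A$ and $b\in B$ is a $1$-category. $J$ has \emph{small fibres} if all $J_{(a,b)}$ are small categories. Let $\mathrm{Cat}^{A^{op}}$ be the $2$-category of $2$-functors from $A^{op}$ to the $2$-category of small categories, $2$-natural transformations and modifications. For $A$ locally small let $\mathrm y\colon A\to\mathrm{Cat}^{A^{op}}$, $\mathrm ya=A(-,a)$, be the Yoneda $2$-functor. For $i\in fa$, where $f\in\mathrm{Cat}^{A^{op}}$, let $(-)^*i\colon\mathrm ya\Rightarrow f$ be the $2$-natural transformation $u\mapsto u^*i:=(fu)(i)$; a morphism $s\colon i\to j$ of $fa$ gives a modification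 $(-)^*s\colon(-)^*i\Rrightarrow(-)^*j$. For $J$ locally discrete with small fibres the \emph{inverse Grothendieck construction} is the $2$-functor $\ulcorner J\urcorner\colon B\to\mathrm{Cat}^{A^{op}}$ with $\ulcorner J\urcorner(b)(a)=J_{(a,b)}$ on which morphisms $u$ of $A$ and $v$ of $B$ act by the functors $u^*$ and $v_!$ that are induced by the lifts. A cell $\alpha\colon u\Rightarrow u'$ of $A$ acts by the natural transformation $\alpha^*\colon u^*\Rightarrow u'^*$ whose component $\alpha^*_i\colon u^*i\to u'^*i$ is the fibre morphism with $\lambda(u',i)\circ\alpha^*_i=\alpha_!\lambda(u,i)$, and a cell $\beta\colon v\Rightarrow v'$ of $B$ by the natural transformation $\beta_!\colon v_!\Rightarrow v'_!$ whose component $\beta_{!i}\colon v_!i\to v'_!i$ is the fibre morphism with $\beta_{!i}\circ\rho(i,v)=\beta^*\rho(i,v')$. \textbf{Cells.} Let $X_0\xleftarrow{p_1}H_1\xrightarrow{q_1}X_1\leftarrow\cdots\rightarrow X_{n-1}\xleftarrow{p_n}H_n\xrightarrow{q_n}X_n$, $n\ge1$, be a path of split two-sided $2$-fibrations. In the iterated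 pullback $H=H_1\times_{X_1}\cdots\times_{X_{n-1}}H_n$ consider the \emph{left} morphisms $(\lambda(u,i_1),\mathrm{id},\dots,\mathrm{id})$, the \emph{inner} morphisms $(\mathrm{id},\dots,\mathrm{id},\rho(i_m,u),\lambda(u,i_{m+1}),\mathrm{id},\dots,\mathrm{id})$ and the \emph{right} morphisms $(\mathrm{id},\dots,\mathrm{id},\rho(i_n,v))$, and similarly left, inner and right cells. Let $\pi_0\colon H\to X_0$ and $\pi_n\colon H\to X_n$ be the outer projections. \begin{itemize} \item For $h\colon X_0\to A$ and $k\colon X_n\to B$ a \emph{marked} lax natural transformation is a lax natural transformation $\psi\colon fh\pi_0\Rightarrow gk\pi_n$ with $\psi_s$ an identity for all left, inner and right morphisms $s$. These are the nullary cells $(H_1,\dots,H_n)\Rightarrow C$ with vertical source $fh$ and vertical target $gk$. The nullary cells on the empty path at $X$ are the $2$-natural transformations $fh\Rightarrow gk$. \item A \emph{unary cell} $(H_1,\dots,H_n)\Rightarrow J$ with vertical source $h$ and target $k$ is a $2$-functor $T\colon H\to J$ with $pT=h\pi_0$ and $qT=k\pi_n$ that sends left morphisms and cells to chosen lifts $\lambda$,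 inner ones to identities and right ones to chosen lifts $\rho$. A unary cell from the empty path at $X$ is a $2$-functor $T\colon X\to J$ with $pT=h$ and $qT=k$ such that $Ts=\lambda(hs,Ty)\circ\rho(Tx,ks)$ for all $s\colon x\to y$ and $T\sigma=\rho(k\sigma,Tt)\cdot\lambda(Ts,h\sigma)$ for all cells $\sigma\colon s\Rightarrow t$. \item A nullary cell $\chi\colon J\Rightarrow C$ with vertical boundaries $f$ and $g$ is \emph{cartesian} if every nullary cell $\psi$ as above, on a possibly empty path, is of the form $\psi=\chi T$ for a unique unary cell $T$ with target $J$, vertical source $h$ and vertical target $k$. \end{itemize} \textbf{Theorem.} Let $A$ be a locally small $2$-category and let $J=[A\xleftarrow{p}J\xrightarrow{q}B]$ be a locally discrete split two-sided $2$-fibration with small fibres. For each $s\colon i\to j$ in $J$ there is a unique morphism $\hat s\colon(qs)_!i\to(ps)^*j$ in the fibre $J_{(pi,qj)}$ with $\lambda(ps,j)\circ\hat s\circ\rho(i,qs)=s$, and $$\chi_i:=(-)^*i\colon\mathrm ypi\Rightarrow\ulcorner J\urcorner qi,\qquad \chi_s:=(-)^*\hat s\colon(qs)_!\circ(-)^*i\Rrightarrow(ps\circ-)^*j$$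 are the components of a lax natural transformation $\chi\colon\mathrm yp\Rightarrow\ulcorner J\urcorner q$ such that: \begin{enumerate} \item the $2$-functor $J\to\mathrm y/\ulcorner J\urcorner$ over $A$ and $B$ that is induced by $\chi$ is invertible, so that $J$ is isomorphic, over $A$ and $B$, to the lax comma $2$-category of $\mathrm y$ and $\ulcorner J\urcorner$; \item $\chi$ exhibits $J$ as a lax comma object: for all $2$-functors $h\colon X\to A$ and $k\colon X\to B$ each lax natural transformation $\psi\colon\mathrm yh\Rightarrow\ulcorner J\urcorner k$ is of the form $\psi=\chi T$ for a unique $2$-functor $T\colon X\to J$ with $pT=h$ and $qT=k$; \item $\chi$ is marked, that is, $\chi_s$ is an identity whenever $s$ is one of the chosen lifts $\lambda(u,i)$ or $\rho(i,v)$, and as a nullary cell $J\Rightarrow\mathrm{Cat}^{A^{op}}$ with vertical boundaries $\mathrm y$ and $\ulcorner J\urcorner$ it is cartesian. \end{enumerate} -/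

import Mathlib

open CategoryTheory Bicategory

attribute [-instance] catToReflQuiver

universe w v u w₁ w₂ w₃ w₄ v₁ v₂ v₃ v₄ u₁ u₂ u₃ u₄

set_option linter.unusedVariables false
set_option linter.unusedSectionVars false
set_option linter.unusedSimpArgs false
set_option linter.checkUnivs false

namespace TwoFib

/-- A cell of a 2-category is an identity cell. -/
def IsIdCell {C : Type u₁} [Bicategory.{w₁, v₁} C] {x y : C} {f g : x ⟶ y} (σ : f ⟶ g) : Prop :=
  ∃ h : f = g, σ = eqToHom h

/-- A morphism of a 2-category is an identity morphism. -/
def IsIdMor {C : Type u₁} [Bicategory.{w₁, v₁} C] [Strict C] {x y : C} (f : x ⟶ y) : Prop :=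
  ∃ h : x = y, f = eqToHom h

section Fibrations

variable {J : Type u₁} [Bicategory.{w₁, v₁} J] [Strict J]
  {A : Type u₂} [Bicategory.{w₂, v₂} A] [Strict A]
  {B : Type u₃} [Bicategory.{w₃, v₃} B] [Strict B]

/-- A split op-2-fibration: a 2-functor `q : J ⟶ B` with a cleavage consisting of opcartesian
lifts `rho i u : i ⟶ u_! i` of morphisms and cartesian lifts `rho₂ s β : β^* s ⟶ s` of cells.
A morphism out of `b = q (u_! i)` is written as a morphism out of `q (u_! i)`, so that
`q (rho i u) ≫ v` is the composite of `u` and `v`; similarly for cells into `u = q (β^* s)`. -/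
structure SplitOpTwoFibration (q : StrictPseudofunctor J B) where
  /-- the object `u_! i` -/
  push (i : J) {b : B} (u : q.obj i ⟶ b) : J
  /-- the lift `i ⟶ u_! i` of `u` -/
  rho (i : J) {b : B} (u : q.obj i ⟶ b) : i ⟶ push i u
  obj_push (i : J) {b : B} (u : q.obj i ⟶ b) : q.obj (push i u) = b
  map_rho (i : J) {b : B} (u : q.obj i ⟶ b) : q.map (rho i u) = u ≫ eqToHom (obj_push i u).symm
  /-- the morphism `β^* s` -/
  pull₂ {i j : J} (s : i ⟶ j) {u : q.obj i ⟶ q.obj j} (β : u ⟶ q.map s) : i ⟶ j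
  /-- the lift `β^* s ⟶ s` of `β` -/
  rho₂ {i j : J} (s : i ⟶ j) {u : q.obj i ⟶ q.obj j} (β : u ⟶ q.map s) : pull₂ s β ⟶ s
  map_pull₂ {i j : J} (s : i ⟶ j) {u : q.obj i ⟶ q.obj j} (β : u ⟶ q.map s) :
    q.map (pull₂ s β) = u
  map₂_rho₂ {i j : J} (s : i ⟶ j) {u : q.obj i ⟶ q.obj j} (β : u ⟶ q.map s) :
    q.map₂ (rho₂ s β) = eqToHom (map_pull₂ s β) ≫ β
  push_comp (i : J) {b b' : B} (u : q.obj i ⟶ b) (v : q.obj (push i u) ⟶ b') :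
    push i (q.map (rho i u) ≫ v) = push (push i u) v
  rho_comp (i : J) {b b' : B} (u : q.obj i ⟶ b) (v : q.obj (push i u) ⟶ b') :
    rho i (q.map (rho i u) ≫ v) =
      (rho i u ≫ rho (push i u) v) ≫ eqToHom (push_comp i u v).symm
  push_id (i : J) : push i (𝟙 (q.obj i)) = i
  rho_id (i : J) : rho i (𝟙 (q.obj i)) = eqToHom (push_id i).symm
  pull₂_comp {i j : J} (s : i ⟶ j) {u u' : q.obj i ⟶ q.obj j} (β : u ⟶ q.map s)
    (γ : u' ⟶ q.map (pull₂ s β)) :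
    pull₂ s (γ ≫ q.map₂ (rho₂ s β)) = pull₂ (pull₂ s β) γ
  rho₂_comp {i j : J} (s : i ⟶ j) {u u' : q.obj i ⟶ q.obj j} (β : u ⟶ q.map s)
    (γ : u' ⟶ q.map (pull₂ s β)) :
    rho₂ s (γ ≫ q.map₂ (rho₂ s β)) =
      eqToHom (pull₂_comp s β γ) ≫ rho₂ (pull₂ s β) γ ≫ rho₂ s β
  pull₂_hcomp {i j k : J} (s : i ⟶ j) (t : j ⟶ k) {u : q.obj i ⟶ q.obj j}
    {v : q.obj j ⟶ q.obj k} (β : u ⟶ q.map s) (δ : v ⟶ q.map t) :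
    pull₂ (s ≫ t) ((β ▷ v ≫ q.map s ◁ δ) ≫ (q.mapComp s t).inv) = pull₂ s β ≫ pull₂ t δ
  rho₂_hcomp {i j k : J} (s : i ⟶ j) (t : j ⟶ k) {u : q.obj i ⟶ q.obj j}
    {v : q.obj j ⟶ q.obj k} (β : u ⟶ q.map s) (δ : v ⟶ q.map t) :
    rho₂ (s ≫ t) ((β ▷ v ≫ q.map s ◁ δ) ≫ (q.mapComp s t).inv) =
      eqToHom (pull₂_hcomp s t β δ) ≫ rho₂ s β ▷ pull₂ t δ ≫ s ◁ rho₂ t δ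
  pull₂_id {i j : J} (s : i ⟶ j) : pull₂ s (𝟙 (q.map s)) = s
  rho₂_id {i j : J} (s : i ⟶ j) : rho₂ s (𝟙 (q.map s)) = eqToHom (pull₂_id s)
  /-- the 1-dimensional universal property of `rho i u` -/
  rho_opcartesian (i : J) {b : B} (u : q.obj i ⟶ b) {j : J} (s : i ⟶ j)
    (v : q.obj (push i u) ⟶ q.obj j) (h : q.map s = q.map (rho i u) ≫ v) :
    ∃! t : push i u ⟶ j, q.map t = v ∧ rho i u ≫ t = s
  /-- the 2-dimensional universal property of `rho i u`; the parallel morphisms `i ⟶ j` whose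
  images factor through `u` are written in their factorised form -/
  rho_opcartesian₂ (i : J) {b : B} (u : q.obj i ⟶ b) {j : J} (s t : push i u ⟶ j)
    (σ : rho i u ≫ s ⟶ rho i u ≫ t) (β : q.map s ⟶ q.map t)
    (h : q.map₂ σ =
      (q.mapComp (rho i u) s).hom ≫ q.map (rho i u) ◁ β ≫ (q.mapComp (rho i u) t).inv) :
    ∃! τ : s ⟶ t, q.map₂ τ = β ∧ rho i u ◁ τ = σ
  /-- the universal property of `rho₂ s β` -/
  rho₂_cartesian {i j : J} (s : i ⟶ j) {u : q.obj i ⟶ q.obj j} (β : u ⟶ q.map s) (r : i ⟶ j)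
    (σ : r ⟶ s) (α : q.map r ⟶ q.map (pull₂ s β)) (h : q.map₂ σ = α ≫ q.map₂ (rho₂ s β)) :
    ∃! τ : r ⟶ pull₂ s β, q.map₂ τ = α ∧ τ ≫ rho₂ s β = σ

/-- A split co-2-fibration, the dual of a split op-2-fibration with respect to both morphisms and
cells: a 2-functor `p : J ⟶ A` with a cleavage consisting of cartesian lifts
`lam i u : u^* i ⟶ i` of morphisms and opcartesian lifts `lam₂ s α : s ⟶ α_! s` of cells. -/
structure SplitCoTwoFibration (p : StrictPseudofunctor J A) where
  /-- the object `u^* i` -/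
  pull (i : J) {a : A} (u : a ⟶ p.obj i) : J
  /-- the lift `u^* i ⟶ i` of `u` -/
  lam (i : J) {a : A} (u : a ⟶ p.obj i) : pull i u ⟶ i
  obj_pull (i : J) {a : A} (u : a ⟶ p.obj i) : p.obj (pull i u) = a
  map_lam (i : J) {a : A} (u : a ⟶ p.obj i) : p.map (lam i u) = eqToHom (obj_pull i u) ≫ u
  /-- the morphism `α_! s` -/
  push₂ {i j : J} (s : i ⟶ j) {v : p.obj i ⟶ p.obj j} (α : p.map s ⟶ v) : i ⟶ j
  /-- the lift `s ⟶ α_! s` of `α` -/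
  lam₂ {i j : J} (s : i ⟶ j) {v : p.obj i ⟶ p.obj j} (α : p.map s ⟶ v) : s ⟶ push₂ s α
  map_push₂ {i j : J} (s : i ⟶ j) {v : p.obj i ⟶ p.obj j} (α : p.map s ⟶ v) :
    p.map (push₂ s α) = v
  map₂_lam₂ {i j : J} (s : i ⟶ j) {v : p.obj i ⟶ p.obj j} (α : p.map s ⟶ v) :
    p.map₂ (lam₂ s α) = α ≫ eqToHom (map_push₂ s α).symm
  pull_comp (i : J) {a a' : A} (u : a ⟶ p.obj i) (v : a' ⟶ p.obj (pull i u)) :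
    pull i (v ≫ p.map (lam i u)) = pull (pull i u) v
  lam_comp (i : J) {a a' : A} (u : a ⟶ p.obj i) (v : a' ⟶ p.obj (pull i u)) :
    lam i (v ≫ p.map (lam i u)) = eqToHom (pull_comp i u v) ≫ lam (pull i u) v ≫ lam i u
  pull_id (i : J) : pull i (𝟙 (p.obj i)) = i
  lam_id (i : J) : lam i (𝟙 (p.obj i)) = eqToHom (pull_id i)
  push₂_comp {i j : J} (s : i ⟶ j) {v v' : p.obj i ⟶ p.obj j} (α : p.map s ⟶ v)
    (γ : p.map (push₂ s α) ⟶ v') :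
    push₂ s (p.map₂ (lam₂ s α) ≫ γ) = push₂ (push₂ s α) γ
  lam₂_comp {i j : J} (s : i ⟶ j) {v v' : p.obj i ⟶ p.obj j} (α : p.map s ⟶ v)
    (γ : p.map (push₂ s α) ⟶ v') :
    lam₂ s (p.map₂ (lam₂ s α) ≫ γ) =
      (lam₂ s α ≫ lam₂ (push₂ s α) γ) ≫ eqToHom (push₂_comp s α γ).symm
  push₂_hcomp {i j k : J} (s : i ⟶ j) (t : j ⟶ k) {u : p.obj i ⟶ p.obj j}
    {v : p.obj j ⟶ p.obj k} (α : p.map s ⟶ u) (δ : p.map t ⟶ v) :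
    push₂ (s ≫ t) ((p.mapComp s t).hom ≫ α ▷ p.map t ≫ u ◁ δ) = push₂ s α ≫ push₂ t δ
  lam₂_hcomp {i j k : J} (s : i ⟶ j) (t : j ⟶ k) {u : p.obj i ⟶ p.obj j}
    {v : p.obj j ⟶ p.obj k} (α : p.map s ⟶ u) (δ : p.map t ⟶ v) :
    lam₂ (s ≫ t) ((p.mapComp s t).hom ≫ α ▷ p.map t ≫ u ◁ δ) =
      (lam₂ s α ▷ t ≫ push₂ s α ◁ lam₂ t δ) ≫ eqToHom (push₂_hcomp s t α δ).symm
  push₂_id {i j : J} (s : i ⟶ j) : push₂ s (𝟙 (p.map s)) = s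
  lam₂_id {i j : J} (s : i ⟶ j) : lam₂ s (𝟙 (p.map s)) = eqToHom (push₂_id s).symm
  /-- the 1-dimensional universal property of `lam i u` -/
  lam_cartesian (i : J) {a : A} (u : a ⟶ p.obj i) {j : J} (s : j ⟶ i)
    (v : p.obj j ⟶ p.obj (pull i u)) (h : p.map s = v ≫ p.map (lam i u)) :
    ∃! t : j ⟶ pull i u, p.map t = v ∧ t ≫ lam i u = s
  /-- the 2-dimensional universal property of `lam i u` -/
  lam_cartesian₂ (i : J) {a : A} (u : a ⟶ p.obj i) {j : J} (s t : j ⟶ pull i u)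
    (σ : s ≫ lam i u ⟶ t ≫ lam i u) (α : p.map s ⟶ p.map t)
    (h : p.map₂ σ =
      (p.mapComp s (lam i u)).hom ≫ α ▷ p.map (lam i u) ≫ (p.mapComp t (lam i u)).inv) :
    ∃! τ : s ⟶ t, p.map₂ τ = α ∧ τ ▷ lam i u = σ
  /-- the universal property of `lam₂ s α` -/
  lam₂_opcartesian {i j : J} (s : i ⟶ j) {v : p.obj i ⟶ p.obj j} (α : p.map s ⟶ v) (r : i ⟶ j)
    (σ : s ⟶ r) (γ : p.map (push₂ s α) ⟶ p.map r) (h : p.map₂ σ = p.map₂ (lam₂ s α) ≫ γ) :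
    ∃! τ : push₂ s α ⟶ r, p.map₂ τ = γ ∧ lam₂ s α ≫ τ = σ

/-- A split two-sided 2-fibration, with underlying span of 2-functors `A ⟵ J ⟶ B`. -/
structure SplitTwoSidedTwoFibration (p : StrictPseudofunctor J A) (q : StrictPseudofunctor J B)
    extends SplitCoTwoFibration p, SplitOpTwoFibration q where
  q_pull (i : J) {a : A} (u : a ⟶ p.obj i) : q.obj (pull i u) = q.obj i
  q_lam (i : J) {a : A} (u : a ⟶ p.obj i) : q.map (lam i u) = eqToHom (q_pull i u)
  q_push₂ {i j : J} (s : i ⟶ j) {v : p.obj i ⟶ p.obj j} (α : p.map s ⟶ v) :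
    q.map (push₂ s α) = q.map s
  q_lam₂ {i j : J} (s : i ⟶ j) {v : p.obj i ⟶ p.obj j} (α : p.map s ⟶ v) :
    q.map₂ (lam₂ s α) = eqToHom (q_push₂ s α).symm
  p_push (i : J) {b : B} (v : q.obj i ⟶ b) : p.obj (push i v) = p.obj i
  p_rho (i : J) {b : B} (v : q.obj i ⟶ b) : p.map (rho i v) = eqToHom (p_push i v).symm
  p_pull₂ {i j : J} (s : i ⟶ j) {u : q.obj i ⟶ q.obj j} (β : u ⟶ q.map s) :
    p.map (pull₂ s β) = p.map s
  p_rho₂ {i j : J} (s : i ⟶ j) {u : q.obj i ⟶ q.obj j} (β : u ⟶ q.map s) :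
    p.map₂ (rho₂ s β) = eqToHom (p_pull₂ s β)
  /-- `v_! (u^* i) = u^* (v_! i)`; here `q (lam i u)` and `p (rho i v)` are identities -/
  push_pull (i : J) {a : A} (u : a ⟶ p.obj i) {b : B} (v : q.obj i ⟶ b) :
    push (pull i u) (q.map (lam i u) ≫ v) = pull (push i v) (u ≫ p.map (rho i v))
  lam_rho (i : J) {a : A} (u : a ⟶ p.obj i) {b : B} (v : q.obj i ⟶ b) :
    lam i u ≫ rho i v =
      rho (pull i u) (q.map (lam i u) ≫ v) ≫ eqToHom (push_pull i u v) ≫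
        lam (push i v) (u ≫ p.map (rho i v))
  /-- `α_! (β^* s) = β^* (α_! s)` -/
  push₂_pull₂ {i j : J} (s : i ⟶ j) {v : p.obj i ⟶ p.obj j} (α : p.map s ⟶ v)
    {u : q.obj i ⟶ q.obj j} (β : u ⟶ q.map s) :
    push₂ (pull₂ s β) (p.map₂ (rho₂ s β) ≫ α) = pull₂ (push₂ s α) (β ≫ q.map₂ (lam₂ s α))
  rho₂_lam₂ {i j : J} (s : i ⟶ j) {v : p.obj i ⟶ p.obj j} (α : p.map s ⟶ v)
    {u : q.obj i ⟶ q.obj j} (β : u ⟶ q.map s) :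
    rho₂ s β ≫ lam₂ s α =
      lam₂ (pull₂ s β) (p.map₂ (rho₂ s β) ≫ α) ≫ eqToHom (push₂_pull₂ s α β) ≫
        rho₂ (push₂ s α) (β ≫ q.map₂ (lam₂ s α))

/-- The span `A ⟵ J ⟶ B` jointly reflects identity cells. -/
def JointlyReflectsIdCells (p : StrictPseudofunctor J A) (q : StrictPseudofunctor J B) : Prop :=
  ∀ ⦃i j : J⦄ ⦃s t : i ⟶ j⦄ (σ : s ⟶ t),
    IsIdCell (p.map₂ σ) → IsIdCell (q.map₂ σ) → IsIdCell σ

end Fibrations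

section TwoNatural

variable {C : Type u₁} [Bicategory.{w₁, v₁} C] {D : Type u₂} [Bicategory.{w₂, v₂} D]

lemma whiskerLeft_congr {a b c : C} {f f' : a ⟶ b} (h : f = f') {g g' : b ⟶ c} (η : g ⟶ g') :
    f ◁ η = eqToHom (by rw [h]) ≫ f' ◁ η ≫ eqToHom (by rw [h]) := by
  subst h; simp

lemma whiskerRight_congr {a b c : C} {f f' : a ⟶ b} (η : f ⟶ f') {g g' : b ⟶ c} (h : g = g') :
    η ▷ g = eqToHom (by rw [h]) ≫ η ▷ g' ≫ eqToHom (by rw [h]) := by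
  subst h; simp

/-- 2-natural transformations between 2-functors. -/
@[ext]
structure TwoNat (F G : StrictPseudofunctor C D) where
  app (a : C) : F.obj a ⟶ G.obj a
  naturality {a b : C} (f : a ⟶ b) : app a ≫ G.map f = F.map f ≫ app b
  naturality₂ {a b : C} {f g : a ⟶ b} (η : f ⟶ g) :
    app a ◁ G.map₂ η =
      eqToHom (naturality f) ≫ F.map₂ η ▷ app b ≫ eqToHom (naturality g).symm

/-- Modifications between 2-natural transformations. -/
@[ext]
structure TwoModification {F G : StrictPseudofunctor C D} (φ ψ : TwoNat F G) where
  app (a : C) : φ.app a ⟶ ψ.app a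
  naturality {a b : C} (f : a ⟶ b) :
    app a ▷ G.map f =
      eqToHom (φ.naturality f) ≫ F.map f ◁ app b ≫ eqToHom (ψ.naturality f).symm

variable {E F G H : StrictPseudofunctor C D}

instance : Category (TwoNat F G) where
  Hom := TwoModification
  id φ := ⟨fun a => 𝟙 (φ.app a), by simp⟩
  comp m n := ⟨fun a => m.app a ≫ n.app a, by simp [m.naturality, n.naturality]⟩

namespace TwoNat

@[ext] lemma hom_ext {φ ψ : TwoNat F G} {m n : φ ⟶ ψ} (h : ∀ a, m.app a = n.app a) : m = n :=
  TwoModification.ext (funext h)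
@[simp] lemma id_app (φ : TwoNat F G) (a : C) : TwoModification.app (𝟙 φ) a = 𝟙 (φ.app a) := rfl
@[simp] lemma comp_app {φ ψ χ : TwoNat F G} (m : φ ⟶ ψ) (n : ψ ⟶ χ) (a : C) :
    TwoModification.app (m ≫ n) a = m.app a ≫ n.app a := rfl
@[simp] lemma eqToHom_app {φ ψ : TwoNat F G} (h : φ = ψ) (a : C) :
    TwoModification.app (eqToHom h) a = eqToHom (by rw [h]) := by
  subst h; rfl

variable [Strict D]

/-- The identity 2-natural transformation. -/
@[reducible, simps]
def idTrans (F : StrictPseudofunctor C D) : TwoNat F F where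
  app a := 𝟙 (F.obj a)
  naturality f := by rw [Strict.id_comp, Strict.comp_id]
  naturality₂ η := by
    simp [Strict.leftUnitor_eqToIso, Strict.rightUnitor_eqToIso]

/-- Composition of 2-natural transformations. -/
@[reducible, simps]
def compTrans (φ : TwoNat F G) (ψ : TwoNat G H) : TwoNat F H where
  app a := φ.app a ≫ ψ.app a
  naturality f := by
    rw [Strict.assoc, ψ.naturality, ← Strict.assoc, φ.naturality, Strict.assoc]
  naturality₂ {a b f g} η := by
    have h' := congrArg (· ▷ ψ.app b) (φ.naturality₂ η)
    simp [Strict.associator_eqToIso, ψ.naturality₂] at h' ⊢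
    simp [eqToHom_comp_iff, comp_eqToHom_iff] at h' ⊢
    exact h'

/-- Left whiskering of modifications. -/
@[reducible, simps]
def whiskerL (φ : TwoNat F G) {ψ ψ' : TwoNat G H} (m : ψ ⟶ ψ') :
    compTrans φ ψ ⟶ compTrans φ ψ' where
  app a := φ.app a ◁ m.app a
  naturality {a b} f := by
    have h := whiskerLeft_congr (φ.naturality f) (m.app b)
    simp [Strict.associator_eqToIso, m.naturality] at h ⊢
    simp [eqToHom_comp_iff, comp_eqToHom_iff] at h ⊢
    exact h

/-- Right whiskering of modifications. -/
@[reducible, simps]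
def whiskerR {φ φ' : TwoNat F G} (m : φ ⟶ φ') (ψ : TwoNat G H) :
    compTrans φ ψ ⟶ compTrans φ' ψ where
  app a := m.app a ▷ ψ.app a
  naturality {a b} f := by
    have h := whiskerRight_congr (m.app a) (ψ.naturality f)
    have h' := congrArg (· ▷ ψ.app b) (m.naturality f)
    simp [Strict.associator_eqToIso] at h h' ⊢
    simp [eqToHom_comp_iff, comp_eqToHom_iff] at h h' ⊢
    rw [h, h']
    simp

lemma id_comp' (φ : TwoNat F G) : compTrans (idTrans F) φ = φ :=
  TwoNat.ext (funext fun _ => Strict.id_comp _)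
lemma comp_id' (φ : TwoNat F G) : compTrans φ (idTrans G) = φ :=
  TwoNat.ext (funext fun _ => Strict.comp_id _)
lemma assoc' (φ : TwoNat E F) (ψ : TwoNat F G) (χ : TwoNat G H) :
    compTrans (compTrans φ ψ) χ = compTrans φ (compTrans ψ χ) :=
  TwoNat.ext (funext fun _ => Strict.assoc _ _ _)

end TwoNat

end TwoNatural

section Presheaves

/-- A category is small with respect to the universe `w`. -/
def IsSmallCat (C : Type u₁) [Category.{v₁} C] : Prop := Small.{w} C ∧ LocallySmall.{w} C

variable (A : Type u) [Bicategory.{u, u} A]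

/-- The 2-category `Cat ^ Aᵒᵖ` of 2-functors from `Aᵒᵖ` into the 2-category of small categories,
2-natural transformations and modifications. Here small means small with respect to a universe
`w`, and `A` is a 2-category in a possibly larger universe `u`. -/
structure Presheaf where
  functor : StrictPseudofunctor Aᵒᵖ Cat.{u, u}
  small (a : Aᵒᵖ) : IsSmallCat.{w} (functor.obj a)

namespace Presheaf

variable {A}

instance : CategoryStruct (Presheaf.{w} A) where
  Hom f g := TwoNat f.functor g.functor
  id f := .idTrans f.functor
  comp φ ψ := φ.compTrans ψ

@[simp] lemma id_app (f : Presheaf.{w} A) (a : Aᵒᵖ) :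
    TwoNat.app (𝟙 f) a = 𝟙 (f.functor.obj a) := rfl
@[simp] lemma comp_app {f g h : Presheaf.{w} A} (φ : f ⟶ g) (ψ : g ⟶ h) (a : Aᵒᵖ) :
    TwoNat.app (φ ≫ ψ) a = φ.app a ≫ ψ.app a := rfl

instance homCategory (f g : Presheaf.{w} A) : Category (f ⟶ g) :=
  inferInstanceAs (Category (TwoNat f.functor g.functor))

@[simp] lemma id₂_app {f g : Presheaf.{w} A} (φ : f ⟶ g) (a : Aᵒᵖ) :
    TwoModification.app (𝟙 φ) a = 𝟙 (φ.app a) := rfl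
@[simp] lemma comp₂_app {f g : Presheaf.{w} A} {φ ψ χ : f ⟶ g} (m : φ ⟶ ψ) (n : ψ ⟶ χ)
    (a : Aᵒᵖ) : TwoModification.app (m ≫ n) a = m.app a ≫ n.app a := rfl
@[simp] lemma eqToHom_app {f g : Presheaf.{w} A} {φ ψ : f ⟶ g} (h : φ = ψ) (a : Aᵒᵖ) :
    TwoModification.app (eqToHom h) a = eqToHom (by rw [h]) := by
  subst h; rfl

@[ext] lemma hom₂_ext {f g : Presheaf.{w} A} {φ ψ : f ⟶ g} {m n : φ ⟶ ψ}
    (h : ∀ a, m.app a = n.app a) : m = n :=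
  TwoModification.ext (funext h)

attribute [local simp] Strict.associator_eqToIso Strict.leftUnitor_eqToIso
  Strict.rightUnitor_eqToIso in
instance : Bicategory (Presheaf.{w} A) where
  whiskerLeft φ _ _ m := TwoNat.whiskerL φ m
  whiskerRight m ψ := TwoNat.whiskerR m ψ
  associator φ ψ χ := eqToIso (TwoNat.assoc' φ ψ χ)
  leftUnitor φ := eqToIso (TwoNat.id_comp' φ)
  rightUnitor φ := eqToIso (TwoNat.comp_id' φ)
  whiskerLeft_id := by intros; apply hom₂_ext; intro; simp
  whiskerLeft_comp := by intros; apply hom₂_ext; intro; simp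
  id_whiskerLeft := by intros; apply hom₂_ext; intro; simp
  comp_whiskerLeft := by intros; apply hom₂_ext; intro; simp
  id_whiskerRight := by intros; apply hom₂_ext; intro; simp
  comp_whiskerRight := by intros; apply hom₂_ext; intro; simp
  whiskerRight_id := by intros; apply hom₂_ext; intro; simp
  whiskerRight_comp := by intros; apply hom₂_ext; intro; simp
  whisker_assoc := by intros; apply hom₂_ext; intro; simp
  whisker_exchange := by intros; apply hom₂_ext; intro; simp [whisker_exchange]
  pentagon := by intros; apply hom₂_ext; intro; simp; rfl
  triangle := by intros; apply hom₂_ext; intro; simp; rfl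

instance : Strict (Presheaf.{w} A) where
  id_comp := TwoNat.id_comp'
  comp_id := TwoNat.comp_id'
  assoc := TwoNat.assoc'
  leftUnitor_eqToIso _ := rfl
  rightUnitor_eqToIso _ := rfl
  associator_eqToIso _ _ _ := rfl

end Presheaf

end Presheaves

section Yoneda

open Opposite Bicategory.Opposite

@[simp] lemma eqToHom_unop2 {A : Type u₁} [Bicategory.{w₁, v₁} A] {a b : Aᵒᵖ} {f g : a ⟶ b}
    (h : f = g) : (eqToHom h).unop2 = eqToHom (congrArg Quiver.Hom.unop h) := by
  subst h; rfl

lemma unop2_inj {A : Type u₁} [Bicategory.{w₁, v₁} A] {a b : Aᵒᵖ} {f g : a ⟶ b} {σ τ : f ⟶ g}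
    (h : σ.unop2 = τ.unop2) : σ = τ := by
  change op2 σ.unop2 = op2 τ.unop2
  rw [h]

instance strictOp {A : Type u₁} [Bicategory.{w₁, v₁} A] [Strict A] : Strict Aᵒᵖ where
  id_comp f := congrArg Quiver.Hom.op (Strict.comp_id f.unop)
  comp_id f := congrArg Quiver.Hom.op (Strict.id_comp f.unop)
  assoc f g h := congrArg Quiver.Hom.op (Strict.assoc h.unop g.unop f.unop).symm
  leftUnitor_eqToIso f := by
    apply Iso.ext; apply unop2_inj; simp [Strict.rightUnitor_eqToIso]
  rightUnitor_eqToIso f := by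
    apply Iso.ext; apply unop2_inj; simp [Strict.leftUnitor_eqToIso]
  associator_eqToIso f g h := by
    apply Iso.ext; apply unop2_inj; simp [Strict.associator_eqToIso]

namespace Strict

variable {C : Type u₁} [Bicategory.{w₁, v₁} C] [Strict C] {a b c d : C}

lemma id_whiskerLeft' {f g : a ⟶ b} (η : f ⟶ g) :
    𝟙 a ◁ η = eqToHom (Strict.id_comp f) ≫ η ≫ eqToHom (Strict.id_comp g).symm := by
  simp [Strict.leftUnitor_eqToIso]

lemma whiskerRight_id' {f g : a ⟶ b} (η : f ⟶ g) :
    η ▷ 𝟙 b = eqToHom (Strict.comp_id f) ≫ η ≫ eqToHom (Strict.comp_id g).symm := by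
  simp [Strict.rightUnitor_eqToIso]

lemma comp_whiskerLeft' (f : a ⟶ b) (g : b ⟶ c) {h h' : c ⟶ d} (η : h ⟶ h') :
    (f ≫ g) ◁ η =
      eqToHom (Strict.assoc f g h) ≫ f ◁ g ◁ η ≫ eqToHom (Strict.assoc f g h').symm := by
  simp [Strict.associator_eqToIso]

lemma whiskerLeft_whiskerLeft (f : a ⟶ b) (g : b ⟶ c) {h h' : c ⟶ d} (η : h ⟶ h') :
    f ◁ g ◁ η =
      eqToHom (Strict.assoc f g h).symm ≫ (f ≫ g) ◁ η ≫ eqToHom (Strict.assoc f g h') := by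
  simp [Strict.associator_eqToIso]

lemma whisker_assoc' (f : a ⟶ b) {g g' : b ⟶ c} (η : g ⟶ g') (h : c ⟶ d) :
    (f ◁ η) ▷ h =
      eqToHom (Strict.assoc f g h) ≫ f ◁ (η ▷ h) ≫ eqToHom (Strict.assoc f g' h).symm := by
  simp [Strict.associator_eqToIso]

lemma whiskerLeft_whiskerRight (f : a ⟶ b) {g g' : b ⟶ c} (η : g ⟶ g') (h : c ⟶ d) :
    f ◁ (η ▷ h) =
      eqToHom (Strict.assoc f g h).symm ≫ (f ◁ η) ▷ h ≫ eqToHom (Strict.assoc f g' h) := by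
  simp [Strict.associator_eqToIso]

lemma whiskerRight_comp' {f f' : a ⟶ b} (η : f ⟶ f') (g : b ⟶ c) (h : c ⟶ d) :
    η ▷ (g ≫ h) =
      eqToHom (Strict.assoc f g h).symm ≫ (η ▷ g) ▷ h ≫ eqToHom (Strict.assoc f' g h) := by
  simp [Strict.associator_eqToIso]

lemma whiskerRight_whiskerRight {f f' : a ⟶ b} (η : f ⟶ f') (g : b ⟶ c) (h : c ⟶ d) :
    (η ▷ g) ▷ h =
      eqToHom (Strict.assoc f g h) ≫ η ▷ (g ≫ h) ≫ eqToHom (Strict.assoc f' g h).symm := by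
  simp [Strict.associator_eqToIso]

end Strict

lemma cat_hom_ext {C D : Cat.{v₁, u₁}} {F G : C ⟶ D}
    (h : ∀ x, F.toFunctor.obj x = G.toFunctor.obj x)
    (h' : ∀ (x y : C) (f : x ⟶ y),
      F.toFunctor.map f = eqToHom (h x) ≫ G.toFunctor.map f ≫ eqToHom (h y).symm) : F = G :=
  Cat.ext (CategoryTheory.Functor.ext h h')

lemma cat_cell_ext {C D : Cat.{v₁, u₁}} {F F' G G' : C ⟶ D} {η : F ⟶ G} {η' : F' ⟶ G'}
    (hF : F = F') (hG : G' = G)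
    (h : ∀ x : C, η.toNatTrans.app x = eqToHom (by rw [hF]) ≫ η'.toNatTrans.app x ≫
      eqToHom (by rw [hG])) : η = eqToHom hF ≫ η' ≫ eqToHom hG := by
  subst hF hG
  ext x
  simpa using h x

lemma cat_cell_ext₁ {C D : Cat.{v₁, u₁}} {F G G' : C ⟶ D} {η : F ⟶ G} {η' : F ⟶ G'}
    (hG : G' = G)
    (h : ∀ x : C, η.toNatTrans.app x = η'.toNatTrans.app x ≫ eqToHom (by rw [hG])) :
    η = η' ≫ eqToHom hG := by
  subst hG
  ext x
  simpa using h x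

lemma cat_cell_ext₀ {C D : Cat.{v₁, u₁}} {F G : C ⟶ D} {η η' : F ⟶ G}
    (h : ∀ x : C, η.toNatTrans.app x = η'.toNatTrans.app x) : η = η' := by
  ext x
  exact h x

variable {A : Type u} [Bicategory.{u, u} A]

lemma Presheaf.cell_ext {f g : Presheaf.{w} A} {φ φ' ψ ψ' : f ⟶ g} {m : φ ⟶ ψ} {m' : φ' ⟶ ψ'}
    (h : φ = φ') (h' : ψ' = ψ)
    (e : ∀ c, m.app c = eqToHom (by rw [h]) ≫ m'.app c ≫ eqToHom (by rw [h'])) :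
    m = eqToHom h ≫ m' ≫ eqToHom h' := by
  subst h h'
  ext c : 1
  simpa using e c

variable [Strict A]

/-- The contravariant hom-2-functor `A(-, a)`. -/
def homFunctor (a : A) : StrictPseudofunctor Aᵒᵖ Cat.{u, u} :=
  .mk'' {
    obj := fun c => Cat.of (c.unop ⟶ a)
    map := fun {c c'} u => (precomposingCat c'.unop c.unop a).obj u.unop
    map₂ := fun {c c'} _ _ η => (precomposingCat c'.unop c.unop a).map η.unop2
    map₂_id := fun _ => cat_cell_ext₀ fun x => id_whiskerRight _ x
    map₂_comp := fun _ _ => cat_cell_ext₀ fun x => comp_whiskerRight _ _ x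
    map_id := fun c => cat_hom_ext (fun x => Strict.id_comp x)
      fun x y f => Strict.id_whiskerLeft' f
    map_comp := fun {c c' c''} f g => cat_hom_ext (fun x => Strict.assoc g.unop f.unop x)
      fun x y α => Strict.comp_whiskerLeft' g.unop f.unop α
    map₂_whisker_left := fun {c c' c''} f g g' η => cat_cell_ext _ _
      fun x => Strict.whiskerRight_whiskerRight η.unop2 f.unop x
    map₂_whisker_right := fun {c c' c''} f f' η g => cat_cell_ext _ _
      fun x => Strict.whisker_assoc' g.unop η.unop2 x }

/-- The 2-natural transformation `A(-, a) ⟶ A(-, a')` given by postcomposition with `u`. -/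
def homTrans {a a' : A} (u : a ⟶ a') : TwoNat (homFunctor a) (homFunctor a') where
  app c := (postcomposingCat c.unop a a').obj u
  naturality f := cat_hom_ext (fun x => (Strict.assoc f.unop x u).symm)
    fun x y α => Strict.whiskerLeft_whiskerRight f.unop α u
  naturality₂ η := cat_cell_ext _ _ fun x => Strict.whiskerRight_comp' η.unop2 x u

/-- The modification given by postcomposition with a cell `η`. -/
def homMod {a a' : A} {u u' : a ⟶ a'} (η : u ⟶ u') : homTrans u ⟶ homTrans u' where
  app c := (postcomposingCat c.unop a a').map η
  naturality f := cat_cell_ext _ _ fun x => Strict.whiskerLeft_whiskerLeft f.unop x η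

section

variable (hA : ∀ a b : A, IsSmallCat.{w} (a ⟶ b))

/-- The representable 2-functor `A(-, a)` as an object of `Cat ^ Aᵒᵖ`. -/
def yonedaObj (a : A) : Presheaf.{w} A := ⟨homFunctor a, fun c => hA c.unop a⟩

/-- The 2-natural transformation of representables given by postcomposition with `u`. -/
def yonedaMap {a a' : A} (u : a ⟶ a') : yonedaObj hA a ⟶ yonedaObj hA a' := homTrans u

/-- The modification given by postcomposition with `η`. -/
def yonedaMap₂ {a a' : A} {u u' : a ⟶ a'} (η : u ⟶ u') : yonedaMap hA u ⟶ yonedaMap hA u' :=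
  homMod η

/-- The Yoneda 2-functor of a locally small 2-category. -/
def yonedaTwo : StrictPseudofunctor A (Presheaf.{w} A) :=
  .mk'' {
    obj := yonedaObj hA
    map := yonedaMap hA
    map₂ := yonedaMap₂ hA
    map₂_id := fun _ => TwoNat.hom_ext fun c => cat_cell_ext₀ fun x => whiskerLeft_id x _
    map₂_comp := fun _ _ => TwoNat.hom_ext fun c => cat_cell_ext₀ fun x => whiskerLeft_comp x _ _
    map_id := fun a => TwoNat.ext <| funext fun c =>
      cat_hom_ext (fun x => Strict.comp_id x) fun x y f => Strict.whiskerRight_id' f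
    map_comp := fun {a b c} f g => TwoNat.ext <| funext fun c =>
      cat_hom_ext (fun x => (Strict.assoc x f g).symm)
        fun x y α => Strict.whiskerRight_comp' α f g
    map₂_whisker_left := fun {a b c} f g g' η => Presheaf.cell_ext _ _ fun d =>
      cat_cell_ext _ _ fun x => Strict.whiskerLeft_whiskerLeft x f η
    map₂_whisker_right := fun {a b c} f f' η g => Presheaf.cell_ext _ _ fun d =>
      cat_cell_ext _ _ fun x => Strict.whiskerLeft_whiskerRight x η g }

end

lemma flip_eqToHom {C : Type u₁} [Category.{v₁} C] {a b c d : C} {X : c ⟶ d} {Y : a ⟶ b}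
    (h : a = c) (h' : d = b) (e : Y = eqToHom h ≫ X ≫ eqToHom h') :
    X = eqToHom h.symm ≫ Y ≫ eqToHom h'.symm := by
  subst h h'; simpa using e.symm

section

variable {C : Type u₁} [Bicategory.{w₁, v₁} C] (F : StrictPseudofunctor C Cat.{v₂, u₂})
  {a b c : C}

lemma map_comp_obj (f : a ⟶ b) (g : b ⟶ c) (x : F.obj a) :
    (F.map (f ≫ g)).toFunctor.obj x = (F.map g).toFunctor.obj ((F.map f).toFunctor.obj x) := by
  rw [F.map_comp]; rfl

lemma map_comp_map (f : a ⟶ b) (g : b ⟶ c) {x y : F.obj a} (s : x ⟶ y) :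
    (F.map (f ≫ g)).toFunctor.map s = eqToHom (map_comp_obj F f g x) ≫
      (F.map g).toFunctor.map ((F.map f).toFunctor.map s) ≫
        eqToHom (map_comp_obj F f g y).symm :=
  CategoryTheory.Functor.congr_hom (congrArg Cat.Hom.toFunctor (F.map_comp f g)) s

lemma map₂_whiskerRight_app {f f' : a ⟶ b} (η : f ⟶ f') (g : b ⟶ c) (x : F.obj a) :
    (F.map₂ (η ▷ g)).toNatTrans.app x = eqToHom (map_comp_obj F f g x) ≫
      (F.map g).toFunctor.map ((F.map₂ η).toNatTrans.app x) ≫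
        eqToHom (map_comp_obj F f' g x).symm := by
  rw [F.map₂_whisker_right, F.mapComp_eq_eqToIso, F.mapComp_eq_eqToIso]
  simp

lemma map₂_whiskerLeft_app (f : a ⟶ b) {g g' : b ⟶ c} (η : g ⟶ g') (x : F.obj a) :
    (F.map₂ (f ◁ η)).toNatTrans.app x = eqToHom (map_comp_obj F f g x) ≫
      (F.map₂ η).toNatTrans.app ((F.map f).toFunctor.obj x) ≫
        eqToHom (map_comp_obj F f g' x).symm := by
  rw [F.map₂_whisker_left, F.mapComp_eq_eqToIso, F.mapComp_eq_eqToIso]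
  simp

end

/-- The 2-natural transformation `(-)^* i : y a ⟶ f` that is given by `u ↦ u^* i = f u i`. -/
def yonedaInv (f : Presheaf.{w} A) (a : A) (i : f.functor.obj (op a)) :
    TwoNat (homFunctor a) f.functor where
  app c := Functor.toCatHom (C := c.unop ⟶ a) (D := f.functor.obj c)
    { obj := fun u => (f.functor.map u.op).toFunctor.obj i
      map := fun α => (f.functor.map₂ (op2 α)).toNatTrans.app i }
  naturality {c d} u := cat_hom_ext
    (fun x => (map_comp_obj f.functor (Quiver.Hom.op x) u i).symm)
    fun x y α => by
      have h := map₂_whiskerRight_app f.functor (op2 (f := x) (g := y) α) u i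
      exact flip_eqToHom _ _ h
  naturality₂ {c d u u'} η := cat_cell_ext _ _ fun x => by
    have h := map₂_whiskerLeft_app f.functor (Quiver.Hom.op x) η i
    exact flip_eqToHom _ _ h

/-- The modification `(-)^* s : (-)^* i ⟶ (-)^* j`. -/
def yonedaInvMap (f : Presheaf.{w} A) (a : A) {i j : f.functor.obj (op a)} (s : i ⟶ j) :
    yonedaInv f a i ⟶ yonedaInv f a j where
  app c := NatTrans.toCatHom₂ (C := c.unop ⟶ a) (D := f.functor.obj c)
    { app := fun u => (f.functor.map u.op).toFunctor.map s }
  naturality {c d} u := cat_cell_ext _ _ fun x => by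
    have h := map_comp_map f.functor (Quiver.Hom.op x) u s
    exact flip_eqToHom _ _ h

end Yoneda

section Cells

variable {C : Type u₁} [Bicategory.{w₁, v₁} C] {D : Type u₂} [Bicategory.{w₂, v₂} D]

lemma IsIdCell.ofEq {a b : C} {f g : a ⟶ b} (h : f = g) : IsIdCell (eqToHom h) := ⟨h, rfl⟩

lemma IsIdCell.comp {a b : C} {f g k : a ⟶ b} {σ : f ⟶ g} {τ : g ⟶ k} (hσ : IsIdCell σ)
    (hτ : IsIdCell τ) : IsIdCell (σ ≫ τ) := by
  obtain ⟨rfl, rfl⟩ := hσ; obtain ⟨rfl, rfl⟩ := hτ; exact ⟨rfl, by simp⟩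

lemma IsIdCell.whiskerLeft {a b c : C} (f : a ⟶ b) {g k : b ⟶ c} {σ : g ⟶ k}
    (hσ : IsIdCell σ) : IsIdCell (f ◁ σ) := by
  obtain ⟨rfl, rfl⟩ := hσ; exact ⟨rfl, by simp⟩

lemma IsIdCell.whiskerRight {a b c : C} {f g : a ⟶ b} {σ : f ⟶ g} (hσ : IsIdCell σ)
    (k : b ⟶ c) : IsIdCell (σ ▷ k) := by
  obtain ⟨rfl, rfl⟩ := hσ; exact ⟨rfl, by simp⟩

lemma IsIdCell.of_comp_left {a b : C} {f g k : a ⟶ b} {σ : f ⟶ g} {τ : g ⟶ k}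
    (hσ : IsIdCell σ) (h : IsIdCell (σ ≫ τ)) : IsIdCell τ := by
  obtain ⟨rfl, rfl⟩ := hσ; simpa using h

lemma IsIdCell.of_comp_right {a b : C} {f g k : a ⟶ b} {σ : f ⟶ g} {τ : g ⟶ k}
    (hτ : IsIdCell τ) (h : IsIdCell (σ ≫ τ)) : IsIdCell σ := by
  obtain ⟨rfl, rfl⟩ := hτ; simpa using h

lemma IsIdCell.map₂ (F : StrictPseudofunctor C D) {a b : C} {f g : a ⟶ b} {σ : f ⟶ g}
    (hσ : IsIdCell σ) : IsIdCell (F.map₂ σ) := by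
  obtain ⟨rfl, rfl⟩ := hσ; exact ⟨rfl, by simp⟩

lemma IsIdCell.map₂_whiskerLeft (F : StrictPseudofunctor C D) {a b c : C} (f : a ⟶ b)
    {g k : b ⟶ c} {σ : g ⟶ k} (hσ : IsIdCell (F.map₂ σ)) : IsIdCell (F.map₂ (f ◁ σ)) := by
  rw [F.map₂_whisker_left, F.mapComp_eq_eqToIso, F.mapComp_eq_eqToIso]
  exact (IsIdCell.ofEq (F.map_comp _ _)).comp
    ((hσ.whiskerLeft _).comp (IsIdCell.ofEq (F.map_comp _ _).symm))

lemma IsIdCell.map₂_whiskerRight (F : StrictPseudofunctor C D) {a b c : C} {f g : a ⟶ b}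
    {σ : f ⟶ g} (hσ : IsIdCell (F.map₂ σ)) (k : b ⟶ c) : IsIdCell (F.map₂ (σ ▷ k)) := by
  rw [F.map₂_whisker_right, F.mapComp_eq_eqToIso, F.mapComp_eq_eqToIso]
  exact (IsIdCell.ofEq (F.map_comp _ _)).comp
    ((hσ.whiskerRight _).comp (IsIdCell.ofEq (F.map_comp _ _).symm))

lemma IsIdCell.map₂_comp (F : StrictPseudofunctor C D) {a b : C} {f g k : a ⟶ b}
    {σ : f ⟶ g} {τ : g ⟶ k} (hσ : IsIdCell (F.map₂ σ)) (hτ : IsIdCell (F.map₂ τ)) :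
    IsIdCell (F.map₂ (σ ≫ τ)) := by
  rw [F.map₂_comp]; exact hσ.comp hτ

lemma heq_comp₂ {a a' b b' : C} (ha : a = a') (hb : b = b') {f g k : a ⟶ b}
    {f' g' k' : a' ⟶ b'} (hf : f ≍ f') (hg : g ≍ g') (hk : k ≍ k') {σ : f ⟶ g} {σ' : f' ⟶ g'}
    {τ : g ⟶ k} {τ' : g' ⟶ k'} (hσ : σ ≍ σ') (hτ : τ ≍ τ') : σ ≫ τ ≍ σ' ≫ τ' := by
  subst ha hb hf hg hk hσ hτ; rfl

lemma heq_whiskerLeft {a a' b b' c c' : C} (ha : a = a') (hb : b = b') (hc : c = c')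
    {f : a ⟶ b} {f' : a' ⟶ b'} {g k : b ⟶ c} {g' k' : b' ⟶ c'} (hf : f ≍ f') (hg : g ≍ g')
    (hk : k ≍ k') {σ : g ⟶ k} {σ' : g' ⟶ k'} (hσ : σ ≍ σ') : f ◁ σ ≍ f' ◁ σ' := by
  subst ha hb hc hf hg hk hσ; rfl

lemma heq_whiskerRight {a a' b b' c c' : C} (ha : a = a') (hb : b = b') (hc : c = c')
    {f g : a ⟶ b} {f' g' : a' ⟶ b'} {k : b ⟶ c} {k' : b' ⟶ c'} (hf : f ≍ f') (hg : g ≍ g')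
    (hk : k ≍ k') {σ : f ⟶ g} {σ' : f' ⟶ g'} (hσ : σ ≍ σ') : σ ▷ k ≍ σ' ▷ k' := by
  subst ha hb hc hf hg hk hσ; rfl

lemma map₂_eqToHom_comp_heq (F : StrictPseudofunctor C D) {a b : C} {f g k : a ⟶ b}
    (h : f = g) (σ : g ⟶ k) : F.map₂ (eqToHom h ≫ σ) ≍ F.map₂ σ := by
  subst h; simp

lemma map₂_comp_eqToHom_heq (F : StrictPseudofunctor C D) {a b : C} {f g k : a ⟶ b}
    (σ : f ⟶ g) (h : g = k) : F.map₂ (σ ≫ eqToHom h) ≍ F.map₂ σ := by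
  subst h; simp

lemma map₂_whiskerLeft_heq (F : StrictPseudofunctor C D) {a b c : C} (f : a ⟶ b)
    {g k : b ⟶ c} (σ : g ⟶ k) : F.map₂ (f ◁ σ) ≍ F.map f ◁ F.map₂ σ := by
  rw [F.map₂_whisker_left, F.mapComp_eq_eqToIso, F.mapComp_eq_eqToIso]
  simp

lemma map₂_whiskerRight_heq (F : StrictPseudofunctor C D) {a b c : C} {f g : a ⟶ b}
    (σ : f ⟶ g) (k : b ⟶ c) : F.map₂ (σ ▷ k) ≍ F.map₂ σ ▷ F.map k := by
  rw [F.map₂_whisker_right, F.mapComp_eq_eqToIso, F.mapComp_eq_eqToIso]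
  simp

variable [Strict D]

lemma conj_heq {a a' b b' : D} (ha : a = a') (hb : b' = b) (f : a' ⟶ b') :
    eqToHom ha ≫ f ≫ eqToHom hb ≍ f := by
  subst ha hb; simp

lemma eqToHom_whiskerLeft_heq {a b c : D} (h : a = b) {g k : b ⟶ c} (σ : g ⟶ k) :
    eqToHom h ◁ σ ≍ σ := by
  subst h; exact (heq_of_eq (Strict.id_whiskerLeft' σ)).trans (by simp)

lemma whiskerRight_eqToHom_heq {a b c : D} {g k : a ⟶ b} (σ : g ⟶ k) (h : b = c) :
    σ ▷ eqToHom h ≍ σ := by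
  subst h; exact (heq_of_eq (Strict.whiskerRight_id' σ)).trans (by simp)

lemma map₂_whiskerLeft_heq_of_id (F : StrictPseudofunctor C D) {a b c : C} (f : a ⟶ b)
    (h : F.obj a = F.obj b) (hf : F.map f = eqToHom h) {g k : b ⟶ c} (σ : g ⟶ k) :
    F.map₂ (f ◁ σ) ≍ F.map₂ σ := by
  refine (map₂_whiskerLeft_heq F f σ).trans ?_
  rw [hf]
  exact eqToHom_whiskerLeft_heq h _

lemma map₂_whiskerRight_heq_of_id (F : StrictPseudofunctor C D) {a b c : C} {g k : a ⟶ b}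
    (σ : g ⟶ k) (f : b ⟶ c) (h : F.obj b = F.obj c) (hf : F.map f = eqToHom h) :
    F.map₂ (σ ▷ f) ≍ F.map₂ σ := by
  refine (map₂_whiskerRight_heq F σ f).trans ?_
  rw [hf]
  exact whiskerRight_eqToHom_heq _ h

end Cells

noncomputable section Fibres

variable {J : Type u₁} [Bicategory.{w₁, v₁} J] [Strict J]
  {A : Type u₂} [Bicategory.{w₂, v₂} A] [Strict A]
  {B : Type u₃} [Bicategory.{w₃, v₃} B] [Strict B]

/-- The objects of the fibre of the span `A ⟵ J ⟶ B` at `(a, b)`. -/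
@[ext]
structure Fibre (p : StrictPseudofunctor J A) (q : StrictPseudofunctor J B) (a : A) (b : B) where
  obj : J
  left : p.obj obj = a
  right : q.obj obj = b

/-- The morphisms of the fibre of the span `A ⟵ J ⟶ B` at `(a, b)`, i.e. those that are mapped to
the identity morphisms of `a` and `b`. -/
@[ext]
structure FibreHom {p : StrictPseudofunctor J A} {q : StrictPseudofunctor J B} {a : A} {b : B}
    (x y : Fibre p q a b) where
  hom : x.obj ⟶ y.obj
  left : p.map hom = eqToHom (x.left.trans y.left.symm)
  right : q.map hom = eqToHom (x.right.trans y.right.symm)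

variable {p : StrictPseudofunctor J A} {q : StrictPseudofunctor J B} {a a' a'' : A} {b b' b'' : B}

@[simp] lemma map_eqToHom (F : StrictPseudofunctor J A) {i j : J} (h : i = j) :
    F.map (eqToHom h) = eqToHom (congrArg F.obj h) := by
  subst h; simp [F.map_id]

instance : Category (Fibre p q a b) where
  Hom := FibreHom
  id x := ⟨𝟙 x.obj, by simp [p.map_id], by simp [q.map_id]⟩
  comp f g := ⟨f.hom ≫ g.hom, by simp [p.map_comp, f.left, g.left],
    by simp [q.map_comp, f.right, g.right]⟩

namespace Fibre

@[ext] lemma hom_ext {x y : Fibre p q a b} {f g : x ⟶ y} (h : f.hom = g.hom) : f = g :=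
  FibreHom.ext h
@[simp] lemma id_hom (x : Fibre p q a b) : FibreHom.hom (𝟙 x) = 𝟙 x.obj := rfl
@[simp] lemma comp_hom {x y z : Fibre p q a b} (f : x ⟶ y) (g : y ⟶ z) :
    FibreHom.hom (f ≫ g) = f.hom ≫ g.hom := rfl
@[simp] lemma eqToHom_hom {x y : Fibre p q a b} (h : x = y) :
    FibreHom.hom (eqToHom h) = eqToHom (congrArg Fibre.obj h) := by
  subst h; rfl

/-- A morphism of `J` between objects in fibres lies over `u` in `A` and `v` in `B`. -/
structure Over {x : Fibre p q a b} {y : Fibre p q a' b'} (s : x.obj ⟶ y.obj) (u : a ⟶ a')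
    (v : b ⟶ b') : Prop where
  left : p.map s = eqToHom x.left ≫ u ≫ eqToHom y.left.symm
  right : q.map s = eqToHom x.right ≫ v ≫ eqToHom y.right.symm

lemma Over.comp {x : Fibre p q a b} {y : Fibre p q a' b'} {z : Fibre p q a'' b''}
    {s : x.obj ⟶ y.obj} {t : y.obj ⟶ z.obj} {u : a ⟶ a'} {u' : a' ⟶ a''} {v : b ⟶ b'}
    {v' : b' ⟶ b''} (hs : Over s u v) (ht : Over t u' v') : Over (s ≫ t) (u ≫ u') (v ≫ v') :=
  ⟨by simp [p.map_comp, hs.left, ht.left], by simp [q.map_comp, hs.right, ht.right]⟩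

lemma over_hom {x y : Fibre p q a b} (f : x ⟶ y) : Over f.hom (𝟙 a) (𝟙 b) :=
  ⟨by simp [f.left], by simp [f.right]⟩

lemma Over.congr {x : Fibre p q a b} {y : Fibre p q a' b'} {s : x.obj ⟶ y.obj} {u u' : a ⟶ a'}
    {v v' : b ⟶ b'} (hs : Over s u v) (hu : u = u') (hv : v = v') : Over s u' v' := by
  subst hu hv; exact hs

lemma Over.left_heq {x : Fibre p q a b} {y : Fibre p q a' b'} {s : x.obj ⟶ y.obj} {u : a ⟶ a'}
    {v : b ⟶ b'} (hs : Over s u v) : p.map s ≍ u :=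
  (heq_of_eq hs.left).trans (conj_heq _ _ _)

lemma Over.right_heq {x : Fibre p q a b} {y : Fibre p q a' b'} {s : x.obj ⟶ y.obj} {u : a ⟶ a'}
    {v : b ⟶ b'} (hs : Over s u v) : q.map s ≍ v :=
  (heq_of_eq hs.right).trans (conj_heq _ _ _)

end Fibre

namespace SplitTwoSidedTwoFibration

open Fibre

variable (K : SplitTwoSidedTwoFibration p q)

/-- The object `u^* x` of the fibre at `(a', b)`. -/
@[reducible, simps]
def pullObj (u : a' ⟶ a) (x : Fibre p q a b) : Fibre p q a' b where
  obj := K.pull x.obj (u ≫ eqToHom x.left.symm)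
  left := K.obj_pull _ _
  right := (K.q_pull _ _).trans x.right

/-- The object `v_! x` of the fibre at `(a, b')`. -/
@[reducible, simps]
def pushObj (v : b ⟶ b') (x : Fibre p q a b) : Fibre p q a b' where
  obj := K.push x.obj (eqToHom x.right ≫ v)
  left := (K.p_push _ _).trans x.left
  right := K.obj_push _ _

/-- The lift `u^* x ⟶ x`. -/
def lamHom (u : a' ⟶ a) (x : Fibre p q a b) : (K.pullObj u x).obj ⟶ x.obj :=
  K.lam x.obj (u ≫ eqToHom x.left.symm)

/-- The lift `x ⟶ v_! x`. -/
def rhoHom (v : b ⟶ b') (x : Fibre p q a b) : x.obj ⟶ (K.pushObj v x).obj :=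
  K.rho x.obj (eqToHom x.right ≫ v)

lemma over_lamHom (u : a' ⟶ a) (x : Fibre p q a b) : Over (K.lamHom u x) u (𝟙 b) :=
  ⟨by simp [lamHom, K.map_lam], by simp [lamHom, K.q_lam]⟩

lemma over_rhoHom (v : b ⟶ b') (x : Fibre p q a b) : Over (K.rhoHom v x) (𝟙 a) v :=
  ⟨by simp [rhoHom, K.p_rho], by simp [rhoHom, K.map_rho]⟩

lemma existsUnique_lam (u : a' ⟶ a) (x : Fibre p q a b) {b' : B} {v : b' ⟶ b}
    {z : Fibre p q a' b'} (s : z.obj ⟶ x.obj) (hs : Over s u v) :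
    ∃! t : z.obj ⟶ (K.pullObj u x).obj, Over t (𝟙 a') v ∧ t ≫ K.lamHom u x = s := by
  obtain ⟨t, ⟨h₁, h₂⟩, h₃⟩ := K.lam_cartesian x.obj (u ≫ eqToHom x.left.symm) s
    (eqToHom (z.left.trans (K.pullObj u x).left.symm)) (by simp [hs.left, K.map_lam])
  refine ⟨t, ⟨⟨by simp [h₁], ?_⟩, h₂⟩, fun t' ⟨ht, ht'⟩ => h₃ t' ⟨by simp [ht.left], ht'⟩⟩
  have h := hs.right
  rw [← h₂, q.map_comp, K.q_lam] at h
  rw [← cancel_mono (eqToHom (K.q_pull x.obj (u ≫ eqToHom x.left.symm)))]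
  simpa using h

lemma existsUnique_rho (v : b ⟶ b') (x : Fibre p q a b) {a' : A} {u : a ⟶ a'}
    {z : Fibre p q a' b'} (s : x.obj ⟶ z.obj) (hs : Over s u v) :
    ∃! t : (K.pushObj v x).obj ⟶ z.obj, Over t u (𝟙 b') ∧ K.rhoHom v x ≫ t = s := by
  obtain ⟨t, ⟨h₁, h₂⟩, h₃⟩ := K.rho_opcartesian x.obj (eqToHom x.right ≫ v) s
    (eqToHom ((K.pushObj v x).right.trans z.right.symm)) (by simp [hs.right, K.map_rho])
  refine ⟨t, ⟨⟨?_, by simp [h₁]⟩, h₂⟩, fun t' ⟨ht, ht'⟩ => h₃ t' ⟨by simp [ht.right], ht'⟩⟩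
  have h := hs.left
  rw [← h₂, p.map_comp, K.p_rho] at h
  rw [← cancel_epi (eqToHom (K.p_push x.obj (eqToHom x.right ≫ v)).symm)]
  simpa using h

/-- The factorisation through the lift `u^* x ⟶ x`. -/
def lamLift (u : a' ⟶ a) {x : Fibre p q a b} {z : Fibre p q a' b} (s : z.obj ⟶ x.obj)
    (hs : Over s u (𝟙 b)) : z ⟶ K.pullObj u x where
  hom := (K.existsUnique_lam u x s hs).choose
  left := (K.existsUnique_lam u x s hs).choose_spec.1.1.left.trans (by simp)
  right := (K.existsUnique_lam u x s hs).choose_spec.1.1.right.trans (by simp)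

/-- The factorisation through the lift `x ⟶ v_! x`. -/
def rhoLift (v : b ⟶ b') {x : Fibre p q a b} {z : Fibre p q a b'} (s : x.obj ⟶ z.obj)
    (hs : Over s (𝟙 a) v) : K.pushObj v x ⟶ z where
  hom := (K.existsUnique_rho v x s hs).choose
  left := (K.existsUnique_rho v x s hs).choose_spec.1.1.left.trans (by simp)
  right := (K.existsUnique_rho v x s hs).choose_spec.1.1.right.trans (by simp)

@[simp] lemma lamLift_lam (u : a' ⟶ a) {x : Fibre p q a b} {z : Fibre p q a' b}
    (s : z.obj ⟶ x.obj) (hs : Over s u (𝟙 b)) : (K.lamLift u s hs).hom ≫ K.lamHom u x = s :=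
  (K.existsUnique_lam u x s hs).choose_spec.1.2

@[simp] lemma rho_rhoLift (v : b ⟶ b') {x : Fibre p q a b} {z : Fibre p q a b'}
    (s : x.obj ⟶ z.obj) (hs : Over s (𝟙 a) v) : K.rhoHom v x ≫ (K.rhoLift v s hs).hom = s :=
  (K.existsUnique_rho v x s hs).choose_spec.1.2

lemma lam_unique {u : a' ⟶ a} {x : Fibre p q a b} {z : Fibre p q a' b}
    {f g : z ⟶ K.pullObj u x} (h : f.hom ≫ K.lamHom u x = g.hom ≫ K.lamHom u x) : f = g :=
  hom_ext ((K.existsUnique_lam u x (v := 𝟙 b) (g.hom ≫ K.lamHom u x)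
    (((over_hom g).comp (K.over_lamHom u x)).congr (by simp) (by simp))).unique
      ⟨over_hom f, h⟩ ⟨over_hom g, rfl⟩)

lemma rho_unique {v : b ⟶ b'} {x : Fibre p q a b} {z : Fibre p q a b'}
    {f g : K.pushObj v x ⟶ z} (h : K.rhoHom v x ≫ f.hom = K.rhoHom v x ≫ g.hom) : f = g :=
  hom_ext ((K.existsUnique_rho v x (u := 𝟙 a) (K.rhoHom v x ≫ g.hom)
    (((K.over_rhoHom v x).comp (over_hom g)).congr (by simp) (by simp))).unique
      ⟨over_hom f, h⟩ ⟨over_hom g, rfl⟩)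

/-- The functor `u^*` between fibres. -/
@[reducible, simps! obj]
def pullFunctor (b : B) (u : a' ⟶ a) : Fibre p q a b ⥤ Fibre p q a' b where
  obj x := K.pullObj u x
  map {x y} f := K.lamLift u (K.lamHom u x ≫ f.hom)
    (((K.over_lamHom u x).comp (over_hom f)).congr (by simp) (by simp))
  map_id x := K.lam_unique (by simp)
  map_comp f g := K.lam_unique (by
    simp only [lamLift_lam, comp_hom, Category.assoc]
    rw [← Category.assoc, ← Category.assoc, lamLift_lam, Category.assoc])

/-- The functor `v_!` between fibres. -/
@[reducible, simps! obj]
def pushFunctor (a : A) (v : b ⟶ b') : Fibre p q a b ⥤ Fibre p q a b' where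
  obj x := K.pushObj v x
  map {x y} f := K.rhoLift v (f.hom ≫ K.rhoHom v y)
    (((over_hom f).comp (K.over_rhoHom v y)).congr (by simp) (by simp))
  map_id x := K.rho_unique (by simp)
  map_comp f g := K.rho_unique (by
    simp only [rho_rhoLift, comp_hom, Category.assoc]
    rw [← Category.assoc (K.rhoHom _ _), rho_rhoLift, Category.assoc, rho_rhoLift])

lemma pull_map_lam (u : a' ⟶ a) {x y : Fibre p q a b} (f : x ⟶ y) :
    ((K.pullFunctor b u).map f).hom ≫ K.lamHom u y = K.lamHom u x ≫ f.hom :=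
  K.lamLift_lam _ _ (((K.over_lamHom u x).comp (over_hom f)).congr (by simp) (by simp))

lemma rho_push_map (v : b ⟶ b') {x y : Fibre p q a b} (f : x ⟶ y) :
    K.rhoHom v x ≫ ((K.pushFunctor a v).map f).hom = f.hom ≫ K.rhoHom v y :=
  K.rho_rhoLift _ _ (((over_hom f).comp (K.over_rhoHom v y)).congr (by simp) (by simp))

end SplitTwoSidedTwoFibration

end Fibres

noncomputable section Currying

variable {J : Type u₁} [Bicategory.{w₁, v₁} J] [Strict J]
  {A : Type u₂} [Bicategory.{w₂, v₂} A] [Strict A]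
  {B : Type u₃} [Bicategory.{w₃, v₃} B] [Strict B]
  {p : StrictPseudofunctor J A} {q : StrictPseudofunctor J B} {a a' a'' : A} {b b' b'' : B}

namespace Fibre

/-- There is a cell `s ⟶ t` that lies over `α` in `A` and over the identity of `v` in `B`. -/
structure CellL {x : Fibre p q a b} {y : Fibre p q a' b'} (s t : x.obj ⟶ y.obj) {u u' : a ⟶ a'}
    (α : u ⟶ u') (v : b ⟶ b') : Prop where
  source : Over s u v
  target : Over t u' v
  cell : ∃ σ : s ⟶ t, p.map₂ σ ≍ α ∧ IsIdCell (q.map₂ σ)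

/-- There is a cell `s ⟶ t` that lies over the identity of `u` in `A` and over `β` in `B`. -/
structure CellR {x : Fibre p q a b} {y : Fibre p q a' b'} (s t : x.obj ⟶ y.obj) (u : a ⟶ a')
    {v v' : b ⟶ b'} (β : v ⟶ v') : Prop where
  source : Over s u v
  target : Over t u v'
  cell : ∃ σ : s ⟶ t, IsIdCell (p.map₂ σ) ∧ q.map₂ σ ≍ β

lemma over_iff {i j : J} {s : i ⟶ j} {u : p.obj i ⟶ p.obj j} {v : q.obj i ⟶ q.obj j} :
    Over (x := ⟨i, rfl, rfl⟩) (y := ⟨j, rfl, rfl⟩) s u v ↔ p.map s = u ∧ q.map s = v :=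
  ⟨fun h => ⟨by simpa using h.left, by simpa using h.right⟩,
    fun h => ⟨by simpa using h.1, by simpa using h.2⟩⟩

lemma CellL.id {x : Fibre p q a b} {y : Fibre p q a' b'} {s : x.obj ⟶ y.obj} {u : a ⟶ a'}
    {v : b ⟶ b'} (hs : Over s u v) : CellL s s (𝟙 u) v := by
  obtain ⟨i, rfl, rfl⟩ := x
  obtain ⟨j, rfl, rfl⟩ := y
  obtain ⟨rfl, rfl⟩ := over_iff.1 hs
  exact ⟨hs, hs, 𝟙 _, by simp, by simpa using IsIdCell.ofEq rfl⟩

lemma CellL.comp {x : Fibre p q a b} {y : Fibre p q a' b'} {s t r : x.obj ⟶ y.obj}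
    {u u' u'' : a ⟶ a'} {α : u ⟶ u'} {α' : u' ⟶ u''} {v : b ⟶ b'} (h : CellL s t α v)
    (h' : CellL t r α' v) : CellL s r (α ≫ α') v := by
  obtain ⟨i, rfl, rfl⟩ := x
  obtain ⟨j, rfl, rfl⟩ := y
  obtain ⟨rfl, rfl⟩ := over_iff.1 h.source
  obtain ⟨rfl, -⟩ := over_iff.1 h.target
  obtain ⟨rfl, -⟩ := over_iff.1 h'.target
  obtain ⟨σ, hσ, k⟩ := h.cell
  obtain ⟨σ', hσ', k'⟩ := h'.cell
  obtain rfl := eq_of_heq hσ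
  obtain rfl := eq_of_heq hσ'
  exact ⟨h.source, h'.target, σ ≫ σ', by simp, k.map₂_comp q k'⟩

lemma CellL.whiskerRight {x : Fibre p q a b} {y : Fibre p q a' b'} {z : Fibre p q a'' b''}
    {s t : x.obj ⟶ y.obj} {u u' : a ⟶ a'} {α : u ⟶ u'} {v : b ⟶ b'} (h : CellL s t α v)
    {k : y.obj ⟶ z.obj} {l : a' ⟶ a''} {m : b' ⟶ b''} (hk : Over k l m) :
    CellL (s ≫ k) (t ≫ k) (α ▷ l) (v ≫ m) := by
  obtain ⟨i, rfl, rfl⟩ := x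
  obtain ⟨j, rfl, rfl⟩ := y
  obtain ⟨j', rfl, rfl⟩ := z
  obtain ⟨rfl, rfl⟩ := over_iff.1 h.source
  obtain ⟨rfl, -⟩ := over_iff.1 h.target
  obtain ⟨rfl, rfl⟩ := over_iff.1 hk
  obtain ⟨σ, hσ, e⟩ := h.cell
  obtain rfl := eq_of_heq hσ
  exact ⟨h.source.comp hk, h.target.comp hk, σ ▷ k, map₂_whiskerRight_heq p σ k,
    e.map₂_whiskerRight q k⟩

lemma CellL.whiskerLeft {x : Fibre p q a b} {y : Fibre p q a' b'} {z : Fibre p q a'' b''}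
    {s t : y.obj ⟶ z.obj} {u u' : a' ⟶ a''} {α : u ⟶ u'} {v : b' ⟶ b''} (h : CellL s t α v)
    {k : x.obj ⟶ y.obj} {l : a ⟶ a'} {m : b ⟶ b'} (hk : Over k l m) :
    CellL (k ≫ s) (k ≫ t) (l ◁ α) (m ≫ v) := by
  obtain ⟨i, rfl, rfl⟩ := x
  obtain ⟨j, rfl, rfl⟩ := y
  obtain ⟨j', rfl, rfl⟩ := z
  obtain ⟨rfl, rfl⟩ := over_iff.1 h.source
  obtain ⟨rfl, -⟩ := over_iff.1 h.target
  obtain ⟨rfl, rfl⟩ := over_iff.1 hk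
  obtain ⟨σ, hσ, e⟩ := h.cell
  obtain rfl := eq_of_heq hσ
  exact ⟨hk.comp h.source, hk.comp h.target, k ◁ σ, map₂_whiskerLeft_heq p k σ,
    e.map₂_whiskerLeft q k⟩

lemma CellL.congr {x : Fibre p q a b} {y : Fibre p q a' b'} {s t : x.obj ⟶ y.obj}
    {u u' l l' : a ⟶ a'} {α : u ⟶ u'} {v m : b ⟶ b'} (h : CellL s t α v) {α' : l ⟶ l'}
    (hu : u = l) (hu' : u' = l') (hα : α ≍ α') (hv : v = m) : CellL s t α' m := by
  subst hu hu' hα hv; exact h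

lemma CellL.eq {x : Fibre p q a b} {y : Fibre p q a' b'} {s t s' t' : x.obj ⟶ y.obj}
    {u u' : a ⟶ a'} {α : u ⟶ u'} {v : b ⟶ b'} (h : CellL s t α v) (hs : s = s') (ht : t = t') :
    CellL s' t' α v := by
  subst hs ht; exact h

lemma CellR.id {x : Fibre p q a b} {y : Fibre p q a' b'} {s : x.obj ⟶ y.obj} {u : a ⟶ a'}
    {v : b ⟶ b'} (hs : Over s u v) : CellR s s u (𝟙 v) := by
  obtain ⟨i, rfl, rfl⟩ := x
  obtain ⟨j, rfl, rfl⟩ := y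
  obtain ⟨rfl, rfl⟩ := over_iff.1 hs
  exact ⟨hs, hs, 𝟙 _, by simpa using IsIdCell.ofEq rfl, by simp⟩

lemma CellR.comp {x : Fibre p q a b} {y : Fibre p q a' b'} {s t r : x.obj ⟶ y.obj}
    {v v' v'' : b ⟶ b'} {β : v ⟶ v'} {β' : v' ⟶ v''} {u : a ⟶ a'} (h : CellR s t u β)
    (h' : CellR t r u β') : CellR s r u (β ≫ β') := by
  obtain ⟨i, rfl, rfl⟩ := x
  obtain ⟨j, rfl, rfl⟩ := y
  obtain ⟨rfl, rfl⟩ := over_iff.1 h.source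
  obtain ⟨-, rfl⟩ := over_iff.1 h.target
  obtain ⟨-, rfl⟩ := over_iff.1 h'.target
  obtain ⟨σ, k, hσ⟩ := h.cell
  obtain ⟨σ', k', hσ'⟩ := h'.cell
  obtain rfl := eq_of_heq hσ
  obtain rfl := eq_of_heq hσ'
  exact ⟨h.source, h'.target, σ ≫ σ', k.map₂_comp p k', by simp⟩

lemma CellR.whiskerRight {x : Fibre p q a b} {y : Fibre p q a' b'} {z : Fibre p q a'' b''}
    {s t : x.obj ⟶ y.obj} {v v' : b ⟶ b'} {β : v ⟶ v'} {u : a ⟶ a'} (h : CellR s t u β)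
    {k : y.obj ⟶ z.obj} {l : a' ⟶ a''} {m : b' ⟶ b''} (hk : Over k l m) :
    CellR (s ≫ k) (t ≫ k) (u ≫ l) (β ▷ m) := by
  obtain ⟨i, rfl, rfl⟩ := x
  obtain ⟨j, rfl, rfl⟩ := y
  obtain ⟨j', rfl, rfl⟩ := z
  obtain ⟨rfl, rfl⟩ := over_iff.1 h.source
  obtain ⟨-, rfl⟩ := over_iff.1 h.target
  obtain ⟨rfl, rfl⟩ := over_iff.1 hk
  obtain ⟨σ, e, hσ⟩ := h.cell
  obtain rfl := eq_of_heq hσ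
  exact ⟨h.source.comp hk, h.target.comp hk, σ ▷ k, e.map₂_whiskerRight p k,
    map₂_whiskerRight_heq q σ k⟩

lemma CellR.whiskerLeft {x : Fibre p q a b} {y : Fibre p q a' b'} {z : Fibre p q a'' b''}
    {s t : y.obj ⟶ z.obj} {v v' : b' ⟶ b''} {β : v ⟶ v'} {u : a' ⟶ a''} (h : CellR s t u β)
    {k : x.obj ⟶ y.obj} {l : a ⟶ a'} {m : b ⟶ b'} (hk : Over k l m) :
    CellR (k ≫ s) (k ≫ t) (l ≫ u) (m ◁ β) := by
  obtain ⟨i, rfl, rfl⟩ := x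
  obtain ⟨j, rfl, rfl⟩ := y
  obtain ⟨j', rfl, rfl⟩ := z
  obtain ⟨rfl, rfl⟩ := over_iff.1 h.source
  obtain ⟨-, rfl⟩ := over_iff.1 h.target
  obtain ⟨rfl, rfl⟩ := over_iff.1 hk
  obtain ⟨σ, e, hσ⟩ := h.cell
  obtain rfl := eq_of_heq hσ
  exact ⟨hk.comp h.source, hk.comp h.target, k ◁ σ, e.map₂_whiskerLeft p k,
    map₂_whiskerLeft_heq q k σ⟩

lemma CellR.congr {x : Fibre p q a b} {y : Fibre p q a' b'} {s t : x.obj ⟶ y.obj}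
    {v v' m m' : b ⟶ b'} {β : v ⟶ v'} {u l : a ⟶ a'} (h : CellR s t u β) {β' : m ⟶ m'}
    (hv : v = m) (hv' : v' = m') (hβ : β ≍ β') (hu : u = l) : CellR s t l β' := by
  subst hv hv' hβ hu; exact h

lemma CellR.eq {x : Fibre p q a b} {y : Fibre p q a' b'} {s t s' t' : x.obj ⟶ y.obj}
    {v v' : b ⟶ b'} {β : v ⟶ v'} {u : a ⟶ a'} (h : CellR s t u β) (hs : s = s') (ht : t = t') :
    CellR s' t' u β := by
  subst hs ht; exact h

end Fibre

namespace SplitTwoSidedTwoFibration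

open Fibre

lemma exists_cellL (K : SplitTwoSidedTwoFibration p q)
    {x : Fibre p q a b} {y : Fibre p q a' b'} {s : x.obj ⟶ y.obj} {u u' : a ⟶ a'}
    {v : b ⟶ b'} (hs : Over s u v) (α : u ⟶ u') : ∃ t, CellL s t α v := by
  obtain ⟨i, rfl, rfl⟩ := x
  obtain ⟨j, rfl, rfl⟩ := y
  obtain ⟨rfl, rfl⟩ := over_iff.1 hs
  refine ⟨K.push₂ s α, hs, over_iff.2 ⟨K.map_push₂ s α, K.q_push₂ s α⟩, K.lam₂ s α, ?_, ?_⟩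
  · rw [K.map₂_lam₂]; simp
  · rw [K.q_lam₂]; exact IsIdCell.ofEq _

lemma exists_cellR (K : SplitTwoSidedTwoFibration p q)
    {x : Fibre p q a b} {y : Fibre p q a' b'} {t : x.obj ⟶ y.obj} {u : a ⟶ a'}
    {v v' : b ⟶ b'} (ht : Over t u v') (β : v ⟶ v') : ∃ s, CellR s t u β := by
  obtain ⟨i, rfl, rfl⟩ := x
  obtain ⟨j, rfl, rfl⟩ := y
  obtain ⟨rfl, rfl⟩ := over_iff.1 ht
  refine ⟨K.pull₂ t β, over_iff.2 ⟨K.p_pull₂ t β, K.map_pull₂ t β⟩, ht, K.rho₂ t β, ?_, ?_⟩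
  · rw [K.p_rho₂]; exact IsIdCell.ofEq _
  · rw [K.map₂_rho₂]; simp

lemma push₂_eq (K : SplitTwoSidedTwoFibration p q) (D : JointlyReflectsIdCells p q)
    {i j : J} {r t : i ⟶ j} (σ : r ⟶ t) (hσ : IsIdCell (q.map₂ σ)) :
    K.push₂ r (p.map₂ σ) = t := by
  obtain ⟨κ, ⟨h₁, h₂⟩, -⟩ := K.lam₂_opcartesian r (p.map₂ σ) t σ
    (eqToHom (K.map_push₂ r (p.map₂ σ))) (by simp [K.map₂_lam₂])
  have hκ : IsIdCell κ := D κ (by rw [h₁]; exact IsIdCell.ofEq _) (by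
    rw [← h₂, q.map₂_comp, K.q_lam₂] at hσ
    exact (IsIdCell.ofEq _).of_comp_left hσ)
  exact hκ.choose

lemma pull₂_eq (K : SplitTwoSidedTwoFibration p q) (D : JointlyReflectsIdCells p q)
    {i j : J} {r t : i ⟶ j} (σ : r ⟶ t) (hσ : IsIdCell (p.map₂ σ)) :
    K.pull₂ t (q.map₂ σ) = r := by
  obtain ⟨κ, ⟨h₁, h₂⟩, -⟩ := K.rho₂_cartesian t (q.map₂ σ) r σ
    (eqToHom (K.map_pull₂ t (q.map₂ σ)).symm) (by simp [K.map₂_rho₂])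
  have hκ : IsIdCell κ := D κ (by
    rw [← h₂, p.map₂_comp, K.p_rho₂] at hσ
    exact (IsIdCell.ofEq _).of_comp_right hσ) (by rw [h₁]; exact IsIdCell.ofEq _)
  exact hκ.choose.symm

lemma cellL_unique (K : SplitTwoSidedTwoFibration p q) (D : JointlyReflectsIdCells p q)
    {x : Fibre p q a b} {y : Fibre p q a' b'} {s t t' : x.obj ⟶ y.obj}
    {u u' : a ⟶ a'} {α : u ⟶ u'} {v : b ⟶ b'} (h : CellL s t α v) (h' : CellL s t' α v) :
    t = t' := by
  obtain ⟨i, rfl, rfl⟩ := x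
  obtain ⟨j, rfl, rfl⟩ := y
  obtain ⟨rfl, rfl⟩ := over_iff.1 h.source
  obtain ⟨rfl, -⟩ := over_iff.1 h.target
  have e := (over_iff.1 h'.target).1
  obtain ⟨σ, hσ, k⟩ := h.cell
  obtain ⟨σ', hσ', k'⟩ := h'.cell
  obtain rfl := eq_of_heq hσ
  rw [← push₂_eq K D σ k, ← push₂_eq K D σ' k']
  congr 1
  exact e.symm
  exact hσ'.symm

lemma cellR_unique (K : SplitTwoSidedTwoFibration p q) (D : JointlyReflectsIdCells p q)
    {x : Fibre p q a b} {y : Fibre p q a' b'} {s s' t : x.obj ⟶ y.obj}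
    {v v' : b ⟶ b'} {β : v ⟶ v'} {u : a ⟶ a'} (h : CellR s t u β) (h' : CellR s' t u β) :
    s = s' := by
  obtain ⟨i, rfl, rfl⟩ := x
  obtain ⟨j, rfl, rfl⟩ := y
  obtain ⟨rfl, rfl⟩ := over_iff.1 h.source
  obtain ⟨-, rfl⟩ := over_iff.1 h.target
  have e := (over_iff.1 h'.source).2
  obtain ⟨σ, k, hσ⟩ := h.cell
  obtain ⟨σ', k', hσ'⟩ := h'.cell
  obtain rfl := eq_of_heq hσ
  rw [← pull₂_eq K D σ k, ← pull₂_eq K D σ' k']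
  congr 1
  exact e.symm
  exact hσ'.symm

end SplitTwoSidedTwoFibration

end Currying

noncomputable section Curry

variable {J : Type u₁} [Bicategory.{w₁, v₁} J] [Strict J]
  {A : Type u₂} [Bicategory.{w₂, v₂} A] [Strict A]
  {B : Type u₃} [Bicategory.{w₃, v₃} B] [Strict B]
  {p : StrictPseudofunctor J A} {q : StrictPseudofunctor J B} {a a' a'' : A} {b b' b'' : B}

lemma id_whiskerLeft_heq {u u' : a ⟶ a'} (α : u ⟶ u') : 𝟙 a ◁ α ≍ α := by
  rw [Strict.id_whiskerLeft']; simp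

lemma whiskerRight_id_heq {u u' : a ⟶ a'} (α : u ⟶ u') : α ▷ 𝟙 a' ≍ α := by
  rw [Strict.whiskerRight_id']; simp

namespace SplitTwoSidedTwoFibration

open Fibre

variable (K : SplitTwoSidedTwoFibration p q) (D : JointlyReflectsIdCells p q)

lemma existsUnique_pullCell (K : SplitTwoSidedTwoFibration p q) (D : JointlyReflectsIdCells p q)
    {u u' : a' ⟶ a} (α : u ⟶ u') (x : Fibre p q a b) :
    ∃! f : K.pullObj u x ⟶ K.pullObj u' x,
      CellL (K.lamHom u x) (f.hom ≫ K.lamHom u' x) α (𝟙 b) := by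
  obtain ⟨t, ht⟩ := exists_cellL K (K.over_lamHom u x) α
  refine ⟨K.lamLift u' t ht.target, ht.eq rfl (K.lamLift_lam _ _ _).symm, fun f hf => ?_⟩
  refine K.lam_unique ?_
  rw [lamLift_lam]
  exact cellL_unique K D hf ht

lemma existsUnique_pushCell (K : SplitTwoSidedTwoFibration p q) (D : JointlyReflectsIdCells p q)
    {v v' : b ⟶ b'} (β : v ⟶ v') (x : Fibre p q a b) :
    ∃! f : K.pushObj v x ⟶ K.pushObj v' x,
      CellR (K.rhoHom v x ≫ f.hom) (K.rhoHom v' x) (𝟙 a) β := by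
  obtain ⟨t, ht⟩ := exists_cellR K (K.over_rhoHom v' x) β
  refine ⟨K.rhoLift v t ht.source, ht.eq (K.rho_rhoLift _ _ _).symm rfl, fun f hf => ?_⟩
  refine K.rho_unique ?_
  rw [rho_rhoLift]
  exact cellR_unique K D hf ht

/-- The component `u^* x ⟶ u'^* x` of the natural transformation `α^*`, i.e. the unique `f` in the
fibre with `f ≫ λ(u', x) = α_! λ(u, x)`. Since `α_! λ(u, x)` is, by local discreteness, the only
target of a cell out of `λ(u, x)` over `α` and the identity of `b`, the equation is expressed by the
existence of such a cell into `f ≫ λ(u', x)`. -/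
def pullCell {u u' : a' ⟶ a} (α : u ⟶ u') (x : Fibre p q a b) :
    K.pullObj u x ⟶ K.pullObj u' x :=
  (existsUnique_pullCell K D α x).choose

/-- The component `v_! x ⟶ v'_! x` of the natural transformation `β_!`, i.e. the unique `f` in the
fibre with `ρ(x, v) ≫ f = β^* ρ(x, v')`, expressed in the same way. -/
def pushCell {v v' : b ⟶ b'} (β : v ⟶ v') (x : Fibre p q a b) :
    K.pushObj v x ⟶ K.pushObj v' x :=
  (existsUnique_pushCell K D β x).choose

lemma pullCell_spec {u u' : a' ⟶ a} (α : u ⟶ u') (x : Fibre p q a b) :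
    CellL (K.lamHom u x) ((K.pullCell D α x).hom ≫ K.lamHom u' x) α (𝟙 b) :=
  (existsUnique_pullCell K D α x).choose_spec.1

lemma pushCell_spec {v v' : b ⟶ b'} (β : v ⟶ v') (x : Fibre p q a b) :
    CellR (K.rhoHom v x ≫ (K.pushCell D β x).hom) (K.rhoHom v' x) (𝟙 a) β :=
  (existsUnique_pushCell K D β x).choose_spec.1

lemma pullCell_eq {u u' : a' ⟶ a} (α : u ⟶ u') (x : Fibre p q a b)
    {f : K.pullObj u x ⟶ K.pullObj u' x}
    (hf : CellL (K.lamHom u x) (f.hom ≫ K.lamHom u' x) α (𝟙 b)) : K.pullCell D α x = f :=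
  (existsUnique_pullCell K D α x).unique (K.pullCell_spec D α x) hf

lemma pushCell_eq {v v' : b ⟶ b'} (β : v ⟶ v') (x : Fibre p q a b)
    {f : K.pushObj v x ⟶ K.pushObj v' x}
    (hf : CellR (K.rhoHom v x ≫ f.hom) (K.rhoHom v' x) (𝟙 a) β) : K.pushCell D β x = f :=
  (existsUnique_pushCell K D β x).unique (K.pushCell_spec D β x) hf

/-- The natural transformation `α^* : u^* ⟶ u'^*`. -/
@[reducible, simps]
def pullTrans (b : B) {u u' : a' ⟶ a} (α : u ⟶ u') :
    K.pullFunctor b u ⟶ K.pullFunctor b u' where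
  app x := K.pullCell D α x
  naturality x y f := K.lam_unique (by
    rw [comp_hom, comp_hom, Category.assoc, Category.assoc, pull_map_lam, ← Category.assoc]
    exact cellL_unique K D ((((K.pullCell_spec D α y).whiskerLeft
      (over_hom ((K.pullFunctor b u).map f))).congr (Category.id_comp _) (Category.id_comp _)
        (id_whiskerLeft_heq α) (Category.id_comp _)).eq rfl (Category.assoc _ _ _).symm)
      ((((K.pullCell_spec D α x).whiskerRight (over_hom f)).congr (Category.comp_id _)
        (Category.comp_id _) (whiskerRight_id_heq α) (Category.comp_id _)).eq
          (K.pull_map_lam u f).symm (Category.assoc _ _ _)))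

/-- The natural transformation `β_! : v_! ⟶ v'_!`. -/
@[reducible, simps]
def pushTrans (a : A) {v v' : b ⟶ b'} (β : v ⟶ v') :
    K.pushFunctor a v ⟶ K.pushFunctor a v' where
  app x := K.pushCell D β x
  naturality x y f := K.rho_unique (by
    rw [comp_hom, comp_hom, ← Category.assoc, ← Category.assoc, rho_push_map, Category.assoc]
    exact cellR_unique K D (((K.pushCell_spec D β y).whiskerLeft
      (over_hom f)).congr (Category.id_comp _) (Category.id_comp _)
        (id_whiskerLeft_heq β) (Category.id_comp _))
      ((((K.pushCell_spec D β x).whiskerRight (over_hom ((K.pushFunctor a v').map f))).congr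
        (Category.comp_id _) (Category.comp_id _) (whiskerRight_id_heq β) (Category.comp_id _)).eq
          rfl (K.rho_push_map v' f)))

lemma pull_congr {i : J} {a : A} {u u' : a ⟶ p.obj i} (h : u = u') : K.pull i u = K.pull i u' := by
  rw [h]

lemma push_congr {i : J} {b : B} {v v' : q.obj i ⟶ b} (h : v = v') : K.push i v = K.push i v' := by
  rw [h]

lemma lam_congr {i : J} {a : A} {u u' : a ⟶ p.obj i} (h : u = u') :
    K.lam i u = eqToHom (K.pull_congr h) ≫ K.lam i u' := by
  subst h; simp

lemma rho_congr {i : J} {b : B} {v v' : q.obj i ⟶ b} (h : v = v') :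
    K.rho i v = K.rho i v' ≫ eqToHom (K.push_congr h).symm := by
  subst h; simp

lemma pullObj_id (x : Fibre p q a b) : K.pullObj (𝟙 a) x = x := by
  obtain ⟨i, rfl, rfl⟩ := x
  exact Fibre.ext ((K.pull_congr (by simp)).trans (K.pull_id i))

lemma pushObj_id (x : Fibre p q a b) : K.pushObj (𝟙 b) x = x := by
  obtain ⟨i, rfl, rfl⟩ := x
  exact Fibre.ext ((K.push_congr (by simp)).trans (K.push_id i))

lemma lamHom_id (x : Fibre p q a b) :
    K.lamHom (𝟙 a) x = eqToHom (congrArg Fibre.obj (K.pullObj_id x)) := by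
  obtain ⟨i, rfl, rfl⟩ := x
  refine (K.lam_congr (show 𝟙 (p.obj i) ≫ eqToHom _ = 𝟙 _ by simp)).trans ?_
  rw [K.lam_id]
  exact eqToHom_trans _ _

lemma rhoHom_id (x : Fibre p q a b) :
    K.rhoHom (𝟙 b) x = eqToHom (congrArg Fibre.obj (K.pushObj_id x)).symm := by
  obtain ⟨i, rfl, rfl⟩ := x
  refine (K.rho_congr (show eqToHom _ ≫ 𝟙 (q.obj i) = 𝟙 _ by simp)).trans ?_
  rw [K.rho_id]
  exact eqToHom_trans _ _

lemma pull_comp_aux (w : a'' ⟶ a') (u : a' ⟶ a) (x : Fibre p q a b) :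
    (w ≫ u) ≫ eqToHom x.left.symm = (w ≫ eqToHom (K.pullObj u x).left.symm) ≫
      p.map (K.lam x.obj (u ≫ eqToHom x.left.symm)) := by
  simp [K.map_lam]

lemma push_comp_aux (v : b ⟶ b') (w : b' ⟶ b'') (x : Fibre p q a b) :
    eqToHom x.right ≫ v ≫ w = q.map (K.rho x.obj (eqToHom x.right ≫ v)) ≫
      eqToHom (K.pushObj v x).right ≫ w := by
  simp [K.map_rho]

lemma pullObj_comp (w : a'' ⟶ a') (u : a' ⟶ a) (x : Fibre p q a b) :
    K.pullObj (w ≫ u) x = K.pullObj w (K.pullObj u x) :=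
  Fibre.ext ((K.pull_congr (K.pull_comp_aux w u x)).trans (K.pull_comp _ _ _))

lemma pushObj_comp (v : b ⟶ b') (w : b' ⟶ b'') (x : Fibre p q a b) :
    K.pushObj (v ≫ w) x = K.pushObj w (K.pushObj v x) :=
  Fibre.ext ((K.push_congr (K.push_comp_aux v w x)).trans (K.push_comp _ _ _))

lemma lamHom_comp (w : a'' ⟶ a') (u : a' ⟶ a) (x : Fibre p q a b) :
    K.lamHom (w ≫ u) x = eqToHom (congrArg Fibre.obj (K.pullObj_comp w u x)) ≫
      K.lamHom w (K.pullObj u x) ≫ K.lamHom u x := by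
  refine (K.lam_congr (K.pull_comp_aux w u x)).trans ?_
  rw [K.lam_comp, ← Category.assoc, eqToHom_trans]
  rfl

lemma rhoHom_comp (v : b ⟶ b') (w : b' ⟶ b'') (x : Fibre p q a b) :
    K.rhoHom (v ≫ w) x = K.rhoHom v x ≫ K.rhoHom w (K.pushObj v x) ≫
      eqToHom (congrArg Fibre.obj (K.pushObj_comp v w x)).symm := by
  refine (K.rho_congr (K.push_comp_aux v w x)).trans ?_
  rw [K.rho_comp, Category.assoc, Category.assoc, eqToHom_trans]
  rfl

lemma push_pull_aux₁ (u : a' ⟶ a) (v : b ⟶ b') (x : Fibre p q a b) :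
    eqToHom (K.pullObj u x).right ≫ v =
      q.map (K.lam x.obj (u ≫ eqToHom x.left.symm)) ≫ eqToHom x.right ≫ v := by
  simp [K.q_lam]

lemma push_pull_aux₂ (u : a' ⟶ a) (v : b ⟶ b') (x : Fibre p q a b) :
    (u ≫ eqToHom x.left.symm) ≫ p.map (K.rho x.obj (eqToHom x.right ≫ v)) =
      u ≫ eqToHom (K.pushObj v x).left.symm := by
  simp [K.p_rho]

lemma pushObj_pullObj (u : a' ⟶ a) (v : b ⟶ b') (x : Fibre p q a b) :
    K.pushObj v (K.pullObj u x) = K.pullObj u (K.pushObj v x) :=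
  Fibre.ext (((K.push_congr (K.push_pull_aux₁ u v x)).trans (K.push_pull _ _ _)).trans
    (K.pull_congr (K.push_pull_aux₂ u v x)))

lemma lamHom_rhoHom (u : a' ⟶ a) (v : b ⟶ b') (x : Fibre p q a b) :
    K.rhoHom v (K.pullObj u x) ≫ eqToHom (congrArg Fibre.obj (K.pushObj_pullObj u v x)) ≫
      K.lamHom u (K.pushObj v x) = K.lamHom u x ≫ K.rhoHom v x := by
  refine Eq.trans ?_ (K.lam_rho x.obj (u ≫ eqToHom x.left.symm) (eqToHom x.right ≫ v)).symm
  rw [K.lam_congr (K.push_pull_aux₂ u v x)]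
  refine (congrArg (· ≫ _) (K.rho_congr (K.push_pull_aux₁ u v x))).trans ?_
  simp
  rfl

lemma rho_lam_unique {u : a' ⟶ a} {v : b ⟶ b'} {x : Fibre p q a' b} {y : Fibre p q a b'}
    {f g : K.pushObj v x ⟶ K.pullObj u y}
    (h : K.rhoHom v x ≫ f.hom ≫ K.lamHom u y = K.rhoHom v x ≫ g.hom ≫ K.lamHom u y) : f = g := by
  refine K.lam_unique ((K.existsUnique_rho v x (K.rhoHom v x ≫ g.hom ≫ K.lamHom u y)
    (((K.over_rhoHom v x).comp ((over_hom g).comp (K.over_lamHom u y))).congr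
      (by simp) (by simp))).unique
      ⟨((over_hom f).comp (K.over_lamHom u y)).congr (Category.id_comp u) (Category.id_comp _), h⟩
      ⟨((over_hom g).comp (K.over_lamHom u y)).congr (Category.id_comp u) (Category.id_comp _),
        rfl⟩)

end SplitTwoSidedTwoFibration

end Curry

noncomputable section Curry

variable {J : Type u₁} [Bicategory.{w₁, v₁} J] [Strict J]
  {A : Type u₂} [Bicategory.{w₂, v₂} A] [Strict A]
  {B : Type u₃} [Bicategory.{w₃, v₃} B] [Strict B]
  {p : StrictPseudofunctor J A} {q : StrictPseudofunctor J B} {a a' a'' : A} {b b' b'' : B}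

namespace SplitTwoSidedTwoFibration

open Fibre

variable (K : SplitTwoSidedTwoFibration p q) (D : JointlyReflectsIdCells p q)

lemma pull_id_map {x y : Fibre p q a b} (f : x ⟶ y) :
    (K.pullFunctor b (𝟙 a)).map f =
      eqToHom (K.pullObj_id x) ≫ f ≫ eqToHom (K.pullObj_id y).symm := by
  apply hom_ext
  have h := K.pull_map_lam (𝟙 a) f
  rw [lamHom_id, lamHom_id, comp_eqToHom_iff] at h
  rw [h, comp_hom, comp_hom, eqToHom_hom, eqToHom_hom, Category.assoc]

lemma push_id_map {x y : Fibre p q a b} (f : x ⟶ y) :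
    (K.pushFunctor a (𝟙 b)).map f =
      eqToHom (K.pushObj_id x) ≫ f ≫ eqToHom (K.pushObj_id y).symm := by
  apply hom_ext
  have h := K.rho_push_map (𝟙 b) f
  rw [rhoHom_id, rhoHom_id, eqToHom_comp_iff] at h
  rw [h, comp_hom, comp_hom, eqToHom_hom, eqToHom_hom]

lemma pull_comp_map (w : a'' ⟶ a') (u : a' ⟶ a) {x y : Fibre p q a b} (f : x ⟶ y) :
    (K.pullFunctor b (w ≫ u)).map f = eqToHom (K.pullObj_comp w u x) ≫
      (K.pullFunctor b w).map ((K.pullFunctor b u).map f) ≫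
        eqToHom (K.pullObj_comp w u y).symm := by
  refine K.lam_unique ?_
  rw [pull_map_lam, comp_hom, comp_hom, eqToHom_hom, eqToHom_hom, lamHom_comp, lamHom_comp]
  simp only [Category.assoc, eqToHom_trans_assoc, eqToHom_refl, Category.id_comp]
  rw [← Category.assoc _ (K.lamHom w _) (K.lamHom u _), pull_map_lam]
  simp only [Category.assoc, lamLift_lam]

lemma push_comp_map (v : b ⟶ b') (w : b' ⟶ b'') {x y : Fibre p q a b} (f : x ⟶ y) :
    (K.pushFunctor a (v ≫ w)).map f = eqToHom (K.pushObj_comp v w x) ≫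
      (K.pushFunctor a w).map ((K.pushFunctor a v).map f) ≫
        eqToHom (K.pushObj_comp v w y).symm := by
  refine K.rho_unique ?_
  rw [rho_push_map, comp_hom, comp_hom, eqToHom_hom, eqToHom_hom, rhoHom_comp, rhoHom_comp]
  simp only [Category.assoc, eqToHom_trans_assoc, eqToHom_refl, Category.id_comp]
  rw [← Category.assoc (K.rhoHom w _) _ _, rho_push_map, Category.assoc,
    ← Category.assoc (K.rhoHom v x) _ _, rho_rhoLift]
  simp only [Category.assoc]

lemma pullCell_id (u : a' ⟶ a) (x : Fibre p q a b) : K.pullCell D (𝟙 u) x = 𝟙 _ :=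
  K.pullCell_eq D _ _ ((CellL.id (K.over_lamHom u x)).eq rfl (Category.id_comp _).symm)

lemma pushCell_id (v : b ⟶ b') (x : Fibre p q a b) : K.pushCell D (𝟙 v) x = 𝟙 _ :=
  K.pushCell_eq D _ _ ((CellR.id (K.over_rhoHom v x)).eq (Category.comp_id _).symm rfl)

lemma pullCell_comp {u u' u'' : a' ⟶ a} (α : u ⟶ u') (α' : u' ⟶ u'') (x : Fibre p q a b) :
    K.pullCell D (α ≫ α') x = K.pullCell D α x ≫ K.pullCell D α' x :=
  K.pullCell_eq D _ _ (((K.pullCell_spec D α x).comp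
    (((K.pullCell_spec D α' x).whiskerLeft (over_hom (K.pullCell D α x))).congr
      (Category.id_comp _) (Category.id_comp _) (id_whiskerLeft_heq α') (Category.id_comp _))).eq
        rfl (Category.assoc _ _ _).symm)

lemma pushCell_comp {v v' v'' : b ⟶ b'} (β : v ⟶ v') (β' : v' ⟶ v'') (x : Fibre p q a b) :
    K.pushCell D (β ≫ β') x = K.pushCell D β x ≫ K.pushCell D β' x :=
  K.pushCell_eq D _ _ (((((K.pushCell_spec D β x).whiskerRight
    (over_hom (K.pushCell D β' x))).congr (Category.comp_id _) (Category.comp_id _)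
      (whiskerRight_id_heq β) (Category.comp_id _)).comp (K.pushCell_spec D β' x)).eq
        (Category.assoc _ _ _) rfl)

lemma pullCell_whiskerLeft (w : a'' ⟶ a') {u u' : a' ⟶ a} (α : u ⟶ u') (x : Fibre p q a b) :
    K.pullCell D (w ◁ α) x = eqToHom (K.pullObj_comp w u x) ≫
      (K.pullFunctor b w).map (K.pullCell D α x) ≫ eqToHom (K.pullObj_comp w u' x).symm := by
  refine K.pullCell_eq D _ _ ?_
  refine ((((K.pullCell_spec D α x).whiskerLeft ((over_hom (eqToHom (K.pullObj_comp w u x))).comp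
    (K.over_lamHom w (K.pullObj u x)))).congr ?_ ?_ ?_ ?_).eq ?_ ?_)
  · simp
  · simp
  · exact heq_whiskerLeft rfl rfl rfl (heq_of_eq (Category.id_comp w)) HEq.rfl HEq.rfl HEq.rfl
  · simp
  · rw [eqToHom_hom, lamHom_comp, Category.assoc]
  · rw [comp_hom, comp_hom, eqToHom_hom, eqToHom_hom, lamHom_comp]
    simp only [Category.assoc, eqToHom_trans_assoc, eqToHom_refl, Category.id_comp]
    rw [← Category.assoc _ (K.lamHom w _) (K.lamHom u' _), pull_map_lam]
    simp only [Category.assoc]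

lemma pullCell_whiskerRight {w w' : a'' ⟶ a'} (α : w ⟶ w') (u : a' ⟶ a) (x : Fibre p q a b) :
    K.pullCell D (α ▷ u) x = eqToHom (K.pullObj_comp w u x) ≫
      K.pullCell D α (K.pullObj u x) ≫ eqToHom (K.pullObj_comp w' u x).symm := by
  refine K.pullCell_eq D _ _ ?_
  refine (((((K.pullCell_spec D α (K.pullObj u x)).whiskerRight (K.over_lamHom u x)).whiskerLeft
    (over_hom (eqToHom (K.pullObj_comp w u x)))).congr ?_ ?_ ?_ ?_).eq ?_ ?_)
  · simp
  · simp
  · exact id_whiskerLeft_heq _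
  · simp
  · rw [eqToHom_hom, lamHom_comp]
  · rw [comp_hom, comp_hom, eqToHom_hom, eqToHom_hom, lamHom_comp]
    simp only [Category.assoc, eqToHom_trans_assoc, eqToHom_refl, Category.id_comp]

lemma pushCell_whiskerLeft (w : b ⟶ b') {v v' : b' ⟶ b''} (β : v ⟶ v') (x : Fibre p q a b) :
    K.pushCell D (w ◁ β) x = eqToHom (K.pushObj_comp w v x) ≫
      K.pushCell D β (K.pushObj w x) ≫ eqToHom (K.pushObj_comp w v' x).symm := by
  refine K.pushCell_eq D _ _ ?_
  refine (((((K.pushCell_spec D β (K.pushObj w x)).whiskerLeft (K.over_rhoHom w x)).whiskerRight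
    (over_hom (eqToHom (K.pushObj_comp w v' x).symm))).congr ?_ ?_ ?_ ?_).eq ?_ ?_)
  · simp
  · simp
  · exact whiskerRight_id_heq _
  · simp
  · rw [comp_hom, comp_hom, eqToHom_hom, eqToHom_hom, rhoHom_comp]
    simp only [Category.assoc, eqToHom_trans_assoc, eqToHom_refl, Category.id_comp]
  · rw [eqToHom_hom, rhoHom_comp, Category.assoc]

lemma pushCell_whiskerRight {w w' : b ⟶ b'} (β : w ⟶ w') (v : b' ⟶ b'') (x : Fibre p q a b) :
    K.pushCell D (β ▷ v) x = eqToHom (K.pushObj_comp w v x) ≫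
      (K.pushFunctor a v).map (K.pushCell D β x) ≫ eqToHom (K.pushObj_comp w' v x).symm := by
  refine K.pushCell_eq D _ _ ?_
  refine ((((K.pushCell_spec D β x).whiskerRight ((K.over_rhoHom v (K.pushObj w' x)).comp
    (over_hom (eqToHom (K.pushObj_comp w' v x).symm)))).congr ?_ ?_ ?_ ?_).eq ?_ ?_)
  · simp
  · simp
  · exact heq_whiskerRight rfl rfl rfl HEq.rfl HEq.rfl (heq_of_eq (Category.comp_id v)) HEq.rfl
  · simp
  · rw [comp_hom, comp_hom, eqToHom_hom, eqToHom_hom, rhoHom_comp]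
    simp only [Category.assoc, eqToHom_trans_assoc, eqToHom_refl, Category.id_comp]
    rw [← Category.assoc (K.rhoHom v _) _ _, rho_push_map, Category.assoc]
  · rw [eqToHom_hom, rhoHom_comp]

lemma push_pull_map (u : a' ⟶ a) (v : b ⟶ b') {x y : Fibre p q a b} (f : x ⟶ y) :
    (K.pushFunctor a' v).map ((K.pullFunctor b u).map f) = eqToHom (K.pushObj_pullObj u v x) ≫
      (K.pullFunctor b' u).map ((K.pushFunctor a v).map f) ≫
        eqToHom (K.pushObj_pullObj u v y).symm := by
  rw [← Category.assoc, ← comp_eqToHom_iff]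
  refine K.rho_lam_unique ?_
  rw [comp_hom, comp_hom, eqToHom_hom, eqToHom_hom, Category.assoc, Category.assoc, pull_map_lam,
    ← Category.assoc, rho_push_map, Category.assoc, lamHom_rhoHom, ← Category.assoc, pull_map_lam,
    Category.assoc, ← rho_push_map, ← Category.assoc, ← lamHom_rhoHom, Category.assoc,
    Category.assoc]
  exact K.pushObj_pullObj u v y

lemma pushFunctor_pullCell {u u' : a' ⟶ a} (α : u ⟶ u') (v : b ⟶ b') (x : Fibre p q a b) :
    (K.pushFunctor a' v).map (K.pullCell D α x) = eqToHom (K.pushObj_pullObj u v x) ≫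
      K.pullCell D α (K.pushObj v x) ≫ eqToHom (K.pushObj_pullObj u' v x).symm := by
  rw [← Category.assoc, ← comp_eqToHom_iff]
  refine K.rho_lam_unique ?_
  refine cellL_unique K D (α := α) (v := v) (s := K.lamHom u x ≫ K.rhoHom v x) ?_ ?_
  · refine (((K.pullCell_spec D α x).whiskerRight (K.over_rhoHom v x)).congr (Category.comp_id _)
      (Category.comp_id _) (whiskerRight_id_heq α) (Category.id_comp v)).eq rfl ?_
    rw [comp_hom, eqToHom_hom, Category.assoc, Category.assoc, ← lamHom_rhoHom, ← Category.assoc,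
      ← Category.assoc, ← rho_push_map]
    simp only [Category.assoc]
  · refine ((((K.pullCell_spec D α (K.pushObj v x)).whiskerLeft ((K.over_rhoHom v _).comp
      (over_hom (eqToHom (K.pushObj_pullObj u v x))))).congr ?_ ?_ ?_ ?_).eq ?_ ?_)
    · simp
    · simp
    · refine HEq.trans (heq_whiskerLeft rfl rfl rfl (heq_of_eq (Category.id_comp (𝟙 _))) HEq.rfl
        HEq.rfl HEq.rfl) (id_whiskerLeft_heq α)
    · simp
    · rw [← lamHom_rhoHom, eqToHom_hom, Category.assoc]
    · rw [comp_hom, eqToHom_hom, Category.assoc, Category.assoc]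
  · exact K.pushObj_pullObj u' v x

lemma pullFunctor_pushCell (u : a' ⟶ a) {v v' : b ⟶ b'} (β : v ⟶ v') (x : Fibre p q a b) :
    (K.pullFunctor b' u).map (K.pushCell D β x) = eqToHom (K.pushObj_pullObj u v x).symm ≫
      K.pushCell D β (K.pullObj u x) ≫ eqToHom (K.pushObj_pullObj u v' x) := by
  rw [← eqToHom_comp_iff]
  refine K.rho_lam_unique ?_
  refine cellR_unique K D (β := β) (u := u) (t := K.lamHom u x ≫ K.rhoHom v' x) ?_ ?_
  · refine (((K.pushCell_spec D β x).whiskerLeft (K.over_lamHom u x)).congr (Category.id_comp _)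
      (Category.id_comp _) (id_whiskerLeft_heq β) (Category.comp_id u)).eq ?_ rfl
    rw [comp_hom, eqToHom_hom, Category.assoc, pull_map_lam, ← Category.assoc, ← lamHom_rhoHom]
    simp only [Category.assoc]
  · refine ((((K.pushCell_spec D β (K.pullObj u x)).whiskerRight
      ((over_hom (eqToHom (K.pushObj_pullObj u v' x))).comp (K.over_lamHom u _))).congr
        ?_ ?_ ?_ ?_).eq ?_ ?_)
    · simp
    · simp
    · refine HEq.trans (heq_whiskerRight rfl rfl rfl HEq.rfl HEq.rfl
        (heq_of_eq (Category.comp_id (𝟙 _))) HEq.rfl) (whiskerRight_id_heq β)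
    · simp
    · rw [comp_hom, eqToHom_hom]
      simp only [Category.assoc]
    · rw [← lamHom_rhoHom, eqToHom_hom]
  · exact K.pushObj_pullObj u v x

end SplitTwoSidedTwoFibration

end Curry

noncomputable section Curry

open Opposite Bicategory.Opposite

variable {J : Type u} [Bicategory.{u, u} J] [Strict J] {A : Type u} [Bicategory.{u, u} A] [Strict A]
  {B : Type u} [Bicategory.{u, u} B] [Strict B]
  {p : StrictPseudofunctor J A} {q : StrictPseudofunctor J B}

namespace SplitTwoSidedTwoFibration

open Fibre

variable (K : SplitTwoSidedTwoFibration p q) (D : JointlyReflectsIdCells p q)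

/-- The 2-functor `Aᵒᵖ ⟶ Cat` of fibres over `b`, with `a ↦ J_(a, b)`, `u ↦ u^*` and `α ↦ α^*`. -/
def fibreFunctor (b : B) : StrictPseudofunctor Aᵒᵖ Cat.{u, u} :=
  .mk'' {
    obj := fun c => Cat.of (Fibre p q c.unop b)
    map := fun u => (K.pullFunctor b u.unop).toCatHom
    map₂ := fun α => (K.pullTrans D b α.unop2).toCatHom₂
    map₂_id := fun _ => cat_cell_ext₀ fun x => K.pullCell_id D _ x
    map₂_comp := fun _ _ => cat_cell_ext₀ fun x => K.pullCell_comp D _ _ x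
    map_id := fun _ => cat_hom_ext (fun x => K.pullObj_id x) fun _ _ f => K.pull_id_map f
    map_comp := fun u w => cat_hom_ext (fun x => K.pullObj_comp w.unop u.unop x)
      fun _ _ f => K.pull_comp_map w.unop u.unop f
    map₂_whisker_left := fun u _ _ α => cat_cell_ext _ _
      fun x => K.pullCell_whiskerRight D α.unop2 u.unop x
    map₂_whisker_right := fun α w => cat_cell_ext _ _
      fun x => K.pullCell_whiskerLeft D w.unop α.unop2 x }

/-- The 2-natural transformation with components `v_! : J_(a, b) ⟶ J_(a, b')`. -/
def fibreTrans {b b' : B} (v : b ⟶ b') : TwoNat (K.fibreFunctor D b) (K.fibreFunctor D b') where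
  app c := (K.pushFunctor c.unop v).toCatHom
  naturality u := cat_hom_ext (fun x => (K.pushObj_pullObj u.unop v x).symm)
    fun _ _ f => flip_eqToHom _ _ (K.push_pull_map u.unop v f)
  naturality₂ α := cat_cell_ext _ _ fun x => flip_eqToHom _ _ (K.pushFunctor_pullCell D α.unop2 v x)

/-- The modification with components `β_!`. -/
def fibreMod {b b' : B} {v v' : b ⟶ b'} (β : v ⟶ v') : K.fibreTrans D v ⟶ K.fibreTrans D v' where
  app c := (K.pushTrans D c.unop β).toCatHom₂
  naturality u := cat_cell_ext _ _ fun x => K.pullFunctor_pushCell D u.unop β x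

section

variable (hJ : ∀ (a : A) (b : B), IsSmallCat.{w} (Fibre p q a b))

def curryObj (b : B) : Presheaf.{w} A := ⟨K.fibreFunctor D b, fun c => hJ c.unop b⟩

def curryMap {b b' : B} (v : b ⟶ b') : K.curryObj D hJ b ⟶ K.curryObj D hJ b' := K.fibreTrans D v

def curryMap₂ {b b' : B} {v v' : b ⟶ b'} (β : v ⟶ v') : K.curryMap D hJ v ⟶ K.curryMap D hJ v' :=
  K.fibreMod D β

/-- The inverse-Grothendieck 2-functor `⌜J⌝ : B ⟶ Cat ^ Aᵒᵖ` of a locally discrete split two-sided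
2-fibration with small fibres, with `⌜J⌝ b a = J_(a, b)`, `⌜J⌝ b u = u^*` and `⌜J⌝ v = v_!`. -/
def curry : StrictPseudofunctor B (Presheaf.{w} A) :=
  .mk'' {
    obj := K.curryObj D hJ
    map := K.curryMap D hJ
    map₂ := K.curryMap₂ D hJ
    map₂_id := fun _ => TwoNat.hom_ext fun c => cat_cell_ext₀ fun x => K.pushCell_id D _ x
    map₂_comp := fun _ _ => TwoNat.hom_ext fun c => cat_cell_ext₀ fun x => K.pushCell_comp D _ _ x
    map_id := fun b => TwoNat.ext <| funext fun c =>
      cat_hom_ext (fun x => K.pushObj_id x) fun _ _ f => K.push_id_map f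
    map_comp := fun v w => TwoNat.ext <| funext fun c =>
      cat_hom_ext (fun x => K.pushObj_comp v w x) fun _ _ f => K.push_comp_map v w f
    map₂_whisker_left := fun v _ _ β => Presheaf.cell_ext _ _ fun d =>
      cat_cell_ext _ _ fun x => K.pushCell_whiskerLeft D v β x
    map₂_whisker_right := fun β w => Presheaf.cell_ext _ _ fun d =>
      cat_cell_ext _ _ fun x => K.pushCell_whiskerRight D β w x }

end

end SplitTwoSidedTwoFibration

end Curry

section IteratedPullbacks

lemma heq_comp₁ {C : Type u₁} [Bicategory.{w₁, v₁} C] {a a' b b' c c' : C} (ha : a = a')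
    (hb : b = b') (hc : c = c') {f : a ⟶ b} {f' : a' ⟶ b'} {g : b ⟶ c} {g' : b' ⟶ c'}
    (hf : f ≍ f') (hg : g ≍ g') : f ≫ g ≍ f' ≫ g' := by
  subst ha hb hc hf hg; rfl

lemma heq_id₁ {C : Type u₁} [Bicategory.{w₁, v₁} C] {a a' : C} (ha : a = a') :
    𝟙 a ≍ 𝟙 a' := by
  subst ha; rfl

lemma heq_id₂ {C : Type u₁} [Bicategory.{w₁, v₁} C] {a a' b b' : C} (ha : a = a') (hb : b = b')
    {f : a ⟶ b} {f' : a' ⟶ b'} (hf : f ≍ f') : 𝟙 f ≍ 𝟙 f' := by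
  subst ha hb hf; rfl

variable {ι : Type} {κ : Type} {E : ι → Type u₁} [∀ i, Bicategory.{w₁, v₁} (E i)]
  {Y : κ → Type u₂} [∀ k, Bicategory.{w₂, v₂} (Y k)] {s t : κ → ι}

/-- The objects of the limit of the 2-categories `E i` along the pairs of 2-functors
`E (s k) ⟶ Y k ⟵ E (t k)`. For `s, t : Fin n → Fin (n + 1)` given by `s k = k` and `t k = k + 1`
this is the iterated pullback `E 0 ×_(Y 0) E 1 ×_(Y 1) ⋯ ×_(Y (n - 1)) E n`. -/
structure IterPullback (l : ∀ k, StrictPseudofunctor (E (s k)) (Y k))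
    (r : ∀ k, StrictPseudofunctor (E (t k)) (Y k)) where
  obj (i : ι) : E i
  eq (k : κ) : (l k).obj (obj (s k)) = (r k).obj (obj (t k))

namespace IterPullback

variable {l : ∀ k, StrictPseudofunctor (E (s k)) (Y k)}
  {r : ∀ k, StrictPseudofunctor (E (t k)) (Y k)}

/-- The morphisms of `IterPullback l r`. -/
@[ext]
structure Hom (x y : IterPullback l r) where
  hom (i : ι) : x.obj i ⟶ y.obj i
  eq (k : κ) : (l k).map (hom (s k)) ≍ (r k).map (hom (t k))

/-- The cells of `IterPullback l r`. -/
@[ext]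
structure Hom₂ {x y : IterPullback l r} (f g : Hom x y) where
  cell (i : ι) : f.hom i ⟶ g.hom i
  eq (k : κ) : (l k).map₂ (cell (s k)) ≍ (r k).map₂ (cell (t k))

instance : CategoryStruct (IterPullback l r) where
  Hom := Hom
  id x := ⟨fun i => 𝟙 (x.obj i), fun k => by
    rw [(l k).map_id, (r k).map_id]; exact heq_id₁ (x.eq k)⟩
  comp {x y z} f g := ⟨fun i => f.hom i ≫ g.hom i, fun k => by
    rw [(l k).map_comp, (r k).map_comp]
    exact heq_comp₁ (x.eq k) (y.eq k) (z.eq k) (f.eq k) (g.eq k)⟩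

@[simp] lemma id_hom (x : IterPullback l r) (i : ι) : Hom.hom (𝟙 x) i = 𝟙 (x.obj i) := rfl
@[simp] lemma comp_hom {x y z : IterPullback l r} (f : x ⟶ y) (g : y ⟶ z) (i : ι) :
    Hom.hom (f ≫ g) i = f.hom i ≫ g.hom i := rfl

instance homCategory (x y : IterPullback l r) : Category (x ⟶ y) where
  Hom f g := Hom₂ f g
  id f := ⟨fun i => 𝟙 (f.hom i), fun k => by
    rw [(l k).map₂_id, (r k).map₂_id]; exact heq_id₂ (x.eq k) (y.eq k) (f.eq k)⟩
  comp {f g h} σ τ := ⟨fun i => σ.cell i ≫ τ.cell i, fun k => by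
    rw [(l k).map₂_comp, (r k).map₂_comp]
    exact heq_comp₂ (x.eq k) (y.eq k) (f.eq k) (g.eq k) (h.eq k) (σ.eq k) (τ.eq k)⟩

@[simp] lemma id_cell {x y : IterPullback l r} (f : x ⟶ y) (i : ι) :
    Hom₂.cell (𝟙 f) i = 𝟙 (f.hom i) := rfl
@[simp] lemma comp_cell {x y : IterPullback l r} {f g h : x ⟶ y} (σ : f ⟶ g) (τ : g ⟶ h) (i : ι) :
    Hom₂.cell (σ ≫ τ) i = σ.cell i ≫ τ.cell i := rfl
@[simp] lemma eqToHom_cell {x y : IterPullback l r} {f g : x ⟶ y} (h : f = g) (i : ι) :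
    Hom₂.cell (eqToHom h) i = eqToHom (by rw [h]) := by
  subst h; rfl

@[ext] lemma hom₂_ext {x y : IterPullback l r} {f g : x ⟶ y} {σ τ : f ⟶ g}
    (h : ∀ i, σ.cell i = τ.cell i) : σ = τ := Hom₂.ext (funext h)

variable [∀ i, Strict (E i)] [∀ k, Strict (Y k)]

/-- Left whiskering. -/
@[simps]
def whiskerL {x y z : IterPullback l r} (f : x ⟶ y) {g h : y ⟶ z} (σ : g ⟶ h) :
    f ≫ g ⟶ f ≫ h where
  cell i := f.hom i ◁ σ.cell i
  eq k := (map₂_whiskerLeft_heq (l k) _ _).trans ((heq_whiskerLeft (x.eq k) (y.eq k) (z.eq k)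
    (f.eq k) (g.eq k) (h.eq k) (σ.eq k)).trans (map₂_whiskerLeft_heq (r k) _ _).symm)

/-- Right whiskering. -/
@[simps]
def whiskerR {x y z : IterPullback l r} {f g : x ⟶ y} (σ : f ⟶ g) (h : y ⟶ z) :
    f ≫ h ⟶ g ≫ h where
  cell i := σ.cell i ▷ h.hom i
  eq k := (map₂_whiskerRight_heq (l k) _ _).trans ((heq_whiskerRight (x.eq k) (y.eq k) (z.eq k)
    (f.eq k) (g.eq k) (h.eq k) (σ.eq k)).trans (map₂_whiskerRight_heq (r k) _ _).symm)

lemma id_comp' {x y : IterPullback l r} (f : x ⟶ y) : 𝟙 x ≫ f = f :=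
  Hom.ext (funext fun _ => Strict.id_comp _)
lemma comp_id' {x y : IterPullback l r} (f : x ⟶ y) : f ≫ 𝟙 y = f :=
  Hom.ext (funext fun _ => Strict.comp_id _)
lemma assoc' {w x y z : IterPullback l r} (f : w ⟶ x) (g : x ⟶ y) (h : y ⟶ z) :
    (f ≫ g) ≫ h = f ≫ g ≫ h :=
  Hom.ext (funext fun _ => Strict.assoc _ _ _)

attribute [local simp] Strict.associator_eqToIso Strict.leftUnitor_eqToIso
  Strict.rightUnitor_eqToIso in
instance : Bicategory (IterPullback l r) where
  whiskerLeft f _ _ σ := whiskerL f σ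
  whiskerRight σ h := whiskerR σ h
  associator f g h := eqToIso (assoc' f g h)
  leftUnitor f := eqToIso (id_comp' f)
  rightUnitor f := eqToIso (comp_id' f)
  whiskerLeft_id := by intros; apply hom₂_ext; intro; simp
  whiskerLeft_comp := by intros; apply hom₂_ext; intro; simp
  id_whiskerLeft := by intros; apply hom₂_ext; intro; simp
  comp_whiskerLeft := by intros; apply hom₂_ext; intro; simp
  id_whiskerRight := by intros; apply hom₂_ext; intro; simp
  comp_whiskerRight := by intros; apply hom₂_ext; intro; simp
  whiskerRight_id := by intros; apply hom₂_ext; intro; simp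
  whiskerRight_comp := by intros; apply hom₂_ext; intro; simp
  whisker_assoc := by intros; apply hom₂_ext; intro; simp
  whisker_exchange := by intros; apply hom₂_ext; intro; simp [whisker_exchange]
  pentagon := by intros; apply hom₂_ext; intro; simp
  triangle := by intros; apply hom₂_ext; intro; simp

instance : Strict (IterPullback l r) where
  id_comp := id_comp'
  comp_id := comp_id'
  assoc := assoc'
  leftUnitor_eqToIso _ := rfl
  rightUnitor_eqToIso _ := rfl
  associator_eqToIso _ _ _ := rfl

/-- The projections of `IterPullback l r`. -/
@[simps! obj map map₂]
def proj (l : ∀ k, StrictPseudofunctor (E (s k)) (Y k))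
    (r : ∀ k, StrictPseudofunctor (E (t k)) (Y k)) (i : ι) :
    StrictPseudofunctor (IterPullback l r) (E i) :=
  .mk'' {
    obj := fun x => x.obj i
    map := fun f => f.hom i
    map₂ := fun σ => σ.cell i
    map_id := fun _ => rfl
    map_comp := fun _ _ => rfl
    map₂_whisker_left := fun _ _ _ _ => by simp; rfl
    map₂_whisker_right := fun _ _ => by simp; rfl }

end IterPullback

end IteratedPullbacks

section LaxComma

variable {A : Type u₁} [Bicategory.{w₁, v₁} A]
  {B : Type u₂} [Bicategory.{w₂, v₂} B]
  {C : Type u₃} [Bicategory.{w₃, v₃} C]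

/-- Lax natural transformations between 2-functors. -/
abbrev LaxNat (F G : StrictPseudofunctor A C) :=
  Lax.LaxTrans F.toPseudofunctor.toLax G.toPseudofunctor.toLax

/-- The lax comma 2-category `f / g`; its objects are morphisms `u : f a ⟶ g b`. -/
structure LaxComma (f : StrictPseudofunctor A C) (g : StrictPseudofunctor B C) where
  left : A
  right : B
  mor : f.obj left ⟶ g.obj right

namespace LaxComma

variable {f : StrictPseudofunctor A C} {g : StrictPseudofunctor B C}

/-- Morphisms of the lax comma 2-category. -/
@[ext]
structure Hom (X Y : LaxComma f g) where
  left : X.left ⟶ Y.left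
  right : X.right ⟶ Y.right
  cell : X.mor ≫ g.map right ⟶ f.map left ≫ Y.mor

/-- Cells of the lax comma 2-category. -/
@[ext]
structure Hom₂ {X Y : LaxComma f g} (s t : Hom X Y) where
  left : s.left ⟶ t.left
  right : s.right ⟶ t.right
  w : s.cell ≫ f.map₂ left ▷ Y.mor = X.mor ◁ g.map₂ right ≫ t.cell

/-- Identity morphisms. -/
@[simps]
def idHom (X : LaxComma f g) : Hom X X where
  left := 𝟙 X.left
  right := 𝟙 X.right
  cell := X.mor ◁ (g.mapId X.right).hom ≫ (ρ_ X.mor).hom ≫ (λ_ X.mor).inv ≫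
    (f.mapId X.left).inv ▷ X.mor

/-- Composition of morphisms. -/
@[simps]
def compHom {X Y Z : LaxComma f g} (s : Hom X Y) (t : Hom Y Z) : Hom X Z where
  left := s.left ≫ t.left
  right := s.right ≫ t.right
  cell := X.mor ◁ (g.mapComp s.right t.right).hom ≫ (α_ _ _ _).inv ≫ s.cell ▷ g.map t.right ≫
    (α_ _ _ _).hom ≫ f.map s.left ◁ t.cell ≫ (α_ _ _ _).inv ≫
    (f.mapComp s.left t.left).inv ▷ Z.mor

instance : CategoryStruct (LaxComma f g) where
  Hom := Hom
  id := idHom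
  comp := compHom

@[simp] lemma id_left (X : LaxComma f g) : Hom.left (𝟙 X) = 𝟙 X.left := rfl
@[simp] lemma id_right (X : LaxComma f g) : Hom.right (𝟙 X) = 𝟙 X.right := rfl
lemma id_cell (X : LaxComma f g) : Hom.cell (𝟙 X) = X.mor ◁ (g.mapId X.right).hom ≫
    (ρ_ X.mor).hom ≫ (λ_ X.mor).inv ≫ (f.mapId X.left).inv ▷ X.mor := rfl
@[simp] lemma comp_left {X Y Z : LaxComma f g} (s : X ⟶ Y) (t : Y ⟶ Z) :
    Hom.left (s ≫ t) = s.left ≫ t.left := rfl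
@[simp] lemma comp_right {X Y Z : LaxComma f g} (s : X ⟶ Y) (t : Y ⟶ Z) :
    Hom.right (s ≫ t) = s.right ≫ t.right := rfl
lemma comp_cell {X Y Z : LaxComma f g} (s : X ⟶ Y) (t : Y ⟶ Z) :
    Hom.cell (s ≫ t) = X.mor ◁ (g.mapComp s.right t.right).hom ≫ (α_ _ _ _).inv ≫
      s.cell ▷ g.map t.right ≫ (α_ _ _ _).hom ≫ f.map s.left ◁ t.cell ≫ (α_ _ _ _).inv ≫
      (f.mapComp s.left t.left).inv ▷ Z.mor := rfl

@[simps]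
instance homCategory (X Y : LaxComma f g) : Category (X ⟶ Y) where
  Hom s t := Hom₂ s t
  id s := ⟨𝟙 _, 𝟙 _, by simp⟩
  comp σ τ := ⟨σ.left ≫ τ.left, σ.right ≫ τ.right, by
    simp [← τ.w, reassoc_of% σ.w]⟩

@[ext]
lemma hom₂_ext {X Y : LaxComma f g} {s t : X ⟶ Y} {σ τ : s ⟶ t} (h : σ.left = τ.left)
    (h' : σ.right = τ.right) : σ = τ := Hom₂.ext h h'

/-- Construct an invertible cell of the lax comma 2-category. -/
@[simps]
def isoMk {X Y : LaxComma f g} {s t : X ⟶ Y} (l : s.left ≅ t.left) (r : s.right ≅ t.right)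
    (w : s.cell ≫ f.map₂ l.hom ▷ Y.mor = X.mor ◁ g.map₂ r.hom ≫ t.cell) : s ≅ t where
  hom := ⟨l.hom, r.hom, w⟩
  inv := ⟨l.inv, r.inv, by
    have : IsIso (X.mor ◁ g.map₂ r.hom) := inferInstance
    rw [← cancel_epi (X.mor ◁ g.map₂ r.hom), ← reassoc_of% w]
    simp [← comp_whiskerRight, ← whiskerLeft_comp_assoc, ← PrelaxFunctor.map₂_comp]⟩
  hom_inv_id := by ext <;> simp
  inv_hom_id := by ext <;> simp

/-- Left whiskering. -/
@[simps]
def whiskerL {X Y Z : LaxComma f g} (s : X ⟶ Y) {t t' : Y ⟶ Z} (τ : t ⟶ t') :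
    s ≫ t ⟶ s ≫ t' where
  left := s.left ◁ τ.left
  right := s.right ◁ τ.right
  w := by
    have h : t.cell ≫ f.map₂ τ.left ▷ Z.mor = Y.mor ◁ g.map₂ τ.right ≫ t'.cell := τ.w
    simp only [comp_cell, Category.assoc, Pseudofunctor.map₂_whisker_left, comp_left, comp_right]
    calc
      _ = X.mor ◁ (g.mapComp s.right t.right).hom ≫ 𝟙 _ ⊗≫ s.cell ▷ g.map t.right ⊗≫
          f.map s.left ◁ (t.cell ≫ f.map₂ τ.left ▷ Z.mor) ⊗≫
          (f.mapComp s.left t'.left).inv ▷ Z.mor := by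
        simp only [← comp_whiskerRight]
        simp only [Iso.inv_hom_id_assoc]
        bicategory
      _ = X.mor ◁ (g.mapComp s.right t.right).hom ≫ 𝟙 _ ⊗≫
          (s.cell ▷ g.map t.right ≫ (f.map s.left ≫ Y.mor) ◁ g.map₂ τ.right) ⊗≫
          f.map s.left ◁ t'.cell ⊗≫
          (f.mapComp s.left t'.left).inv ▷ Z.mor := by
        rw [h]; bicategory
      _ = _ := by
        rw [← whisker_exchange]
        simp only [whiskerLeft_comp, Category.assoc, whiskerLeft_inv_hom_assoc]
        bicategory

/-- Right whiskering. -/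
@[simps]
def whiskerR {X Y Z : LaxComma f g} {s s' : X ⟶ Y} (σ : s ⟶ s') (t : Y ⟶ Z) :
    s ≫ t ⟶ s' ≫ t where
  left := σ.left ▷ t.left
  right := σ.right ▷ t.right
  w := by
    have h : s.cell ≫ f.map₂ σ.left ▷ Y.mor = X.mor ◁ g.map₂ σ.right ≫ s'.cell := σ.w
    simp only [comp_cell, Category.assoc, Pseudofunctor.map₂_whisker_right, comp_left, comp_right]
    calc
      _ = X.mor ◁ (g.mapComp s.right t.right).hom ≫ 𝟙 _ ⊗≫ s.cell ▷ g.map t.right ⊗≫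
          (f.map s.left ◁ t.cell ≫ f.map₂ σ.left ▷ (f.map t.left ≫ Z.mor)) ⊗≫
          (f.mapComp s'.left t.left).inv ▷ Z.mor := by
        simp only [← comp_whiskerRight]
        simp only [Iso.inv_hom_id_assoc]
        bicategory
      _ = X.mor ◁ (g.mapComp s.right t.right).hom ≫ 𝟙 _ ⊗≫
          (s.cell ≫ f.map₂ σ.left ▷ Y.mor) ▷ g.map t.right ⊗≫
          f.map s'.left ◁ t.cell ⊗≫
          (f.mapComp s'.left t.left).inv ▷ Z.mor := by
        rw [whisker_exchange]; bicategory
      _ = _ := by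
        rw [h]
        simp only [whiskerLeft_comp, Category.assoc, whiskerLeft_inv_hom_assoc]
        bicategory

/-- The associator. -/
@[simps!]
def assoc {W X Y Z : LaxComma f g} (r : W ⟶ X) (s : X ⟶ Y) (t : Y ⟶ Z) :
    (r ≫ s) ≫ t ≅ r ≫ s ≫ t :=
  isoMk (α_ r.left s.left t.left) (α_ r.right s.right t.right) (by
    simp only [comp_cell, Category.assoc, Pseudofunctor.map₂_associator, comp_left, comp_right]
    calc
      _ = W.mor ◁ (g.mapComp (r.right ≫ s.right) t.right).hom ⊗≫
          W.mor ◁ (g.mapComp r.right s.right).hom ▷ g.map t.right ⊗≫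
          r.cell ▷ g.map s.right ▷ g.map t.right ⊗≫
          f.map r.left ◁ s.cell ▷ g.map t.right ⊗≫
          ((f.mapComp r.left s.left).inv ▷ (Y.mor ≫ g.map t.right) ≫
            f.map (r.left ≫ s.left) ◁ t.cell) ⊗≫
          (f.mapComp r.left s.left).hom ▷ f.map t.left ▷ Z.mor ⊗≫
          f.map r.left ◁ (f.mapComp s.left t.left).inv ▷ Z.mor ⊗≫
          (f.mapComp r.left (s.left ≫ t.left)).inv ▷ Z.mor := by
        simp only [← comp_whiskerRight]
        simp only [Iso.inv_hom_id_assoc]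
        bicategory
      _ = W.mor ◁ (g.mapComp (r.right ≫ s.right) t.right).hom ⊗≫
          W.mor ◁ (g.mapComp r.right s.right).hom ▷ g.map t.right ⊗≫
          r.cell ▷ g.map s.right ▷ g.map t.right ⊗≫
          f.map r.left ◁ s.cell ▷ g.map t.right ⊗≫
          f.map r.left ◁ f.map s.left ◁ t.cell ⊗≫
          ((f.mapComp r.left s.left).inv ≫ (f.mapComp r.left s.left).hom) ▷
            f.map t.left ▷ Z.mor ⊗≫
          f.map r.left ◁ (f.mapComp s.left t.left).inv ▷ Z.mor ⊗≫
          (f.mapComp r.left (s.left ≫ t.left)).inv ▷ Z.mor := by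
        rw [← whisker_exchange]; bicategory
      _ = W.mor ◁ (g.mapComp (r.right ≫ s.right) t.right).hom ⊗≫
          W.mor ◁ (g.mapComp r.right s.right).hom ▷ g.map t.right ⊗≫
          (r.cell ▷ (g.map s.right ≫ g.map t.right) ≫
            (f.map r.left ≫ X.mor) ◁ ((g.mapComp s.right t.right).inv ≫
              (g.mapComp s.right t.right).hom)) ⊗≫
          f.map r.left ◁ s.cell ▷ g.map t.right ⊗≫
          f.map r.left ◁ f.map s.left ◁ t.cell ⊗≫
          f.map r.left ◁ (f.mapComp s.left t.left).inv ▷ Z.mor ⊗≫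
          (f.mapComp r.left (s.left ≫ t.left)).inv ▷ Z.mor := by
        simp only [Iso.inv_hom_id]; bicategory
      _ = W.mor ◁ (g.mapComp (r.right ≫ s.right) t.right).hom ⊗≫
          W.mor ◁ (g.mapComp r.right s.right).hom ▷ g.map t.right ⊗≫
          (r.cell ▷ (g.map s.right ≫ g.map t.right) ≫
            (f.map r.left ≫ X.mor) ◁ (g.mapComp s.right t.right).inv) ⊗≫
          f.map r.left ◁ X.mor ◁ (g.mapComp s.right t.right).hom ⊗≫
          f.map r.left ◁ s.cell ▷ g.map t.right ⊗≫
          f.map r.left ◁ f.map s.left ◁ t.cell ⊗≫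
          f.map r.left ◁ (f.mapComp s.left t.left).inv ▷ Z.mor ⊗≫
          (f.mapComp r.left (s.left ≫ t.left)).inv ▷ Z.mor := by
        rw [whiskerLeft_comp]; bicategory
      _ = _ := by
        rw [← whisker_exchange]
        simp only [whiskerLeft_comp, Category.assoc, whiskerLeft_inv_hom_assoc]
        bicategory)

/-- The left unitor. -/
@[simps!]
def leftUnitor {X Y : LaxComma f g} (s : X ⟶ Y) : 𝟙 X ≫ s ≅ s :=
  isoMk (λ_ s.left) (λ_ s.right) (by
    simp only [comp_cell, id_cell, Category.assoc, Pseudofunctor.map₂_left_unitor, comp_left,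
      comp_right, id_left, id_right]
    calc
      _ = X.mor ◁ (g.mapComp (𝟙 X.right) s.right).hom ⊗≫
          X.mor ◁ (g.mapId X.right).hom ▷ g.map s.right ⊗≫
          ((f.mapId X.left).inv ▷ (X.mor ≫ g.map s.right) ≫
            f.map (𝟙 X.left) ◁ s.cell) ⊗≫
          (f.mapId X.left).hom ▷ f.map s.left ▷ Y.mor ⊗≫ 𝟙 _ := by
        simp only [← comp_whiskerRight]
        simp only [Iso.inv_hom_id_assoc]
        bicategory
      _ = X.mor ◁ (g.mapComp (𝟙 X.right) s.right).hom ⊗≫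
          X.mor ◁ (g.mapId X.right).hom ▷ g.map s.right ⊗≫ s.cell ⊗≫
          ((f.mapId X.left).inv ≫ (f.mapId X.left).hom) ▷ f.map s.left ▷ Y.mor ⊗≫ 𝟙 _ := by
        rw [← whisker_exchange]; bicategory
      _ = _ := by
        simp only [Iso.inv_hom_id]; bicategory)

/-- The right unitor. -/
@[simps!]
def rightUnitor {X Y : LaxComma f g} (s : X ⟶ Y) : s ≫ 𝟙 Y ≅ s :=
  isoMk (ρ_ s.left) (ρ_ s.right) (by
    simp only [comp_cell, id_cell, Category.assoc, Pseudofunctor.map₂_right_unitor, comp_left,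
      comp_right, id_left, id_right]
    calc
      _ = X.mor ◁ (g.mapComp s.right (𝟙 Y.right)).hom ⊗≫
          (s.cell ▷ g.map (𝟙 Y.right) ≫ (f.map s.left ≫ Y.mor) ◁ (g.mapId Y.right).hom) ⊗≫
          f.map s.left ◁ ((f.mapId Y.left).inv ≫ (f.mapId Y.left).hom) ▷ Y.mor ⊗≫ 𝟙 _ := by
        simp only [← comp_whiskerRight]
        simp only [Iso.inv_hom_id_assoc]
        bicategory
      _ = _ := by
        rw [← whisker_exchange]
        simp only [Iso.inv_hom_id]; bicategory)

instance : Bicategory (LaxComma f g) where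
  whiskerLeft := whiskerL
  whiskerRight := whiskerR
  associator := assoc
  leftUnitor := leftUnitor
  rightUnitor := rightUnitor
  whiskerLeft_id := by intros; ext <;> simp
  whiskerLeft_comp := by intros; ext <;> simp
  id_whiskerLeft := by intros; ext <;> simp
  comp_whiskerLeft := by intros; ext <;> simp
  id_whiskerRight := by intros; ext <;> simp
  comp_whiskerRight := by intros; ext <;> simp
  whiskerRight_id := by intros; ext <;> simp
  whiskerRight_comp := by intros; ext <;> simp
  whisker_assoc := by intros; ext <;> simp
  whisker_exchange := by intros; ext <;> simp [whisker_exchange]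
  pentagon := by intros; ext <;> simp
  triangle := by intros; ext <;> simp

@[simp] lemma whiskerLeft_left {X Y Z : LaxComma f g} (s : X ⟶ Y) {t t' : Y ⟶ Z} (τ : t ⟶ t') :
    Hom₂.left (s ◁ τ) = s.left ◁ τ.left := rfl
@[simp] lemma whiskerLeft_right {X Y Z : LaxComma f g} (s : X ⟶ Y) {t t' : Y ⟶ Z} (τ : t ⟶ t') :
    Hom₂.right (s ◁ τ) = s.right ◁ τ.right := rfl
@[simp] lemma whiskerRight_left {X Y Z : LaxComma f g} {s s' : X ⟶ Y} (σ : s ⟶ s') (t : Y ⟶ Z) :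
    Hom₂.left (σ ▷ t) = σ.left ▷ t.left := rfl
@[simp] lemma whiskerRight_right {X Y Z : LaxComma f g} {s s' : X ⟶ Y} (σ : s ⟶ s')
    (t : Y ⟶ Z) : Hom₂.right (σ ▷ t) = σ.right ▷ t.right := rfl

lemma hom_eq_of_cell {X Y : LaxComma f g} {s t : X ⟶ Y} (σ : s ⟶ t) (hl : s.left = t.left)
    (hr : s.right = t.right) (h₁ : σ.left = eqToHom hl) (h₂ : σ.right = eqToHom hr) : s = t := by
  obtain ⟨sl, sr, sc⟩ := s
  obtain ⟨tl, tr, tc⟩ := t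
  obtain ⟨σl, σr, hw⟩ := σ
  dsimp only at hl hr h₁ h₂
  subst hl hr h₁ h₂
  simp only [eqToHom_refl, PrelaxFunctor.map₂_id, id_whiskerRight, whiskerLeft_id,
    Category.comp_id, Category.id_comp] at hw
  rw [hw]

@[simp] lemma eqToHom_left {X Y : LaxComma f g} {s t : X ⟶ Y} (h : s = t) :
    (eqToHom h).left = eqToHom (congrArg Hom.left h) := by
  subst h; rfl
@[simp] lemma eqToHom_right {X Y : LaxComma f g} {s t : X ⟶ Y} (h : s = t) :
    (eqToHom h).right = eqToHom (congrArg Hom.right h) := by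
  subst h; rfl

instance [Strict A] [Strict B] : Strict (LaxComma f g) where
  id_comp s := hom_eq_of_cell (λ_ s).hom (Strict.id_comp _) (Strict.id_comp _)
    (by simp [Bicategory.leftUnitor, Strict.leftUnitor_eqToIso])
    (by simp [Bicategory.leftUnitor, Strict.leftUnitor_eqToIso])
  comp_id s := hom_eq_of_cell (ρ_ s).hom (Strict.comp_id _) (Strict.comp_id _)
    (by simp [Bicategory.rightUnitor, Strict.rightUnitor_eqToIso])
    (by simp [Bicategory.rightUnitor, Strict.rightUnitor_eqToIso])
  assoc r s t := hom_eq_of_cell (α_ r s t).hom (Strict.assoc _ _ _) (Strict.assoc _ _ _)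
    (by simp [Bicategory.associator, Strict.associator_eqToIso])
    (by simp [Bicategory.associator, Strict.associator_eqToIso])
  leftUnitor_eqToIso s := by
    ext <;> simp [Bicategory.leftUnitor, Strict.leftUnitor_eqToIso]
  rightUnitor_eqToIso s := by
    ext <;> simp [Bicategory.rightUnitor, Strict.rightUnitor_eqToIso]
  associator_eqToIso r s t := by
    ext <;> simp [Bicategory.associator, Strict.associator_eqToIso]

variable [Strict A] [Strict B]

/-- The projection `f / g ⟶ A`. -/
@[simps! obj map map₂]
def projLeft (f : StrictPseudofunctor A C) (g : StrictPseudofunctor B C) :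
    StrictPseudofunctor (LaxComma f g) A :=
  .mk'' {
    obj := fun X => X.left
    map := fun s => s.left
    map₂ := fun σ => σ.left
    map_id := fun _ => rfl
    map_comp := fun _ _ => rfl
    map₂_whisker_left := fun _ _ _ _ => by simp; exact (Category.id_comp _).symm
    map₂_whisker_right := fun _ _ => by simp; exact (Category.id_comp _).symm }

/-- The projection `f / g ⟶ B`. -/
@[simps! obj map map₂]
def projRight (f : StrictPseudofunctor A C) (g : StrictPseudofunctor B C) :
    StrictPseudofunctor (LaxComma f g) B :=
  .mk'' {
    obj := fun X => X.right
    map := fun s => s.right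
    map₂ := fun σ => σ.right
    map_id := fun _ => rfl
    map_comp := fun _ _ => rfl
    map₂_whisker_left := fun _ _ _ _ => by simp; exact (Category.id_comp _).symm
    map₂_whisker_right := fun _ _ => by simp; exact (Category.id_comp _).symm }

variable {J : Type u} [Bicategory.{w, v} J] [Strict J]

lemma lift_aux {W X Y Z : C} {x : W ⟶ X} {y : Y ⟶ Z} {g₀ g₁ g₂ : X ⟶ Z} {f₀ f₁ f₂ : W ⟶ Y}
    (a : g₀ ≅ g₁) (b : g₁ ≅ g₂) (c : f₀ ≅ f₁) (d : f₁ ≅ f₂) (n : x ≫ g₀ ⟶ f₀ ≫ y)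
    (m : x ≫ g₂ ⟶ f₂ ≫ y) (h : x ◁ (b.inv ≫ a.inv) ≫ n = m ≫ (d.inv ≫ c.inv) ▷ y) :
    n ≫ c.hom ▷ y = x ◁ a.hom ≫ x ◁ b.hom ≫ m ≫ d.inv ▷ y := by
  rw [← cancel_epi (x ◁ (b.inv ≫ a.inv)), reassoc_of% h]
  simp

lemma lift_aux₁ {W X Y Z : C} {x : W ⟶ X} {y : Y ⟶ Z} {g₀ g₁ g₂ : X ⟶ Z} {f₀ f₁ f₂ : W ⟶ Y}
    (a : g₀ ≅ g₁) (b : g₁ ≅ g₂) (c : f₀ ≅ f₁) (d : f₁ ≅ f₂) (n : x ≫ g₀ ⟶ f₀ ≫ y)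
    {k : W ⟶ Z} (m : x ≫ g₂ ⟶ k) (m' : k ⟶ f₂ ≫ y)
    (h : x ◁ (b.inv ≫ a.inv) ≫ n = m ≫ m' ≫ (d.inv ≫ c.inv) ▷ y) :
    n ≫ c.hom ▷ y = x ◁ a.hom ≫ x ◁ b.hom ≫ m ≫ m' ≫ d.inv ▷ y := by
  rw [lift_aux a b c d n (m ≫ m') (by rw [h, Category.assoc]), Category.assoc]

lemma lift_aux₂ {W X Y Z : C} {x : W ⟶ X} {y : Y ⟶ Z} {g₀ g₁ g₂ : X ⟶ Z} {f₀ f₁ f₂ : W ⟶ Y}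
    (a : g₀ ≅ g₁) (b : g₁ ≅ g₂) (c : f₀ ≅ f₁) (d : f₁ ≅ f₂) (n : x ≫ g₀ ⟶ f₀ ≫ y)
    {k₁ k₂ k₃ k₄ : W ⟶ Z} (m₁ : x ≫ g₂ ⟶ k₁) (m₂ : k₁ ⟶ k₂) (m₃ : k₂ ⟶ k₃) (m₄ : k₃ ⟶ k₄)
    (m₅ : k₄ ⟶ f₂ ≫ y)
    (h : x ◁ (b.inv ≫ a.inv) ≫ n = m₁ ≫ m₂ ≫ m₃ ≫ m₄ ≫ m₅ ≫ (d.inv ≫ c.inv) ▷ y) :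
    n ≫ c.hom ▷ y = x ◁ a.hom ≫ x ◁ b.hom ≫ m₁ ≫ m₂ ≫ m₃ ≫ m₄ ≫ m₅ ≫ d.inv ▷ y := by
  rw [lift_aux a b c d n (m₁ ≫ m₂ ≫ m₃ ≫ m₄ ≫ m₅) (by rw [h]; simp only [Category.assoc])]
  simp only [Category.assoc]

/-- The 2-functor into the lax comma 2-category that is induced by a lax natural transformation
`f ∘ p ⟶ g ∘ q`. -/
@[simps! obj map map₂]
def lift (p : StrictPseudofunctor J A) (q : StrictPseudofunctor J B)
    (χ : LaxNat (p.comp f) (q.comp g)) : StrictPseudofunctor J (LaxComma f g) :=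
  .mk'' {
    obj := fun i => ⟨p.obj i, q.obj i, χ.app i⟩
    map := fun s => ⟨p.map s, q.map s, χ.naturality s⟩
    map₂ := fun σ => ⟨p.map₂ σ, q.map₂ σ, χ.naturality_naturality σ⟩
    map₂_id := fun _ => by ext <;> simp
    map₂_comp := fun _ _ => by ext <;> simp
    map_id := fun i => by
      refine hom_eq_of_cell (f := f) (g := g) (X := ⟨p.obj i, q.obj i, χ.app i⟩)
        (Y := ⟨p.obj i, q.obj i, χ.app i⟩)
        ⟨(p.mapId i).hom, (q.mapId i).hom, ?_⟩ (p.map_id i) (q.map_id i)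
        (by simp [p.mapId_eq_eqToIso]) (by simp [q.mapId_eq_eqToIso])
      exact lift_aux₁ (g.map₂Iso (q.mapId i)) (g.mapId (q.obj i)) (f.map₂Iso (p.mapId i))
        (f.mapId (p.obj i)) (χ.naturality (𝟙 i)) (ρ_ (χ.app i)).hom (λ_ (χ.app i)).inv
        (χ.naturality_id i)
    map_comp := fun {i j k} s t => by
      refine hom_eq_of_cell (f := f) (g := g) (X := ⟨p.obj i, q.obj i, χ.app i⟩)
        (Y := ⟨p.obj k, q.obj k, χ.app k⟩)
        ⟨(p.mapComp s t).hom, (q.mapComp s t).hom, ?_⟩ (p.map_comp s t) (q.map_comp s t)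
        (by simp [p.mapComp_eq_eqToIso]) (by simp [q.mapComp_eq_eqToIso])
      exact lift_aux₂ (g.map₂Iso (q.mapComp s t)) (g.mapComp (q.map s) (q.map t))
        (f.map₂Iso (p.mapComp s t)) (f.mapComp (p.map s) (p.map t)) (χ.naturality (s ≫ t))
        (α_ (χ.app i) (g.map (q.map s)) (g.map (q.map t))).inv (χ.naturality s ▷ g.map (q.map t))
        (α_ (f.map (p.map s)) (χ.app j) (g.map (q.map t))).hom
        (f.map (p.map s) ◁ χ.naturality t)
        (α_ (f.map (p.map s)) (f.map (p.map t)) (χ.app k)).inv (χ.naturality_comp s t)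
    map₂_whisker_left := fun s _ _ τ => by
      ext <;> simp [p.mapComp_eq_eqToIso, q.mapComp_eq_eqToIso]
    map₂_whisker_right := fun σ t => by
      ext <;> simp [p.mapComp_eq_eqToIso, q.mapComp_eq_eqToIso] }

end LaxComma

end LaxComma

section Cells

/-- A 2-functor is invertible. -/
def IsInvertible {C : Type u₁} [Bicategory.{w₁, v₁} C] [Strict C] {D : Type u₂}
    [Bicategory.{w₂, v₂} D] [Strict D] (F : StrictPseudofunctor C D) : Prop :=
  ∃ G : StrictPseudofunctor D C, F.comp G = .id C ∧ G.comp F = .id D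

section

variable {J : Type u₁} [Bicategory.{w₁, v₁} J] {A : Type u₂} [Bicategory.{w₂, v₂} A]
  {B : Type u₃} [Bicategory.{w₃, v₃} B]
  {p : StrictPseudofunctor J A} {q : StrictPseudofunctor J B}

/-- `t` is one of the lifts `λ(u, j) : u^* j ⟶ j` of the cleavage. -/
def SplitCoTwoFibration.IsLam [Strict J] (K : SplitCoTwoFibration p) {i j : J} (t : i ⟶ j) : Prop :=
  ∃ h : i = K.pull j (p.map t), t = eqToHom h ≫ K.lam j (p.map t)

/-- `σ` is one of the lifts `λ(s, α) : s ⟶ α_! s` of the cleavage. -/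
def SplitCoTwoFibration.IsLam₂ (K : SplitCoTwoFibration p) {i j : J} {s t : i ⟶ j} (σ : s ⟶ t) :
    Prop :=
  ∃ h : K.push₂ s (p.map₂ σ) = t, σ = K.lam₂ s (p.map₂ σ) ≫ eqToHom h

/-- `t` is one of the lifts `ρ(i, v) : i ⟶ v_! i` of the cleavage. -/
def SplitOpTwoFibration.IsRho [Strict J] (K : SplitOpTwoFibration q) {i j : J} (t : i ⟶ j) : Prop :=
  ∃ h : K.push i (q.map t) = j, t = K.rho i (q.map t) ≫ eqToHom h

/-- `σ` is one of the lifts `ρ(β, t) : β^* t ⟶ t` of the cleavage. -/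
def SplitOpTwoFibration.IsRho₂ (K : SplitOpTwoFibration q) {i j : J} {s t : i ⟶ j} (σ : s ⟶ t) :
    Prop :=
  ∃ h : s = K.pull₂ t (q.map₂ σ), σ = eqToHom h ≫ K.rho₂ t (q.map₂ σ)

end

/-- Large 2-categories. -/
structure LargeTwoCat where
  carrier : Type u₁
  [bicategory : Bicategory.{w₁, v₁} carrier]
  [strict : Strict carrier]

instance : CoeSort LargeTwoCat.{w₁, v₁, u₁} (Type u₁) := ⟨LargeTwoCat.carrier⟩

instance (X : LargeTwoCat.{w₁, v₁, u₁}) : Bicategory.{w₁, v₁} X := X.bicategory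

instance (X : LargeTwoCat.{w₁, v₁, u₁}) : Strict X := X.strict

/-- Split two-sided 2-fibrations between large 2-categories. -/
structure Fibration (X Y : LargeTwoCat.{w₁, v₁, u₁}) where
  apex : LargeTwoCat.{w₁, v₁, u₁}
  p : StrictPseudofunctor apex X
  q : StrictPseudofunctor apex Y
  cleavage : SplitTwoSidedTwoFibration p q

/-- Paths `X 0 ⇸ X 1 ⇸ ⋯ ⇸ X (n + 1)` of `n + 1` split two-sided 2-fibrations. -/
structure FibrationPath (n : ℕ) where
  X : Fin (n + 2) → LargeTwoCat.{w₁, v₁, u₁}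
  H (m : Fin (n + 1)) : Fibration (X m.castSucc) (X m.succ)

namespace FibrationPath

variable {n : ℕ} (P : FibrationPath.{w₁, v₁, u₁} n)

/-- The 2-category `X 0` at the start of the path. -/
abbrev start : LargeTwoCat.{w₁, v₁, u₁} := P.X (Fin.castSucc 0)

/-- The 2-category `X (n + 1)` at the end of the path. -/
abbrev finish : LargeTwoCat.{w₁, v₁, u₁} := P.X (Fin.last n).succ

/-- The iterated pullback of the spans in the path. -/
abbrev Total : Type u₁ :=
  IterPullback (E := fun m : Fin (n + 1) => (P.H m).apex)
    (Y := fun m : Fin n => P.X m.succ.castSucc) (s := Fin.castSucc) (t := Fin.succ)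
    (fun m => (P.H m.castSucc).q) (fun m => (P.H m.succ).p)

/-- The left projection `∏ H ⟶ X 0`. -/
abbrev left : StrictPseudofunctor P.Total P.start := (IterPullback.proj _ _ 0).comp (P.H 0).p

/-- The right projection `∏ H ⟶ X (n + 1)`. -/
abbrev right : StrictPseudofunctor P.Total P.finish :=
  (IterPullback.proj _ _ (Fin.last n)).comp (P.H (Fin.last n)).q

variable {P}

/-- The morphisms `(λ(u, i₀), id, …, id)` of the iterated pullback. -/
def IsStartLam {x y : P.Total} (s : x ⟶ y) : Prop :=
  (P.H 0).cleavage.IsLam (s.hom 0) ∧ ∀ m, m ≠ 0 → IsIdMor (s.hom m)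

/-- The morphisms `(id, …, id, ρ(i_m, u), λ(u, i_(m+1)), id, …, id)` of the iterated pullback. -/
def IsInner {x y : P.Total} (s : x ⟶ y) : Prop :=
  ∃ k : Fin n, (P.H k.castSucc).cleavage.IsRho (s.hom k.castSucc) ∧
    (P.H k.succ).cleavage.IsLam (s.hom k.succ) ∧
    ∀ m, m ≠ k.castSucc → m ≠ k.succ → IsIdMor (s.hom m)

/-- The morphisms `(id, …, id, ρ(i_n, v))` of the iterated pullback. -/
def IsFinishRho {x y : P.Total} (s : x ⟶ y) : Prop :=
  (P.H (Fin.last n)).cleavage.IsRho (s.hom (Fin.last n)) ∧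
    ∀ m, m ≠ Fin.last n → IsIdMor (s.hom m)

/-- The cells `(λ(s₀, α), id, …, id)` of the iterated pullback. -/
def IsStartLam₂ {x y : P.Total} {s t : x ⟶ y} (σ : s ⟶ t) : Prop :=
  (P.H 0).cleavage.IsLam₂ (σ.cell 0) ∧ ∀ m, m ≠ 0 → IsIdCell (σ.cell m)

/-- The cells `(id, …, id, ρ(α, s_m), λ(s_(m+1), α), id, …, id)` of the iterated pullback. -/
def IsInner₂ {x y : P.Total} {s t : x ⟶ y} (σ : s ⟶ t) : Prop :=
  ∃ k : Fin n, (P.H k.castSucc).cleavage.IsRho₂ (σ.cell k.castSucc) ∧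
    (P.H k.succ).cleavage.IsLam₂ (σ.cell k.succ) ∧
    ∀ m, m ≠ k.castSucc → m ≠ k.succ → IsIdCell (σ.cell m)

/-- The cells `(id, …, id, ρ(β, s_n))` of the iterated pullback. -/
def IsFinishRho₂ {x y : P.Total} {s t : x ⟶ y} (σ : s ⟶ t) : Prop :=
  (P.H (Fin.last n)).cleavage.IsRho₂ (σ.cell (Fin.last n)) ∧
    ∀ m, m ≠ Fin.last n → IsIdCell (σ.cell m)

end FibrationPath

section

variable {A : Type u₁} [Bicategory.{w₁, v₁} A] {B : Type u₂} [Bicategory.{w₂, v₂} B]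
  {C : Type u₃} [Bicategory.{w₃, v₃} C] {J : Type u₄} [Bicategory.{w₄, v₄} J] [Strict J]
  {f : StrictPseudofunctor A C} {g : StrictPseudofunctor B C}
  {p : StrictPseudofunctor J A} {q : StrictPseudofunctor J B}

/-- Marked lax natural transformations `f h ⟶ g k` on the iterated pullback of a path. These are
the nullary cells with horizontal source `P` and vertical boundary `f h` and `g k`. -/
structure IsMarked {n : ℕ} {P : FibrationPath.{w, v, u} n} {h : StrictPseudofunctor P.start A}
    {k : StrictPseudofunctor P.finish B}
    (ψ : LaxNat ((P.left.comp h).comp f) ((P.right.comp k).comp g)) : Prop where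
  cm {x y : P.Total} (s : x ⟶ y) : FibrationPath.IsStartLam s → IsIdCell (ψ.naturality s)
  im {x y : P.Total} (s : x ⟶ y) : FibrationPath.IsInner s → IsIdCell (ψ.naturality s)
  om {x y : P.Total} (s : x ⟶ y) : FibrationPath.IsFinishRho s → IsIdCell (ψ.naturality s)

/-- The conditions that make a 2-functor `T`, from the iterated pullback of a path into `J` and
compatible with the projections, into a unary cell with horizontal target `J`. -/
structure IsUnaryCell (K : SplitTwoSidedTwoFibration p q) {n : ℕ} {P : FibrationPath.{w, v, u} n}
    (T : StrictPseudofunctor P.Total J) : Prop where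
  pcm {x y : P.Total} (s : x ⟶ y) : FibrationPath.IsStartLam s → K.IsLam (T.map s)
  poc {x y : P.Total} {s t : x ⟶ y} (σ : s ⟶ t) :
    FibrationPath.IsStartLam₂ σ → K.IsLam₂ (T.map₂ σ)
  iem {x y : P.Total} (s : x ⟶ y) : FibrationPath.IsInner s → IsIdMor (T.map s)
  iec {x y : P.Total} {s t : x ⟶ y} (σ : s ⟶ t) :
    FibrationPath.IsInner₂ σ → IsIdCell (T.map₂ σ)
  pom {x y : P.Total} (s : x ⟶ y) : FibrationPath.IsFinishRho s → K.IsRho (T.map s)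
  pcc {x y : P.Total} {s t : x ⟶ y} (σ : s ⟶ t) :
    FibrationPath.IsFinishRho₂ σ → K.IsRho₂ (T.map₂ σ)

/-- The conditions that make a 2-functor `T : X ⟶ J`, compatible with the projections, into a
`(0, 1)`-ary cell with horizontal target `J`: each morphism `T u` is the composite
`λ(p (T u), T y) ∘ ρ(T x, q (T u))`, and each cell `T α` is the composite
`ρ(q (T α), T v) ∘ λ(T u, p (T α))`. -/
structure IsZeroOneCell (K : SplitTwoSidedTwoFibration p q) {X : LargeTwoCat.{w, v, u}}
    (T : StrictPseudofunctor X J) : Prop where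
  cm {x y : X} (s : x ⟶ y) :
    ∃ h : K.push (T.obj x) (q.map (T.map s)) = K.pull (T.obj y) (p.map (T.map s)),
      T.map s = K.rho (T.obj x) (q.map (T.map s)) ≫ eqToHom h ≫
        K.lam (T.obj y) (p.map (T.map s))
  cc {x y : X} {s t : x ⟶ y} (σ : s ⟶ t) :
    ∃ h : K.push₂ (T.map s) (p.map₂ (T.map₂ σ)) = K.pull₂ (T.map t) (q.map₂ (T.map₂ σ)),
      T.map₂ σ = K.lam₂ (T.map s) (p.map₂ (T.map₂ σ)) ≫ eqToHom h ≫
        K.rho₂ (T.map t) (q.map₂ (T.map₂ σ))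

/-- The 2-functor `T` factorises the lax natural transformation `ψ : f h ⟶ g k` through
`χ : f p ⟶ g q`, that is `p T = h`, `q T = k` and `χ T = ψ`. -/
structure Factorises {X : Type u} [Bicategory.{w, v} X] (χ : LaxNat (p.comp f) (q.comp g))
    {h : StrictPseudofunctor X A} {k : StrictPseudofunctor X B} (ψ : LaxNat (h.comp f) (k.comp g))
    (T : StrictPseudofunctor X J) : Prop where
  left : T.comp p = h
  right : T.comp q = k
  app (x : X) : ψ.app x ≍ χ.app (T.obj x)
  naturality {x y : X} (s : x ⟶ y) : ψ.naturality s ≍ χ.naturality (T.map s)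

/-- The lax natural transformation `χ : f p ⟶ g q` exhibits `J` as the comma object of `f` and `g`
among large 2-categories, 2-functors and lax natural transformations. -/
def IsLaxComma (χ : LaxNat (p.comp f) (q.comp g)) : Prop :=
  ∀ (X : LargeTwoCat.{w, v, u}) (h : StrictPseudofunctor X A) (k : StrictPseudofunctor X B)
    (ψ : LaxNat (h.comp f) (k.comp g)), ∃! T : StrictPseudofunctor X J, Factorises χ ψ T

/-- The lax natural transformation `χ : f p ⟶ g q` is a marked one that forms a cartesian nullary
cell with horizontal source `J`: each nullary cell `ψ` with vertical boundary `f h` and `g k`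
factors uniquely through `χ`. The first two fields say that `χ` is a cell, the third is about cells
`ψ` on a path of positive length, and the last one about vertical cells, i.e. 2-natural
transformations. -/
structure IsNullaryCartesian (K : SplitTwoSidedTwoFibration p q)
    (χ : LaxNat (p.comp f) (q.comp g)) : Prop where
  cm {i j : J} (s : i ⟶ j) : K.IsLam s → IsIdCell (χ.naturality s)
  om {i j : J} (s : i ⟶ j) : K.IsRho s → IsIdCell (χ.naturality s)
  factor {n : ℕ} (P : FibrationPath.{w, v, u} n) (h : StrictPseudofunctor P.start A)
    (k : StrictPseudofunctor P.finish B)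
    (ψ : LaxNat ((P.left.comp h).comp f) ((P.right.comp k).comp g)) : IsMarked ψ →
      ∃! T : StrictPseudofunctor P.Total J, Factorises χ ψ T ∧ IsUnaryCell K T
  factor₀ (X : LargeTwoCat.{w, v, u}) (h : StrictPseudofunctor X A) (k : StrictPseudofunctor X B)
    (ψ : LaxNat (h.comp f) (k.comp g)) :
      (∀ {x y : X} (s : x ⟶ y), IsIdCell (ψ.naturality s)) →
        ∃! T : StrictPseudofunctor X J, Factorises χ ψ T ∧ IsZeroOneCell K T

end

end Cells

noncomputable section Chi

open Opposite

variable {J : Type u} [Bicategory.{u, u} J] [Strict J] {A : Type u} [Bicategory.{u, u} A] [Strict A]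
  {B : Type u} [Bicategory.{u, u} B] [Strict B]
  {p : StrictPseudofunctor J A} {q : StrictPseudofunctor J B}

/-- The object `i` of `J` as an object of the fibre over `(p i, q i)`. -/
def fibreObj (p : StrictPseudofunctor J A) (q : StrictPseudofunctor J B) (i : J) :
    Fibre p q (p.obj i) (q.obj i) := ⟨i, rfl, rfl⟩

variable (hA : ∀ a b : A, IsSmallCat.{w} (a ⟶ b))

/-- The 2-natural transformation `(-)^* i : y a ⟶ f`, with components `u ↦ u^* i = f u i`. -/
def inverseYoneda (f : Presheaf.{w} A) {a : A} (i : f.functor.obj (op a)) :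
    (yonedaTwo hA).obj a ⟶ f := yonedaInv f a i

/-- The modification `(-)^* s : (-)^* i ⟶ (-)^* j`, with components `u ↦ u^* s = f u s`. -/
def inverseYonedaMap (f : Presheaf.{w} A) {a : A} {i j : f.functor.obj (op a)} (s : i ⟶ j) :
    inverseYoneda hA f i ⟶ inverseYoneda hA f j := yonedaInvMap f a s

namespace SplitTwoSidedTwoFibration

variable (K : SplitTwoSidedTwoFibration p q) (D : JointlyReflectsIdCells p q)
  (hJ : ∀ (a : A) (b : B), IsSmallCat.{w} (Fibre p q a b))

/-- The lax natural transformation `χ : y p ⟶ ⌜J⌝ q` has the components `χ_i = (-)^* i` and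
`χ_s = (-)^* ŝ`, where `ŝ : (q s)_! i ⟶ (p s)^* j` is the unique morphism in the fibre over
`(p i, q j)` such that `λ(p s, j) ∘ ŝ ∘ ρ(i, q s) = s`. The equalities `h` and `h'` in the second
field are `(-)^* i ≫ (q s)_! = (-)^* (q s)_! i` and `(-)^* (p s)^* j = y (p s) ≫ (-)^* j`. -/
structure HasComponents (χ : LaxNat (p.comp (yonedaTwo hA)) (q.comp (K.curry D hJ))) : Prop where
  app (i : J) : χ.app i = inverseYoneda hA ((K.curry D hJ).obj (q.obj i)) (fibreObj p q i)
  naturality {i j : J} (s : i ⟶ j) :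
    ∃ t : K.pushObj (q.map s) (fibreObj p q i) ⟶ K.pullObj (p.map s) (fibreObj p q j),
      K.rhoHom (q.map s) (fibreObj p q i) ≫ t.hom ≫ K.lamHom (p.map s) (fibreObj p q j) = s ∧
      (∀ t' : K.pushObj (q.map s) (fibreObj p q i) ⟶ K.pullObj (p.map s) (fibreObj p q j),
        K.rhoHom (q.map s) (fibreObj p q i) ≫ t'.hom ≫ K.lamHom (p.map s) (fibreObj p q j) = s →
          t' = t) ∧
      ∃ h h', χ.naturality s =
        eqToHom h ≫ inverseYonedaMap hA ((K.curry D hJ).obj (q.obj j)) t ≫ eqToHom h'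

end SplitTwoSidedTwoFibration

end Chi

end TwoFib

open TwoFib

/-! The theorem is the Yoneda lemma combined with the factorisation of the morphisms and cells of
`J` through chosen lifts. By Yoneda, `i ↦ (-)^* i` is bijective on objects and on morphisms from the
fibre over `(a, b)` to the category of 2-natural transformations `y a ⟶ ⌜J⌝ b` and modifications
(`fibreYoneda_obj_bijective`, `fibreYoneda_map_bijective`). It turns composition with `⌜J⌝ v` into
`v_!` and composition with `y u` into `u^*`.

Hence an object of the lax comma 2-category `y / ⌜J⌝` is an object of some fibre, that is, an object
of `J`. A morphism over `u` and `v` from `i` to `j` is a modification from `(-)^* (v_! i)` to `(-)^*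
(u^* j)`, thus a fibre morphism `f : v_! i ⟶ u^* j`. The universal properties of the lifts say that
`f ↦ λ(u, j) ∘ f ∘ ρ(i, v)`, called `glue`, is a bijection from these onto the morphisms `i ⟶ j`
over `u` and `v` (`glue_injective`, `exists_glue`, `over_glue`). Its inverse is `s ↦ ŝ`, called
`hat`. Composition is respected since `λ` and `ρ` commute (`glue_comp`).

For cells, local discreteness enters. Factoring a cell `σ : s ⟶ t` over `α` and `β` through `λ(s,
α)` and `ρ(β, t)` leaves a cell over identities, so `α_! s = β^* t` and `σ` is the composite of the
two lifts (`push₂_eq_pull₂`, `cell_ext`). In terms of fibre morphisms, such a `σ` exists if and only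
if `α^* ∘ ŝ = t̂ ∘ β_!` (`glue_pullCell_eq_of_cell`, `exists_cell_of_glue_pullCell_eq`). This is the
defining equation of the cells of the lax comma 2-category. It also is the naturality of `χ` with
respect to cells. So the 2-functor induced by `χ` is bijective on objects, morphisms and cells
(`lift_chi_isBijective`), and therefore invertible.

The universal properties follow formally. A factorisation of `ψ` through `χ` is the same as a lift
of the 2-functor induced by `ψ` along the one induced by `χ` (`factorises_iff`), which exists
uniquely. For cartesianness only the cleavage conditions on this factorisation `T` have to be
proved. The cell `χ_s` is an identity exactly when `ŝ` is, that is, when `s = λ(p s, j) ∘ ρ(i, q s)`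
(`isIdCell_glueCell_hat_iff`). The marking of `ψ` thus makes `T s` such a composite, and one or both
of the lifts are identities when `T s` lies over identities in `A` or `B`. The conditions on cells
are automatic by local discreteness. -/

namespace TwoFib

/-! ### Extensionality and invertibility of 2-functors. -/

section TwoFunctors

variable {C : Type u₁} [Bicategory.{w₁, v₁} C] {D : Type u₂} [Bicategory.{w₂, v₂} D]

/-- The coherence isomorphisms of a strict pseudofunctor are forced to be the canonical identities,
so only objects, morphisms and cells matter. Heterogeneous equality spares transports along the
equalities of endpoints. -/
lemma twoFunctor_ext {F G : StrictPseudofunctor C D} (h₀ : ∀ x, F.obj x = G.obj x)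
    (h₁ : ∀ {x y : C} (f : x ⟶ y), F.map f ≍ G.map f)
    (h₂ : ∀ {x y : C} {f g : x ⟶ y} (σ : f ⟶ g), F.map₂ σ ≍ G.map₂ σ) : F = G := by
  obtain ⟨⟨⟨⟨⟨⟨Fo, Fm⟩, F₂⟩, _, _⟩, Fi, Fc, _, _, _, _, _⟩, _, Fi'⟩, _, Fc'⟩ := F
  obtain ⟨⟨⟨⟨⟨⟨Go, Gm⟩, G₂⟩, _, _⟩, Gi, Gc, _, _, _, _, _⟩, _, Gi'⟩, _, Gc'⟩ := G
  obtain rfl : Fo = Go := funext h₀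
  obtain rfl : @Fm = @Gm := by
    funext x y f; exact eq_of_heq (h₁ f)
  obtain rfl : @F₂ = @G₂ := by
    funext x y f g σ; exact eq_of_heq (h₂ σ)
  obtain rfl : Fi = Gi := by
    funext x; exact (Fi' x).trans (Gi' x).symm
  obtain rfl : @Fc = @Gc := by
    funext x y z f g; exact (Fc' f g).trans (Gc' f g).symm
  rfl

/-- A 2-functor that is bijective on objects, on morphisms and on cells. -/
structure IsBijective (F : StrictPseudofunctor C D) : Prop where
  obj : Function.Bijective F.obj
  map (x y : C) : Function.Bijective (F.map : (x ⟶ y) → (F.obj x ⟶ F.obj y))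
  map₂ {x y : C} (f g : x ⟶ y) : Function.Bijective (F.map₂ : (f ⟶ g) → (F.map f ⟶ F.map g))

namespace IsBijective

variable {F : StrictPseudofunctor C D} (hF : IsBijective F)
include hF

/-- Preimages are needed for morphisms between arbitrary objects of `D`, which equal objects `F.obj
x` only propositionally. This form and the three that follow allow for such equations between
endpoints. -/
lemma exists_map_heq {x y : C} {d d' : D} (hx : F.obj x = d) (hy : F.obj y = d') (f : d ⟶ d') :
    ∃ g : x ⟶ y, F.map g ≍ f := by
  subst hx hy
  exact ((hF.map x y).2 f).imp fun _ h => heq_of_eq h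

lemma exists_map₂_heq {x y : C} {g g' : x ⟶ y} {d d' : D} (hx : F.obj x = d) (hy : F.obj y = d')
    {f f' : d ⟶ d'} (hg : F.map g ≍ f) (hg' : F.map g' ≍ f') (α : f ⟶ f') :
    ∃ β : g ⟶ g', F.map₂ β ≍ α := by
  subst hx hy hg hg'
  exact ((hF.map₂ g g').2 α).imp fun _ h => heq_of_eq h

lemma heq_of_map_heq {x x' y y' : C} (hx : x = x') (hy : y = y') {g : x ⟶ y} {g' : x' ⟶ y'}
    (h : F.map g ≍ F.map g') : g ≍ g' := by
  subst hx hy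
  exact heq_of_eq ((hF.map x y).1 (eq_of_heq h))

lemma heq_of_map₂_heq {x x' y y' : C} (hx : x = x') (hy : y = y') {f g : x ⟶ y}
    {f' g' : x' ⟶ y'} (hf : f ≍ f') (hg : g ≍ g') {σ : f ⟶ g} {σ' : f' ⟶ g'}
    (h : F.map₂ σ ≍ F.map₂ σ') : σ ≍ σ' := by
  subst hx hy hf hg
  exact heq_of_eq ((hF.map₂ f g).1 (eq_of_heq h))

/-- The inverse consists of chosen preimages. By injectivity each of its 2-functor laws may be
checked after applying `F`, where it follows from preservation of the operations by `F`, up to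
heterogeneous equality. -/
theorem isInvertible [Strict C] [Strict D] : IsInvertible F := by
  choose o ho using hF.obj.2
  choose m hm using fun {d d' : D} (f : d ⟶ d') => hF.exists_map_heq (ho d) (ho d') f
  choose c hc using fun {d d' : D} {f f' : d ⟶ d'} (α : f ⟶ f') =>
    hF.exists_map₂_heq (ho d) (ho d') (hm f) (hm f') α
  have hcomp {a b d : D} (f : a ⟶ b) (g : b ⟶ d) : F.map (m f ≫ m g) ≍ f ≫ g := by
    rw [F.map_comp]
    exact heq_comp₁ (ho a) (ho b) (ho d) (hm f) (hm g)
  have id' (d : D) : m (𝟙 d) = 𝟙 (o d) := (hF.map _ _).1 <| eq_of_heq <| by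
    rw [F.map_id]
    exact (hm _).trans (heq_id₁ (ho d)).symm
  have comp' {a b d : D} (f : a ⟶ b) (g : b ⟶ d) : m (f ≫ g) = m f ≫ m g :=
    (hF.map _ _).1 <| eq_of_heq <| (hm _).trans (hcomp f g).symm
  refine ⟨.mk'' {
    obj := o
    map := m
    map₂ := c
    map₂_id := fun {a b} f => (hF.map₂ _ _).1 <| eq_of_heq <| by
      rw [F.map₂_id]
      exact (hc _).trans (heq_id₂ (ho a) (ho b) (hm f)).symm
    map₂_comp := fun {a b f g h} σ τ => (hF.map₂ _ _).1 <| eq_of_heq <| by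
      rw [F.map₂_comp]
      exact (hc _).trans (heq_comp₂ (ho a) (ho b) (hm f) (hm g) (hm h) (hc σ) (hc τ)).symm
    map_id := id'
    map_comp := comp'
    map₂_whisker_left := fun {a b d} f {g g'} η => (hF.map₂ _ _).1 <| eq_of_heq <| by
      refine (hc _).trans ((map₂_eqToHom_comp_heq F _ _).trans ((map₂_comp_eqToHom_heq F _ _).trans
        ((map₂_whiskerLeft_heq F _ _).trans ?_))).symm
      exact heq_whiskerLeft (ho a) (ho b) (ho d) (hm f) (hm g) (hm g') (hc η)
    map₂_whisker_right := fun {a b d f f'} η g => (hF.map₂ _ _).1 <| eq_of_heq <| by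
      refine (hc _).trans ((map₂_eqToHom_comp_heq F _ _).trans ((map₂_comp_eqToHom_heq F _ _).trans
        ((map₂_whiskerRight_heq F _ _).trans ?_))).symm
      exact heq_whiskerRight (ho a) (ho b) (ho d) (hm f) (hm f') (hm g) (hc η) }, ?_, ?_⟩
  · have hx (x : C) : o (F.obj x) = x := hF.obj.1 (ho _)
    have hf {x y : C} (f : x ⟶ y) : m (F.map f) ≍ f := hF.heq_of_map_heq (hx x) (hx y) (hm _)
    exact twoFunctor_ext hx hf fun {x y f g} σ =>
      hF.heq_of_map₂_heq (hx x) (hx y) (hf f) (hf g) (hc _)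
  · exact twoFunctor_ext ho hm hc

end IsBijective

lemma twoFunctor_comp_assoc {E : Type u₃} [Bicategory.{w₃, v₃} E] {E' : Type u₄}
    [Bicategory.{w₄, v₄} E'] (F : StrictPseudofunctor C D) (G : StrictPseudofunctor D E)
    (H : StrictPseudofunctor E E') : (F.comp G).comp H = F.comp (G.comp H) :=
  twoFunctor_ext (fun _ => rfl) (fun _ => HEq.rfl) (fun _ => HEq.rfl)

lemma twoFunctor_comp_id (F : StrictPseudofunctor C D) : F.comp (.id D) = F :=
  twoFunctor_ext (fun _ => rfl) (fun _ => HEq.rfl) (fun _ => HEq.rfl)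

/-- Applied to equations such as `T.comp p = h` between 2-functors, for which the images of a cell
have different types on the two sides. -/
lemma isIdCell_map₂_of_eq {F G : StrictPseudofunctor C D} (h : F = G) {x y : C} {f g : x ⟶ y}
    {σ : f ⟶ g} (hσ : IsIdCell (G.map₂ σ)) : IsIdCell (F.map₂ σ) := by
  subst h; exact hσ

lemma isIdCell_of_heq {x y : C} {f g f' g' : x ⟶ y}
    (hf : f = f') (hg : g = g') {σ : f ⟶ g} {τ : f' ⟶ g'} (h : σ ≍ τ) (hτ : IsIdCell τ) :
    IsIdCell σ := by
  subst hf hg h; exact hτ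

lemma IsIdMor.map [Strict C] [Strict D] (F : StrictPseudofunctor C D) {x y : C} {f : x ⟶ y}
    (hf : IsIdMor f) : IsIdMor (F.map f) := by
  obtain ⟨rfl, rfl⟩ := hf
  exact ⟨rfl, by simp [F.map_id]⟩

lemma isIdMor_map_of_eq [Strict D] {F G : StrictPseudofunctor C D} (h : F = G) {x y : C}
    {f : x ⟶ y} (hf : IsIdMor (G.map f)) : IsIdMor (F.map f) := by
  subst h; exact hf

end TwoFunctors

/-! ### Factorisations through `χ` as lifts of 2-functors into the lax comma 2-category. -/

section LaxCommaObjects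

variable {A : Type u₁} [Bicategory.{w₁, v₁} A] {B : Type u₂} [Bicategory.{w₂, v₂} B]
  {C : Type u₃} [Bicategory.{w₃, v₃} C]
  {f : StrictPseudofunctor A C} {g : StrictPseudofunctor B C}

namespace LaxComma

lemma mor_heq {X Y : LaxComma f g} (h : X = Y) : X.mor ≍ Y.mor := by subst h; rfl

lemma cell_heq {X Y X' Y' : LaxComma f g} (hX : X = X') (hY : Y = Y') {s : X ⟶ Y}
    {s' : X' ⟶ Y'} (h : s ≍ s') : s.cell ≍ s'.cell := by
  subst hX hY h; rfl

end LaxComma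

variable [Strict A] [Strict B] {J : Type u₄} [Bicategory.{w₄, v₄} J] [Strict J]
  {p : StrictPseudofunctor J A} {q : StrictPseudofunctor J B}

lemma LaxComma.lift_projLeft (χ : LaxNat (p.comp f) (q.comp g)) :
    (LaxComma.lift p q χ).comp (LaxComma.projLeft f g) = p :=
  twoFunctor_ext (fun _ => rfl) (fun _ => HEq.rfl) (fun _ => HEq.rfl)

lemma LaxComma.lift_projRight (χ : LaxNat (p.comp f) (q.comp g)) :
    (LaxComma.lift p q χ).comp (LaxComma.projRight f g) = q :=
  twoFunctor_ext (fun _ => rfl) (fun _ => HEq.rfl) (fun _ => HEq.rfl)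

variable {X : Type u} [Bicategory.{w, v} X] [Strict X]

/-- A 2-functor into `f / g` amounts to its two projections together with the lax natural
transformation that it classifies. The equation on the right therefore encodes `p T = h`, `q T = k`
and `χ T = ψ` at once. -/
lemma factorises_iff (χ : LaxNat (p.comp f) (q.comp g)) {h : StrictPseudofunctor X A}
    {k : StrictPseudofunctor X B} (ψ : LaxNat (h.comp f) (k.comp g))
    (T : StrictPseudofunctor X J) :
    Factorises χ ψ T ↔ T.comp (LaxComma.lift p q χ) = LaxComma.lift h k ψ := by
  constructor
  · rintro ⟨rfl, rfl, ha, hn⟩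
    have ha' (x : X) : χ.app (T.obj x) = ψ.app x := (eq_of_heq (ha x)).symm
    obtain ⟨a, n, h₁, h₂, h₃⟩ := ψ
    -- The components have to be identified first, as the types of the naturality cells depend on
    -- them.
    obtain rfl : (fun x => χ.app (T.obj x)) = a := funext ha'
    obtain rfl : (fun {x y : X} (s : x ⟶ y) => χ.naturality (T.map s)) = @n := by
      funext x y s; exact (eq_of_heq (hn s)).symm
    exact twoFunctor_ext (fun _ => rfl) (fun _ => HEq.rfl) (fun _ => HEq.rfl)
  · intro e
    have hl : T.comp p = h := by
      have := congrArg (fun F => F.comp (LaxComma.projLeft f g)) e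
      rwa [twoFunctor_comp_assoc, LaxComma.lift_projLeft, LaxComma.lift_projLeft] at this
    have hr : T.comp q = k := by
      have := congrArg (fun F => F.comp (LaxComma.projRight f g)) e
      rwa [twoFunctor_comp_assoc, LaxComma.lift_projRight, LaxComma.lift_projRight] at this
    have ho (x : X) : (T.comp (LaxComma.lift p q χ)).obj x = (LaxComma.lift h k ψ).obj x := by
      rw [e]
    refine ⟨hl, hr, fun x => (LaxComma.mor_heq (ho x)).symm, fun {x y} s =>
      (LaxComma.cell_heq (ho x) (ho y) (s := (T.comp (LaxComma.lift p q χ)).map s)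
        (s' := (LaxComma.lift h k ψ).map s) ?_).symm⟩
    rw [e]

/-- An equation `T.comp F = F'` with `F` invertible has exactly one solution, `F'` followed by the
inverse of `F`. -/
theorem existsUnique_factorises {χ : LaxNat (p.comp f) (q.comp g)}
    (hχ : IsInvertible (LaxComma.lift p q χ)) {h : StrictPseudofunctor X A}
    {k : StrictPseudofunctor X B} (ψ : LaxNat (h.comp f) (k.comp g)) :
    ∃! T : StrictPseudofunctor X J, Factorises χ ψ T := by
  obtain ⟨G, h₁, h₂⟩ := hχ
  simp only [factorises_iff]
  refine ⟨(LaxComma.lift h k ψ).comp G, ?_, fun T hT => ?_⟩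
  · dsimp only
    rw [twoFunctor_comp_assoc, h₂, twoFunctor_comp_id]
  · rw [← hT, twoFunctor_comp_assoc, h₁, twoFunctor_comp_id]

omit [Strict A] [Strict B] [Strict J] [Strict X] in
-- This carries the marking of `ψ` over to `χ T`. Both cells have the same boundary once the
-- components of `ψ` and `χ T` are identified.
lemma Factorises.isIdCell {χ : LaxNat (p.comp f) (q.comp g)} {h : StrictPseudofunctor X A}
    {k : StrictPseudofunctor X B} {ψ : LaxNat (h.comp f) (k.comp g)}
    {T : StrictPseudofunctor X J} (hT : Factorises χ ψ T) {x y : X} {s : x ⟶ y}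
    (hs : IsIdCell (ψ.naturality s)) : IsIdCell (χ.naturality (T.map s)) := by
  obtain ⟨rfl, rfl, ha, hn⟩ := hT
  have e (x : X) : χ.app (T.obj x) = ψ.app x := (eq_of_heq (ha x)).symm
  exact isIdCell_of_heq (C := C) (congrArg (· ≫ _) (e x)) (congrArg (_ ≫ ·) (e y)) (hn s).symm hs

end LaxCommaObjects

end TwoFib

namespace TwoFib

/-! ### The Yoneda lemma for 2-functors into `Cat`. -/

section YonedaLemma

open Opposite Bicategory.Opposite

variable {A : Type u} [Bicategory.{u, u} A] [Strict A] (hA : ∀ a b : A, IsSmallCat.{w} (a ⟶ b))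

/-- The functor `i ↦ (-)^* i` of the Yoneda lemma. -/
def inverseYonedaFunctor (f : Presheaf.{w} A) (a : A) :
    f.functor.obj (op a) ⥤ ((yonedaTwo hA).obj a ⟶ f) where
  obj i := inverseYoneda hA f i
  map s := inverseYonedaMap hA f s
  map_id i := Presheaf.hom₂_ext fun c => cat_cell_ext₀ fun w =>
    (f.functor.map (Quiver.Hom.op w)).toFunctor.map_id i
  map_comp s t := Presheaf.hom₂_ext fun c => cat_cell_ext₀ fun w =>
    (f.functor.map (Quiver.Hom.op w)).toFunctor.map_comp s t

section

variable (f : Presheaf.{w} A) {a : A}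

lemma presheaf_map_id_obj (i : f.functor.obj (op a)) :
    (f.functor.map (𝟙 (op a))).toFunctor.obj i = i := by
  rw [f.functor.map_id]; rfl

lemma presheaf_map_id_map {i j : f.functor.obj (op a)} (s : i ⟶ j) :
    (f.functor.map (𝟙 (op a))).toFunctor.map s =
      eqToHom (presheaf_map_id_obj f i) ≫ s ≫ eqToHom (presheaf_map_id_obj f j).symm :=
  CategoryTheory.Functor.congr_hom (congrArg Cat.Hom.toFunctor (f.functor.map_id (op a))) s

/-- Evaluation at the identity morphism. -/
def evalId : ((yonedaTwo hA).obj a ⟶ f) ⥤ f.functor.obj (op a) where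
  obj φ := (TwoNat.app φ (op a)).toFunctor.obj (𝟙 a)
  map m := (TwoModification.app m (op a)).toNatTrans.app (𝟙 a)
  map_id _ := rfl
  map_comp _ _ := rfl

lemma evalId_inverseYoneda (i : f.functor.obj (op a)) :
    (evalId hA f).obj (inverseYoneda hA f i) = i :=
  presheaf_map_id_obj f i

/-- Evaluating `(-)^* i` at the identity gives `(𝟙 a)^* i`, which is `i` by strictness of `f`. -/
lemma inverseYonedaFunctor_comp_evalId :
    inverseYonedaFunctor hA f a ⋙ evalId hA f = 𝟭 _ :=
  CategoryTheory.Functor.ext (evalId_inverseYoneda hA f) fun _ _ s => presheaf_map_id_map f s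

/-- Equations between functors, or between natural transformations, yield pointwise equations with
explicit `eqToHom`s. This lemma and the next three extract them from 2-natural transformations and
modifications. -/
lemma twoNat_naturality_obj {F G : StrictPseudofunctor Aᵒᵖ Cat.{u, u}} (φ : TwoNat F G)
    {c d : Aᵒᵖ} (u : c ⟶ d) (x : F.obj c) :
    (G.map u).toFunctor.obj ((φ.app c).toFunctor.obj x) =
      (φ.app d).toFunctor.obj ((F.map u).toFunctor.obj x) :=
  congrArg (fun H : F.obj c ⟶ G.obj d => H.toFunctor.obj x) (φ.naturality u)

lemma twoNat_naturality_map {F G : StrictPseudofunctor Aᵒᵖ Cat.{u, u}} (φ : TwoNat F G)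
    {c d : Aᵒᵖ} (u : c ⟶ d) {x y : F.obj c} (s : x ⟶ y) :
    (G.map u).toFunctor.map ((φ.app c).toFunctor.map s) =
      eqToHom (twoNat_naturality_obj φ u x) ≫
        (φ.app d).toFunctor.map ((F.map u).toFunctor.map s) ≫
          eqToHom (twoNat_naturality_obj φ u y).symm :=
  CategoryTheory.Functor.congr_hom (congrArg Cat.Hom.toFunctor (φ.naturality u)) s

lemma twoNat_naturality₂_app {F G : StrictPseudofunctor Aᵒᵖ Cat.{u, u}} (φ : TwoNat F G)
    {c d : Aᵒᵖ} {u u' : c ⟶ d} (η : u ⟶ u') (x : F.obj c) :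
    (G.map₂ η).toNatTrans.app ((φ.app c).toFunctor.obj x) =
      eqToHom (twoNat_naturality_obj φ u x) ≫
        (φ.app d).toFunctor.map ((F.map₂ η).toNatTrans.app x) ≫
          eqToHom (twoNat_naturality_obj φ u' x).symm := by
  have h := congrArg (fun m => m.toNatTrans.app x) (φ.naturality₂ η)
  simpa using h

lemma twoMod_naturality_app {F G : StrictPseudofunctor Aᵒᵖ Cat.{u, u}} {φ ψ : TwoNat F G}
    (m : φ ⟶ ψ) {c d : Aᵒᵖ} (u : c ⟶ d) (x : F.obj c) :
    (G.map u).toFunctor.map ((m.app c).toNatTrans.app x) =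
      eqToHom (twoNat_naturality_obj φ u x) ≫
        (m.app d).toNatTrans.app ((F.map u).toFunctor.obj x) ≫
          eqToHom (twoNat_naturality_obj ψ u x).symm := by
  have h := congrArg (fun m => m.toNatTrans.app x) (m.naturality u)
  simpa using h

end

section

variable {f : Presheaf.{w} A} {a : A}

/-- Naturality of `φ` at `w`, applied to the identity of `a`, gives `φ(w) = w^* φ(𝟙 a)`. The same
argument with a cell `α` in place of `w` and 2-dimensional naturality gives the action of `φ` on
morphisms of the hom-category. -/
lemma inverseYoneda_evalId (φ : (yonedaTwo hA).obj a ⟶ f) :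
    inverseYoneda hA f ((evalId hA f).obj φ) = φ := by
  refine TwoNat.ext (funext fun c => cat_hom_ext (fun w => ?_) fun w w' α => ?_)
  · exact (twoNat_naturality_obj φ (Quiver.Hom.op w) (𝟙 a)).trans
      (congrArg (TwoNat.app φ c).toFunctor.obj (Strict.comp_id (show c.unop ⟶ a from w)))
  · refine (twoNat_naturality₂_app φ (op2 (f := w) (g := w') α) (𝟙 a)).trans ?_
    -- The representable acts on the identity of `a` by the whiskering of `α` with it, which is `α`
    -- up to the equations `w ≫ 𝟙 a = w` and `w' ≫ 𝟙 a = w'`.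
    have h : ((homFunctor a).map₂ (op2 (f := w) (g := w') α)).toNatTrans.app (𝟙 a) = _ :=
      Strict.whiskerRight_id' (f := (show c.unop ⟶ a from w)) α
    erw [h]
    erw [Functor.map_comp, Functor.map_comp, eqToHom_map, eqToHom_map]
    simp
    rfl

/-- The component of a modification at `w` is, up to identities, the restriction along `w` of its
component at the identity of `a`. -/
lemma evalId_map_injective {φ ψ : (yonedaTwo hA).obj a ⟶ f} {m n : φ ⟶ ψ}
    (h : (evalId hA f).map m = (evalId hA f).map n) : m = n := by
  refine Presheaf.hom₂_ext fun c => cat_cell_ext₀ fun w => ?_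
  have hm := twoMod_naturality_app m (Quiver.Hom.op (show c.unop ⟶ a from w)) (𝟙 a)
  have hn := twoMod_naturality_app n (Quiver.Hom.op (show c.unop ⟶ a from w)) (𝟙 a)
  have e := (hm.symm.trans (congrArg (f.functor.map (Quiver.Hom.op w)).toFunctor.map h)).trans hn
  rw [cancel_epi, cancel_mono] at e
  -- So far the two modifications agree at `w ≫ 𝟙 a` instead of `w`. The types of their components
  -- depend on this object, hence the transport along an equation between variables.
  have key {z z' : (homFunctor a).obj c} (hz : z = z')
      (e : (TwoModification.app m c).toNatTrans.app z =
        (TwoModification.app n c).toNatTrans.app z) :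
      (TwoModification.app m c).toNatTrans.app z' =
        (TwoModification.app n c).toNatTrans.app z' := by
    subst hz; exact e
  exact key (Strict.comp_id (show c.unop ⟶ a from w)) e

variable (f) in
-- Evaluation at the identity is a left inverse, which gives injectivity. It is itself injective on
-- modifications, so a modification is the image of its evaluation, conjugated with the equations
-- `(𝟙 a)^* i = i` and `(𝟙 a)^* j = j`.
lemma inverseYonedaFunctor_map_bijective (i j : f.functor.obj (op a)) :
    Function.Bijective ((inverseYonedaFunctor hA f a).map (X := i) (Y := j)) := by
  have h {i j : f.functor.obj (op a)} (s : i ⟶ j) := CategoryTheory.Functor.congr_hom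
    (inverseYonedaFunctor_comp_evalId hA f) s
  dsimp at h
  constructor
  · intro s t e
    have := h s
    rw [e, h t] at this
    rwa [cancel_epi, cancel_mono, eq_comm] at this
  · intro m
    refine ⟨eqToHom (evalId_inverseYoneda hA f i).symm ≫ (evalId hA f).map m ≫
      eqToHom (evalId_inverseYoneda hA f j), evalId_map_injective hA ?_⟩
    rw [h]
    simp only [Category.assoc]
    erw [eqToHom_trans, eqToHom_trans_assoc]
    simp only [eqToHom_refl, Category.comp_id]
    exact Category.id_comp _

lemma inverseYoneda_injective {i j : f.functor.obj (op a)}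
    (h : inverseYoneda hA f i = inverseYoneda hA f j) : i = j := by
  rw [← evalId_inverseYoneda hA f i, h, evalId_inverseYoneda]

end

section

variable {f g : Presheaf.{w} A} {a a' : A}

/-- The Yoneda correspondence is 2-natural in the presheaf and in the representing object. This is
one of six lemmas that express it for objects, morphisms and cells. Here the two sides at `w` are `θ
(w^* i)` and `w^* (θ i)`; for the representing object one compares `(w ≫ v)^* i` with `w^* (v^* i)`.
-/
lemma inverseYoneda_comp (i : f.functor.obj (op a)) (θ : f ⟶ g) :
    inverseYoneda hA f i ≫ θ = inverseYoneda hA g ((TwoNat.app θ (op a)).toFunctor.obj i) :=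
  TwoNat.ext (funext fun c => cat_hom_ext
    (fun w => (twoNat_naturality_obj θ (Quiver.Hom.op w) i).symm) fun w w' α =>
      flip_eqToHom _ _ (twoNat_naturality₂_app θ (op2 (f := w) (g := w') α) i))

lemma yonedaTwo_comp_inverseYoneda (v : a' ⟶ a) (i : f.functor.obj (op a)) :
    (yonedaTwo hA).map v ≫ inverseYoneda hA f i =
      inverseYoneda hA f ((f.functor.map v.op).toFunctor.obj i) :=
  TwoNat.ext (funext fun c => cat_hom_ext
    (fun w => map_comp_obj f.functor v.op (Quiver.Hom.op w) i) fun w w' α =>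
      map₂_whiskerLeft_app f.functor v.op (op2 (f := w) (g := w') α) i)

lemma inverseYoneda_map_whiskerRight {i j : f.functor.obj (op a)} (s : i ⟶ j) (θ : f ⟶ g) :
    (inverseYonedaFunctor hA f a).map s ▷ θ = eqToHom (inverseYoneda_comp hA i θ) ≫
      (inverseYonedaFunctor hA g a).map ((TwoNat.app θ (op a)).toFunctor.map s) ≫
        eqToHom (inverseYoneda_comp hA j θ).symm :=
  Presheaf.cell_ext _ _ fun c => cat_cell_ext _ _ fun w =>
    flip_eqToHom _ _ (twoNat_naturality_map θ (Quiver.Hom.op w) s)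

lemma whiskerLeft_inverseYoneda_map (v : a' ⟶ a) {i j : f.functor.obj (op a)} (s : i ⟶ j) :
    (yonedaTwo hA).map v ◁ (inverseYonedaFunctor hA f a).map s =
      eqToHom (yonedaTwo_comp_inverseYoneda hA v i) ≫
        (inverseYonedaFunctor hA f a').map ((f.functor.map v.op).toFunctor.map s) ≫
          eqToHom (yonedaTwo_comp_inverseYoneda hA v j).symm :=
  Presheaf.cell_ext _ _ fun c => cat_cell_ext _ _ fun w =>
    map_comp_map f.functor v.op (Quiver.Hom.op w) s

lemma inverseYoneda_whiskerLeft (i : f.functor.obj (op a)) {θ θ' : f ⟶ g} (m : θ ⟶ θ') :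
    inverseYoneda hA f i ◁ m = eqToHom (inverseYoneda_comp hA i θ) ≫
      (inverseYonedaFunctor hA g a).map ((TwoModification.app m (op a)).toNatTrans.app i) ≫
        eqToHom (inverseYoneda_comp hA i θ').symm :=
  Presheaf.cell_ext _ _ fun c => cat_cell_ext _ _ fun w =>
    flip_eqToHom _ _ (twoMod_naturality_app m (Quiver.Hom.op w) i)

lemma yonedaTwo_map₂_whiskerRight {v v' : a' ⟶ a} (α : v ⟶ v') (i : f.functor.obj (op a)) :
    (yonedaTwo hA).map₂ α ▷ inverseYoneda hA f i =
      eqToHom (yonedaTwo_comp_inverseYoneda hA v i) ≫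
        (inverseYonedaFunctor hA f a').map ((f.functor.map₂ (op2 α)).toNatTrans.app i) ≫
          eqToHom (yonedaTwo_comp_inverseYoneda hA v' i).symm :=
  Presheaf.cell_ext _ _ fun c => cat_cell_ext _ _ fun w =>
    map₂_whiskerRight_app f.functor (op2 α) (Quiver.Hom.op w) i

end

end YonedaLemma

end TwoFib

namespace TwoFib

/-! ### Morphisms and cells of `J` in terms of fibre morphisms `v_! x ⟶ u^* y`. -/

noncomputable section Gluing

variable {J : Type u₁} [Bicategory.{w₁, v₁} J] [Strict J]
  {A : Type u₂} [Bicategory.{w₂, v₂} A] [Strict A]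
  {B : Type u₃} [Bicategory.{w₃, v₃} B] [Strict B]
  {p : StrictPseudofunctor J A} {q : StrictPseudofunctor J B} {a a' a'' : A} {b b' b'' : B}

namespace SplitTwoSidedTwoFibration

open Fibre

variable (K : SplitTwoSidedTwoFibration p q)

/-- The morphism `λ(u, y) ∘ f ∘ ρ(x, v)`. -/
def glue {u : a ⟶ a'} {v : b ⟶ b'} {x : Fibre p q a b} {y : Fibre p q a' b'}
    (f : K.pushObj v x ⟶ K.pullObj u y) : x.obj ⟶ y.obj :=
  K.rhoHom v x ≫ f.hom ≫ K.lamHom u y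

section

variable {u u' : a ⟶ a'} {v v' : b ⟶ b'} {x : Fibre p q a b} {y : Fibre p q a' b'}

lemma over_glue (f : K.pushObj v x ⟶ K.pullObj u y) : Over (K.glue f) u v :=
  ((K.over_rhoHom v x).comp ((over_hom f).comp (K.over_lamHom u y))).congr (by simp) (by simp)

lemma glue_injective {f g : K.pushObj v x ⟶ K.pullObj u y} (h : K.glue f = K.glue g) : f = g :=
  K.rho_lam_unique h

/-- Factoring `s` through the opcartesian lift of `v` leaves a morphism over `u` and an identity of
`B`, which then factors through the cartesian lift of `u`. -/
lemma exists_glue {s : x.obj ⟶ y.obj} (hs : Over s u v) :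
    ∃ f : K.pushObj v x ⟶ K.pullObj u y, K.glue f = s := by
  obtain ⟨t, ⟨ht, h⟩, -⟩ := K.existsUnique_rho v x s hs
  refine ⟨K.lamLift u t ht, ?_⟩
  rw [glue, lamLift_lam, h]

/-- In the composite of the glued morphisms `λ(u, y)` is followed by `ρ(y, t)`. Since the lifts
commute, these can be exchanged. Then `ρ` moves past `f`, turning it into `t_! f`, and `λ` moves
past `g`, turning it into `u^* g`. -/
lemma glue_comp {w : a' ⟶ a''} {t : b' ⟶ b''} {z : Fibre p q a'' b''}
    (f : K.pushObj v x ⟶ K.pullObj u y) (g : K.pushObj t y ⟶ K.pullObj w z) :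
    K.glue (eqToHom (K.pushObj_comp v t x) ≫ (K.pushFunctor a t).map f ≫
      eqToHom (K.pushObj_pullObj u t y) ≫ (K.pullFunctor b'' u).map g ≫
        eqToHom (K.pullObj_comp u w z).symm) = K.glue f ≫ K.glue g := by
  have h₁ := K.rho_push_map t f
  have h₂ := K.lamHom_rhoHom u t y
  have h₃ := K.pull_map_lam u g
  simp only [glue, comp_hom, eqToHom_hom, rhoHom_comp, lamHom_comp, Category.assoc,
    eqToHom_trans_assoc, eqToHom_refl, Category.id_comp]
  rw [← Category.assoc (K.lamHom u y), ← h₂]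
  simp only [Category.assoc]
  rw [reassoc_of% h₁, reassoc_of% h₃]

/-- The cell is the one out of `λ(u, y)` that defines `α^*`, whiskered with `ρ(x, v)` and `f`. So
composing a fibre morphism with `α^*` amounts to pushing the glued morphism forward along `α`. The
next lemma is the dual one for `β_!`. -/
lemma cellL_glue (D : JointlyReflectsIdCells p q) (f : K.pushObj v x ⟶ K.pullObj u y)
    (α : u ⟶ u') : CellL (K.glue f) (K.glue (f ≫ K.pullCell D α y)) α v := by
  refine ((((K.pullCell_spec D α y).whiskerLeft ((K.over_rhoHom v x).comp (over_hom f))).congr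
    ?_ ?_ ?_ ?_).eq ?_ ?_)
  · simp
  · simp
  · exact (heq_whiskerLeft rfl rfl rfl (heq_of_eq (Category.id_comp (𝟙 _))) HEq.rfl HEq.rfl
      HEq.rfl).trans (id_whiskerLeft_heq α)
  · simp
  · simp [glue]
  · simp [glue]

lemma cellR_glue (D : JointlyReflectsIdCells p q) (f : K.pushObj v' x ⟶ K.pullObj u y)
    (β : v ⟶ v') : CellR (K.glue (K.pushCell D β x ≫ f)) (K.glue f) u β := by
  refine ((((K.pushCell_spec D β x).whiskerRight ((over_hom f).comp (K.over_lamHom u y))).congr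
    ?_ ?_ ?_ ?_).eq ?_ ?_)
  · simp
  · simp
  · exact (heq_whiskerRight rfl rfl rfl HEq.rfl HEq.rfl (heq_of_eq (Category.comp_id (𝟙 _)))
      HEq.rfl).trans (whiskerRight_id_heq β)
  · simp
  · simp [glue]
  · simp [glue]

end

/-- This is the opcartesian property of the lift, together with the fact that `q` maps the lift to
an identity and so does not see it. With `α` only heterogeneously equal to the image of `σ`, two
cells with equal images can be factored through literally the same lift. -/
lemma exists_lam₂_factor (K : SplitTwoSidedTwoFibration p q) {i j : J} {s t : i ⟶ j} (σ : s ⟶ t)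
    {v : p.obj i ⟶ p.obj j} (α : p.map s ⟶ v) (hv : v = p.map t) (hα : p.map₂ σ ≍ α) :
    ∃ τ : K.push₂ s α ⟶ t, K.lam₂ s α ≫ τ = σ ∧ IsIdCell (p.map₂ τ) ∧ q.map₂ τ ≍ q.map₂ σ := by
  subst hv hα
  obtain ⟨τ, ⟨h₁, h₂⟩, -⟩ := K.lam₂_opcartesian s (p.map₂ σ) t σ
    (eqToHom (K.map_push₂ s (p.map₂ σ))) (by simp [K.map₂_lam₂])
  refine ⟨τ, h₂, ⟨_, h₁⟩, ?_⟩
  have h := congrArg q.map₂ h₂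
  rw [q.map₂_comp, K.q_lam₂] at h
  rw [← h]
  simp

lemma exists_rho₂_factor (K : SplitTwoSidedTwoFibration p q) {i j : J} {s t : i ⟶ j} (σ : s ⟶ t)
    {v : q.obj i ⟶ q.obj j} (β : v ⟶ q.map t) (hv : v = q.map s) (hβ : q.map₂ σ ≍ β) :
    ∃ κ : s ⟶ K.pull₂ t β, κ ≫ K.rho₂ t β = σ ∧ IsIdCell (q.map₂ κ) ∧ p.map₂ κ ≍ p.map₂ σ := by
  subst hv hβ
  obtain ⟨κ, ⟨h₁, h₂⟩, -⟩ := K.rho₂_cartesian t (q.map₂ σ) s σ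
    (eqToHom (K.map_pull₂ t (q.map₂ σ)).symm) (by simp [K.map₂_rho₂])
  refine ⟨κ, h₂, ⟨_, h₁⟩, ?_⟩
  have h := congrArg p.map₂ h₂
  rw [p.map₂_comp, K.p_rho₂] at h
  rw [← h]
  simp

/-- Local discreteness only mentions identity cells. To deduce faithfulness, both cells are factored
through the same lift `λ` of cells and then the same lift `ρ`. The cells that remain in the middle
lie over identities, so they are identities between the same morphisms. -/
lemma cell_ext (K : SplitTwoSidedTwoFibration p q) (D : JointlyReflectsIdCells p q) {i j : J}
    {s t : i ⟶ j} {σ σ' : s ⟶ t} (hp : p.map₂ σ = p.map₂ σ') (hq : q.map₂ σ = q.map₂ σ') :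
    σ = σ' := by
  obtain ⟨τ, h, hτ, k⟩ := K.exists_lam₂_factor σ (p.map₂ σ) rfl HEq.rfl
  obtain ⟨τ', h', hτ', k'⟩ := K.exists_lam₂_factor σ' (p.map₂ σ) rfl (heq_of_eq hp.symm)
  have hk : q.map₂ τ' = q.map₂ τ :=
    eq_of_heq (k'.trans ((heq_of_eq hq.symm).trans k.symm))
  obtain ⟨κ, l, hκ, m⟩ := K.exists_rho₂_factor τ (q.map₂ τ) rfl HEq.rfl
  obtain ⟨κ', l', hκ', m'⟩ := K.exists_rho₂_factor τ' (q.map₂ τ) rfl (heq_of_eq hk)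
  have r := K.p_pull₂ t (q.map₂ τ)
  obtain ⟨_, rfl⟩ := D κ (isIdCell_of_heq rfl r m hτ) hκ
  obtain ⟨_, rfl⟩ := D κ' (isIdCell_of_heq rfl r m' hτ') hκ'
  rw [← h, ← h', ← l, ← l']

/-- The comparison cell from `α_! s` to `β^* t` lies over identities in `A` and `B`, hence is an
identity. This decomposition is what makes all conditions on cells automatic later on. -/
lemma push₂_eq_pull₂ (K : SplitTwoSidedTwoFibration p q) (D : JointlyReflectsIdCells p q)
    {i j : J} {s t : i ⟶ j} (σ : s ⟶ t) :
    ∃ h : K.push₂ s (p.map₂ σ) = K.pull₂ t (q.map₂ σ),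
      σ = K.lam₂ s (p.map₂ σ) ≫ eqToHom h ≫ K.rho₂ t (q.map₂ σ) := by
  obtain ⟨τ, h, hτ, k⟩ := K.exists_lam₂_factor σ (p.map₂ σ) rfl HEq.rfl
  -- The cell `τ` starts at `α_! s`, whose image in `B` equals that of `s` only propositionally; so
  -- its image in `B` is merely heterogeneously equal to that of `σ`.
  obtain ⟨κ, l, hκ, m⟩ := K.exists_rho₂_factor τ (q.map₂ σ) (K.q_push₂ s (p.map₂ σ)).symm k
  obtain ⟨e, rfl⟩ := D κ (isIdCell_of_heq rfl (K.p_pull₂ _ _) m hτ) hκ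
  exact ⟨e, by rw [l, h]⟩

/-- The two sides glue to `α_! s` and to `β^* t`, where `α` and `β` are the images of `σ`. These
agree because of the existence of `σ`. -/
lemma glue_pullCell_eq_of_cell (K : SplitTwoSidedTwoFibration p q)
    (D : JointlyReflectsIdCells p q) {i j : J} {s t : i ⟶ j} (σ : s ⟶ t)
    (f : K.pushObj (q.map s) ⟨i, rfl, rfl⟩ ⟶ K.pullObj (p.map s) ⟨j, rfl, rfl⟩)
    (g : K.pushObj (q.map t) ⟨i, rfl, rfl⟩ ⟶ K.pullObj (p.map t) ⟨j, rfl, rfl⟩)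
    (hf : K.glue f = s) (hg : K.glue g = t) :
    f ≫ K.pullCell D (p.map₂ σ) ⟨j, rfl, rfl⟩ = K.pushCell D (q.map₂ σ) ⟨i, rfl, rfl⟩ ≫ g := by
  apply K.glue_injective
  have h₁ := (K.cellL_glue D f (p.map₂ σ)).eq hf rfl
  have h₂ := (K.cellR_glue D g (q.map₂ σ)).eq rfl hg
  obtain ⟨h, -⟩ := K.push₂_eq_pull₂ D σ
  trans K.push₂ s (p.map₂ σ)
  · exact cellL_unique K D h₁ ⟨over_iff.2 ⟨rfl, rfl⟩,
      over_iff.2 ⟨K.map_push₂ s _, K.q_push₂ s _⟩, K.lam₂ s _, by rw [K.map₂_lam₂]; simp,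
      by rw [K.q_lam₂]; exact .ofEq _⟩
  · rw [h]
    exact (cellR_unique K D h₂ ⟨over_iff.2 ⟨K.p_pull₂ t _, K.map_pull₂ t _⟩,
      over_iff.2 ⟨rfl, rfl⟩, K.rho₂ t _, by rw [K.p_rho₂]; exact .ofEq _,
      by rw [K.map₂_rho₂]; simp⟩).symm

/-- By hypothesis, pushing `s` forward along `α` and pulling `t` back along `β` lead to the same
morphism. The required cell passes through it: its first half lies over `α` and an identity, its
second half over an identity and `β`. -/
lemma exists_cell_of_glue_pullCell_eq (K : SplitTwoSidedTwoFibration p q)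
    (D : JointlyReflectsIdCells p q) {i j : J} {s t : i ⟶ j} (α : p.map s ⟶ p.map t)
    (β : q.map s ⟶ q.map t)
    (f : K.pushObj (q.map s) ⟨i, rfl, rfl⟩ ⟶ K.pullObj (p.map s) ⟨j, rfl, rfl⟩)
    (g : K.pushObj (q.map t) ⟨i, rfl, rfl⟩ ⟶ K.pullObj (p.map t) ⟨j, rfl, rfl⟩)
    (hf : K.glue f = s) (hg : K.glue g = t)
    (h : f ≫ K.pullCell D α ⟨j, rfl, rfl⟩ = K.pushCell D β ⟨i, rfl, rfl⟩ ≫ g) :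
    ∃ σ : s ⟶ t, p.map₂ σ = α ∧ q.map₂ σ = β := by
  have h₁ := (K.cellL_glue D f α).eq hf rfl
  have h₂ := (K.cellR_glue D g β).eq rfl hg
  rw [h] at h₁
  generalize K.glue (K.pushCell D β ⟨i, rfl, rfl⟩ ≫ g) = r at h₁ h₂
  obtain ⟨σ, hσ, e⟩ := h₁.cell
  obtain ⟨τ, e', hτ⟩ := h₂.cell
  refine ⟨σ ≫ τ, ?_, ?_⟩
  · rw [p.map₂_comp]
    obtain ⟨_, h'⟩ := e'
    rw [h']
    exact eq_of_heq ((comp_eqToHom_heq _ _).trans hσ)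
  · rw [q.map₂_comp]
    obtain ⟨_, h'⟩ := e
    rw [h']
    exact eq_of_heq ((eqToHom_comp_heq _ _).trans hτ)

end SplitTwoSidedTwoFibration

end Gluing

end TwoFib

/-! ### The lax natural transformation `χ` and its identity components. -/

namespace TwoFib

/-- A lax natural transformation between 2-functors into a strict 2-category, in which the
coherence cells are identities. -/
def laxNatMk {X : Type u₁} [Bicategory.{w₁, v₁} X] {C : Type u₂} [Bicategory.{w₂, v₂} C] [Strict C]
    {F G : StrictPseudofunctor X C} (app : ∀ x, F.obj x ⟶ G.obj x)
    (nat : ∀ {x y : X} (s : x ⟶ y), app x ≫ G.map s ⟶ F.map s ≫ app y)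
    (nat_nat : ∀ {x y : X} {s t : x ⟶ y} (σ : s ⟶ t),
      nat s ≫ F.map₂ σ ▷ app y = app x ◁ G.map₂ σ ≫ nat t)
    (nat_id : ∀ x, IsIdCell (nat (𝟙 x)))
    (nat_comp : ∀ {x y z : X} (s : x ⟶ y) (t : y ⟶ z), nat (s ≫ t) =
      eqToHom (by rw [G.map_comp, Strict.assoc]) ≫ nat s ▷ G.map t ≫
        eqToHom (Strict.assoc _ _ _) ≫ F.map s ◁ nat t ≫
          eqToHom (by rw [F.map_comp, Strict.assoc])) : LaxNat F G where
  app := app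
  naturality := nat
  naturality_naturality := nat_nat
  naturality_id x := by
    obtain ⟨h, e⟩ := nat_id x
    change app x ◁ (G.mapId x).inv ≫ nat (𝟙 x) =
      (ρ_ (app x)).hom ≫ (λ_ (app x)).inv ≫ (F.mapId x).inv ▷ app x
    simp [e, F.mapId_eq_eqToIso, G.mapId_eq_eqToIso, Strict.leftUnitor_eqToIso,
      Strict.rightUnitor_eqToIso]
  naturality_comp {x y z} s t := by
    change app x ◁ (G.mapComp s t).inv ≫ nat (s ≫ t) = (α_ _ _ _).inv ≫ nat s ▷ G.map t ≫
      (α_ _ _ _).hom ≫ F.map s ◁ nat t ≫ (α_ _ _ _).inv ≫ (F.mapComp s t).inv ▷ app z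
    simp [nat_comp, F.mapComp_eq_eqToIso, G.mapComp_eq_eqToIso, Strict.associator_eqToIso]

noncomputable section LaxTransformation

open Opposite Bicategory.Opposite

variable {J : Type u} [Bicategory.{u, u} J] [Strict J] {A : Type u} [Bicategory.{u, u} A] [Strict A]
  {B : Type u} [Bicategory.{u, u} B] [Strict B]
  {p : StrictPseudofunctor J A} {q : StrictPseudofunctor J B} {a a' a'' : A} {b b' b'' : B}

namespace SplitTwoSidedTwoFibration

open Fibre

variable (hA : ∀ a b : A, IsSmallCat.{w} (a ⟶ b))
  (K : SplitTwoSidedTwoFibration p q) (D : JointlyReflectsIdCells p q)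
  (hJ : ∀ (a : A) (b : B), IsSmallCat.{w} (Fibre p q a b))

/-- The functor `x ↦ (-)^* x` on the fibre over `(a, b)`. -/
def fibreYoneda (a : A) (b : B) :
    Fibre p q a b ⥤ ((yonedaTwo hA).obj a ⟶ (K.curry D hJ).obj b) :=
  inverseYonedaFunctor hA ((K.curry D hJ).obj b) a

lemma fibreYoneda_map_bijective (x y : Fibre p q a b) :
    Function.Bijective ((K.fibreYoneda hA D hJ a b).map (X := x) (Y := y)) :=
  inverseYonedaFunctor_map_bijective hA ((K.curry D hJ).obj b) x y

lemma fibreYoneda_obj_bijective :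
    Function.Bijective (K.fibreYoneda hA D hJ a b).obj :=
  ⟨fun _ _ h => inverseYoneda_injective (f := (K.curry D hJ).obj b) hA h,
    fun φ => ⟨(evalId hA ((K.curry D hJ).obj b)).obj φ, inverseYoneda_evalId hA φ⟩⟩

/-- This and the next five lemmas are the 2-naturality of the Yoneda correspondence for the presheaf
`⌜J⌝ b`, for which the abstract actions unfold to `v_!`, `u^*`, `β_!` and `α^*`. -/
lemma fibreYoneda_comp (v : b ⟶ b') (x : Fibre p q a b) :
    (K.fibreYoneda hA D hJ a b).obj x ≫ (K.curry D hJ).map v =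
      (K.fibreYoneda hA D hJ a b').obj (K.pushObj v x) :=
  inverseYoneda_comp (f := (K.curry D hJ).obj b) hA x ((K.curry D hJ).map v)

lemma comp_fibreYoneda (u : a' ⟶ a) (x : Fibre p q a b) :
    (yonedaTwo hA).map u ≫ (K.fibreYoneda hA D hJ a b).obj x =
      (K.fibreYoneda hA D hJ a' b).obj (K.pullObj u x) :=
  yonedaTwo_comp_inverseYoneda (f := (K.curry D hJ).obj b) hA u x

lemma fibreYoneda_map_whiskerRight {x y : Fibre p q a b} (f : x ⟶ y) (v : b ⟶ b') :
    (K.fibreYoneda hA D hJ a b).map f ▷ (K.curry D hJ).map v =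
      eqToHom (K.fibreYoneda_comp hA D hJ v x) ≫
        (K.fibreYoneda hA D hJ a b').map ((K.pushFunctor a v).map f) ≫
          eqToHom (K.fibreYoneda_comp hA D hJ v y).symm :=
  inverseYoneda_map_whiskerRight (f := (K.curry D hJ).obj b) hA (i := x) (j := y) f
    ((K.curry D hJ).map v)

lemma whiskerLeft_fibreYoneda_map (u : a' ⟶ a) {x y : Fibre p q a b} (f : x ⟶ y) :
    (yonedaTwo hA).map u ◁ (K.fibreYoneda hA D hJ a b).map f =
      eqToHom (K.comp_fibreYoneda hA D hJ u x) ≫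
        (K.fibreYoneda hA D hJ a' b).map ((K.pullFunctor b u).map f) ≫
          eqToHom (K.comp_fibreYoneda hA D hJ u y).symm :=
  whiskerLeft_inverseYoneda_map (f := (K.curry D hJ).obj b) hA u (i := x) (j := y) f

lemma fibreYoneda_whiskerLeft (x : Fibre p q a b) {v v' : b ⟶ b'} (β : v ⟶ v') :
    (K.fibreYoneda hA D hJ a b).obj x ◁ (K.curry D hJ).map₂ β =
      eqToHom (K.fibreYoneda_comp hA D hJ v x) ≫
        (K.fibreYoneda hA D hJ a b').map (K.pushCell D β x) ≫
          eqToHom (K.fibreYoneda_comp hA D hJ v' x).symm :=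
  inverseYoneda_whiskerLeft (f := (K.curry D hJ).obj b) hA x ((K.curry D hJ).map₂ β)

lemma map₂_whiskerRight_fibreYoneda {u u' : a' ⟶ a} (α : u ⟶ u') (x : Fibre p q a b) :
    (yonedaTwo hA).map₂ α ▷ (K.fibreYoneda hA D hJ a b).obj x =
      eqToHom (K.comp_fibreYoneda hA D hJ u x) ≫
        (K.fibreYoneda hA D hJ a' b).map (K.pullCell D α x) ≫
          eqToHom (K.comp_fibreYoneda hA D hJ u' x).symm :=
  yonedaTwo_map₂_whiskerRight (f := (K.curry D hJ).obj b) hA α x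

/-- The cell of `Cat ^ Aᵒᵖ` that corresponds to a morphism `v_! x ⟶ u^* y` of a fibre. -/
def glueCell {u : a ⟶ a'} {v : b ⟶ b'} {x : Fibre p q a b} {y : Fibre p q a' b'}
    (f : K.pushObj v x ⟶ K.pullObj u y) :
    (K.fibreYoneda hA D hJ a b).obj x ≫ (K.curry D hJ).map v ⟶
      (yonedaTwo hA).map u ≫ (K.fibreYoneda hA D hJ a' b').obj y :=
  eqToHom (K.fibreYoneda_comp hA D hJ v x) ≫ (K.fibreYoneda hA D hJ a b').map f ≫
    eqToHom (K.comp_fibreYoneda hA D hJ u y).symm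

section

variable {u u' : a ⟶ a'} {v v' : b ⟶ b'} {x : Fibre p q a b} {y : Fibre p q a' b'}

lemma glueCell_bijective : Function.Bijective
    (K.glueCell hA D hJ (u := u) (v := v) (x := x) (y := y)) := by
  constructor
  · intro f g h
    rw [glueCell, glueCell, cancel_epi, cancel_mono] at h
    exact (K.fibreYoneda_map_bijective hA D hJ _ _).1 h
  · intro m
    obtain ⟨f, hf⟩ := (K.fibreYoneda_map_bijective hA D hJ (K.pushObj v x) (K.pullObj u y)).2
      (eqToHom (K.fibreYoneda_comp hA D hJ v x).symm ≫ m ≫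
        eqToHom (K.comp_fibreYoneda hA D hJ u y))
    exact ⟨f, by rw [glueCell, hf]; simp⟩

lemma glueCell_comp_map₂ (f : K.pushObj v x ⟶ K.pullObj u y) (α : u ⟶ u') :
    K.glueCell hA D hJ f ≫ (yonedaTwo hA).map₂ α ▷ (K.fibreYoneda hA D hJ a' b').obj y =
      K.glueCell hA D hJ (f ≫ K.pullCell D α y) := by
  rw [map₂_whiskerRight_fibreYoneda, glueCell, glueCell]
  simp

lemma map₂_comp_glueCell (β : v ⟶ v') (f : K.pushObj v' x ⟶ K.pullObj u y) :
    (K.fibreYoneda hA D hJ a b).obj x ◁ (K.curry D hJ).map₂ β ≫ K.glueCell hA D hJ f =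
      K.glueCell hA D hJ (K.pushCell D β x ≫ f) := by
  rw [fibreYoneda_whiskerLeft, glueCell, glueCell]
  simp

/-- If the cell is an identity, then `(-)^* (v_! x) = (-)^* (u^* y)`, and injectivity on objects
gives `v_! x = u^* y`. Faithfulness then shows that `f` is the identity. -/
lemma isIdCell_glueCell_iff (f : K.pushObj v x ⟶ K.pullObj u y) :
    IsIdCell (K.glueCell hA D hJ f) ↔ ∃ h, f = eqToHom h := by
  constructor
  · rintro ⟨h, e⟩
    have h' : K.pushObj v x = K.pullObj u y := (K.fibreYoneda_obj_bijective hA D hJ).1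
      (by rw [← fibreYoneda_comp, ← comp_fibreYoneda, h])
    refine ⟨h', (K.fibreYoneda_map_bijective hA D hJ _ _).1 ?_⟩
    rw [glueCell, eqToHom_comp_iff, comp_eqToHom_iff] at e
    rw [e, eqToHom_map]
    simp
  · rintro ⟨h, rfl⟩
    rw [glueCell, eqToHom_map, eqToHom_trans, eqToHom_trans]
    exact .ofEq _

/-- By `glue_comp`, `k` is the composite of `t_! f` and `u^* g`, and the two whiskered cells
correspond to these factors. The boundary of `k` is given by equations, as `p` and `q` of a
composite equal the composites of the images only propositionally. -/
lemma glueCell_comp {w : a' ⟶ a''} {t : b' ⟶ b''} {z : Fibre p q a'' b''}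
    (f : K.pushObj v x ⟶ K.pullObj u y) (g : K.pushObj t y ⟶ K.pullObj w z)
    {u₁ : a ⟶ a''} {v₁ : b ⟶ b''} (hu : u₁ = u ≫ w) (hv : v₁ = v ≫ t)
    (k : K.pushObj v₁ x ⟶ K.pullObj u₁ z) (hk : K.glue k = K.glue f ≫ K.glue g)
    (h₁ h₂ h₃) :
    K.glueCell hA D hJ k = eqToHom h₁ ≫ K.glueCell hA D hJ f ▷ (K.curry D hJ).map t ≫
      eqToHom h₂ ≫ (yonedaTwo hA).map u ◁ K.glueCell hA D hJ g ≫ eqToHom h₃ := by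
  subst hu hv
  rw [← glue_comp] at hk
  rw [K.glue_injective hk, glueCell, glueCell, glueCell]
  simp only [comp_whiskerRight, whiskerLeft_comp, eqToHom_whiskerRight, whiskerLeft_eqToHom,
    fibreYoneda_map_whiskerRight, whiskerLeft_fibreYoneda_map, Functor.map_comp, eqToHom_map,
    Category.assoc, eqToHom_trans, eqToHom_trans_assoc]

end

/-- The morphism `ŝ` of the fibre over `(p i, q j)`. -/
def hat {i j : J} (s : i ⟶ j) :
    K.pushObj (q.map s) (fibreObj p q i) ⟶ K.pullObj (p.map s) (fibreObj p q j) :=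
  (K.exists_glue (over_iff.2 ⟨rfl, rfl⟩ : Over (x := fibreObj p q i) (y := fibreObj p q j)
    s (p.map s) (q.map s))).choose

lemma glue_hat {i j : J} (s : i ⟶ j) : K.glue (K.hat s) = s :=
  (K.exists_glue (over_iff.2 ⟨rfl, rfl⟩ : Over (x := fibreObj p q i) (y := fibreObj p q j)
    s (p.map s) (q.map s))).choose_spec

/-- The cell is an identity if and only if `ŝ` is one, and gluing an identity gives `λ ∘ ρ`. This
describes the morphisms at which `χ` is marked, and the cleavage conditions for unary cells are read
off from it. -/
lemma isIdCell_glueCell_hat_iff {i j : J} (s : i ⟶ j) :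
    IsIdCell (K.glueCell hA D hJ (K.hat s)) ↔
      ∃ h : K.push i (q.map s) = K.pull j (p.map s),
        s = K.rho i (q.map s) ≫ eqToHom h ≫ K.lam j (p.map s) := by
  -- Lifts in fibres are taken along morphisms composed with the equations that place an object in
  -- its fibre. For `fibreObj` these are identities and have to be removed to arrive at `K.rho` and
  -- `K.lam`.
  have hv : eqToHom (fibreObj p q i).right ≫ q.map s = q.map s := Category.id_comp _
  have hu : p.map s ≫ eqToHom (fibreObj p q j).left.symm = p.map s := Category.comp_id _
  have key (h : K.pushObj (q.map s) (fibreObj p q i) = K.pullObj (p.map s) (fibreObj p q j)) :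
      K.glue (eqToHom h) = K.rho i (q.map s) ≫ eqToHom ((K.push_congr hv).symm.trans
        ((congrArg Fibre.obj h).trans (K.pull_congr hu))) ≫ K.lam j (p.map s) := by
    rw [glue, rhoHom, lamHom]
    erw [K.rho_congr hv, K.lam_congr hu]
    simp
    rfl
  rw [isIdCell_glueCell_iff]
  constructor
  · rintro ⟨h, e⟩
    refine ⟨(K.push_congr hv).symm.trans ((congrArg Fibre.obj h).trans (K.pull_congr hu)), ?_⟩
    exact (K.glue_hat s).symm.trans ((congrArg K.glue e).trans (key h))
  · rintro ⟨h, e⟩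
    have h' : K.pushObj (q.map s) (fibreObj p q i) = K.pullObj (p.map s) (fibreObj p q j) :=
      Fibre.ext ((K.push_congr hv).trans (h.trans (K.pull_congr hu).symm))
    refine ⟨h', K.glue_injective ?_⟩
    exact (K.glue_hat s).trans (e.trans (key h').symm)

/-- The lax natural transformation `χ : y p ⟶ ⌜J⌝ q`. -/
def chi : LaxNat (p.comp (yonedaTwo hA)) (q.comp (K.curry D hJ)) :=
  laxNatMk (fun i => (K.fibreYoneda hA D hJ (p.obj i) (q.obj i)).obj (fibreObj p q i))
    (fun s => K.glueCell hA D hJ (K.hat s))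
    (fun {i j s t} σ => by
      -- Naturality for cells is the equation `α^* ∘ ŝ = t̂ ∘ β_!` for the images `α` and `β` of
      -- `σ`.
      refine (K.glueCell_comp_map₂ hA D hJ (K.hat s) (p.map₂ σ)).trans
        (Eq.trans ?_ (K.map₂_comp_glueCell hA D hJ (q.map₂ σ) (K.hat t)).symm)
      exact congrArg (K.glueCell hA D hJ) (K.glue_pullCell_eq_of_cell D σ (K.hat s) (K.hat t)
        (K.glue_hat s) (K.glue_hat t)))
    (fun i => by
      -- The lifts preserve identities, so the identity of `i` is a composite of lifts `λ ∘ ρ`.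
      refine (K.isIdCell_glueCell_hat_iff hA D hJ (𝟙 i)).2
        ⟨(K.push_congr (q.map_id i)).trans ((K.push_id i).trans
          ((K.pull_id i).symm.trans (K.pull_congr (p.map_id i)).symm)), ?_⟩
      rw [K.rho_congr (q.map_id i), K.lam_congr (p.map_id i), K.rho_id, K.lam_id]
      simp)
    (fun s t => K.glueCell_comp hA D hJ (K.hat s) (K.hat t) (p.map_comp s t) (q.map_comp s t)
      (K.hat (s ≫ t)) ((K.glue_hat (s ≫ t)).trans
        (congrArg₂ (· ≫ ·) (K.glue_hat s).symm (K.glue_hat t).symm)) _ _ _)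

end SplitTwoSidedTwoFibration

end LaxTransformation

end TwoFib

namespace TwoFib

/-! ### Recognising chosen lifts among the morphisms `λ ∘ ρ` and among cells. -/

section Cleavages

variable {J : Type u₁} [Bicategory.{w₁, v₁} J] [Strict J]
  {A : Type u₂} [Bicategory.{w₂, v₂} A] [Strict A]
  {B : Type u₃} [Bicategory.{w₃, v₃} B] [Strict B]
  {p : StrictPseudofunctor J A} {q : StrictPseudofunctor J B}

namespace SplitTwoSidedTwoFibration

variable (K : SplitTwoSidedTwoFibration p q)

/-- Preservation of identities by the lifts, in a form that allows the endpoints to be equal only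
propositionally; similarly for the next three lemmas. -/
lemma rho_eqToHom {i : J} {b : B} {v : q.obj i ⟶ b} {h : q.obj i = b} (hv : v = eqToHom h) :
    ∃ e : i = K.push i v, K.rho i v = eqToHom e := by
  subst h hv
  exact ⟨(K.push_id i).symm, K.rho_id i⟩

lemma lam_eqToHom {i : J} {a : A} {u : a ⟶ p.obj i} {h : a = p.obj i} (hu : u = eqToHom h) :
    ∃ e : K.pull i u = i, K.lam i u = eqToHom e := by
  subst h hu
  exact ⟨K.pull_id i, K.lam_id i⟩

lemma rho₂_eqToHom {i j : J} {s : i ⟶ j} {v : q.obj i ⟶ q.obj j} {β : v ⟶ q.map s}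
    (hβ : IsIdCell β) : ∃ e : K.pull₂ s β = s, K.rho₂ s β = eqToHom e := by
  obtain ⟨rfl, rfl⟩ := hβ
  exact ⟨K.pull₂_id s, K.rho₂_id s⟩

lemma lam₂_eqToHom {i j : J} {s : i ⟶ j} {u : p.obj i ⟶ p.obj j} {α : p.map s ⟶ u}
    (hα : IsIdCell α) : ∃ e : s = K.push₂ s α, K.lam₂ s α = eqToHom e := by
  obtain ⟨rfl, rfl⟩ := hα
  exact ⟨(K.push₂_id s).symm, K.lam₂_id s⟩

section

variable {i j : J} {s : i ⟶ j}

lemma isIdMor_map_of_isLam (hs : K.IsLam s) : IsIdMor (q.map s) := by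
  obtain ⟨h, e⟩ := hs
  rw [e, q.map_comp, map_eqToHom, K.q_lam, eqToHom_trans]
  exact ⟨_, rfl⟩

lemma isIdMor_map_of_isRho (hs : K.IsRho s) : IsIdMor (p.map s) := by
  obtain ⟨h, e⟩ := hs
  rw [e, p.map_comp, map_eqToHom, K.p_rho, eqToHom_trans]
  exact ⟨_, rfl⟩

/-- The morphism `s` is the composite of lifts `λ(p s, j) ∘ ρ(i, q s)`. -/
def IsRhoLam (s : i ⟶ j) : Prop :=
  ∃ h : K.push i (q.map s) = K.pull j (p.map s),
    s = K.rho i (q.map s) ≫ eqToHom h ≫ K.lam j (p.map s)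

/-- If `q s` is an identity, then so is its lift `ρ`, and only `λ` remains. -/
lemma IsRhoLam.isLam (h : K.IsRhoLam s) (hq : IsIdMor (q.map s)) : K.IsLam s := by
  obtain ⟨h, e⟩ := h
  obtain ⟨_, hq⟩ := hq
  obtain ⟨h', e'⟩ := K.rho_eqToHom hq
  rw [e', ← Category.assoc, eqToHom_trans] at e
  exact ⟨_, e⟩

lemma IsRhoLam.isRho (h : K.IsRhoLam s) (hp : IsIdMor (p.map s)) : K.IsRho s := by
  obtain ⟨h, e⟩ := h
  obtain ⟨_, hp⟩ := hp
  obtain ⟨h', e'⟩ := K.lam_eqToHom hp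
  rw [e', eqToHom_trans] at e
  exact ⟨_, e⟩

lemma IsRhoLam.isIdMor (h : K.IsRhoLam s) (hp : IsIdMor (p.map s)) (hq : IsIdMor (q.map s)) :
    IsIdMor s := by
  obtain ⟨_, hp⟩ := hp
  obtain ⟨h, e⟩ := h.isLam K hq
  obtain ⟨h', e'⟩ := K.lam_eqToHom hp
  rw [e', eqToHom_trans] at e
  exact ⟨_, e⟩

lemma isRhoLam_of_isLam (hs : K.IsLam s) : K.IsRhoLam s := by
  obtain ⟨_, hq⟩ := K.isIdMor_map_of_isLam hs
  obtain ⟨h, e⟩ := hs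
  obtain ⟨h', e'⟩ := K.rho_eqToHom hq
  refine ⟨h'.symm.trans h, ?_⟩
  rw [e', ← Category.assoc, eqToHom_trans]
  exact e

lemma isRhoLam_of_isRho (hs : K.IsRho s) : K.IsRhoLam s := by
  obtain ⟨_, hp⟩ := K.isIdMor_map_of_isRho hs
  obtain ⟨h, e⟩ := hs
  obtain ⟨h', e'⟩ := K.lam_eqToHom hp
  refine ⟨h.trans h'.symm, ?_⟩
  rw [e', eqToHom_trans]
  exact e

end

section

variable {i j : J} {s t : i ⟶ j} {σ : s ⟶ t}

lemma isIdCell_map₂_of_isLam₂ (hσ : K.IsLam₂ σ) : IsIdCell (q.map₂ σ) := by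
  obtain ⟨h, e⟩ := hσ
  rw [e, q.map₂_comp, K.q_lam₂]
  exact (IsIdCell.ofEq _).comp ((IsIdCell.ofEq _).map₂ q)

lemma isIdCell_map₂_of_isRho₂ (hσ : K.IsRho₂ σ) : IsIdCell (p.map₂ σ) := by
  obtain ⟨h, e⟩ := hσ
  rw [e, p.map₂_comp, K.p_rho₂]
  exact ((IsIdCell.ofEq _).map₂ p).comp (IsIdCell.ofEq _)

/-- Each cell is a lift `λ` followed by a lift `ρ`, and here the latter is the lift of an identity.
-/
lemma isLam₂_of_isIdCell (D : JointlyReflectsIdCells p q) (hσ : IsIdCell (q.map₂ σ)) :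
    K.IsLam₂ σ := by
  obtain ⟨h, e⟩ := K.push₂_eq_pull₂ D σ
  obtain ⟨h', e'⟩ := K.rho₂_eqToHom hσ
  rw [e', eqToHom_trans] at e
  exact ⟨_, e⟩

lemma isRho₂_of_isIdCell (D : JointlyReflectsIdCells p q) (hσ : IsIdCell (p.map₂ σ)) :
    K.IsRho₂ σ := by
  obtain ⟨h, e⟩ := K.push₂_eq_pull₂ D σ
  obtain ⟨h', e'⟩ := K.lam₂_eqToHom hσ
  rw [e', ← Category.assoc, eqToHom_trans] at e
  exact ⟨_, e⟩

end

end SplitTwoSidedTwoFibration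

end Cleavages

/-! ### Outer projections of left, inner and right morphisms and cells. -/

namespace FibrationPath

variable {n : ℕ} {P : FibrationPath.{w, v, u} n} {x y : P.Total} {s t : x ⟶ y} {σ : s ⟶ t}

/-- On a path of length one the first factor is also the last one, so its `λ` component has to be
considered; `q` maps that component to an identity. -/
lemma IsStartLam.isIdMor_q (hs : IsStartLam s) (m : Fin (n + 1)) :
    IsIdMor ((P.H m).q.map (s.hom m)) := by
  by_cases hm : m = 0
  · subst hm
    exact (P.H 0).cleavage.isIdMor_map_of_isLam hs.1
  · exact (hs.2 m hm).map _

lemma IsFinishRho.isIdMor_p (hs : IsFinishRho s) (m : Fin (n + 1)) :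
    IsIdMor ((P.H m).p.map (s.hom m)) := by
  by_cases hm : m = Fin.last n
  · subst hm
    exact (P.H (Fin.last n)).cleavage.isIdMor_map_of_isRho hs.1
  · exact (hs.2 m hm).map _

lemma IsInner.isIdMor_p (hs : IsInner s) : IsIdMor ((P.H 0).p.map (s.hom 0)) := by
  obtain ⟨k, h₁, -, h₃⟩ := hs
  -- Only the `λ` component, at `k.succ`, can have a nontrivial image under `p`, and `k.succ` is
  -- never `0`. The component at `0` may well be the lift `ρ`, whose image under `p` is an identity.
  have key (m : Fin (n + 1)) (hm : m ≠ k.succ) : IsIdMor ((P.H m).p.map (s.hom m)) := by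
    by_cases hm' : m = k.castSucc
    · subst hm'
      exact (P.H k.castSucc).cleavage.isIdMor_map_of_isRho h₁
    · exact (h₃ m hm' hm).map _
  exact key 0 (Fin.succ_ne_zero k).symm

lemma IsInner.isIdMor_q (hs : IsInner s) :
    IsIdMor ((P.H (Fin.last n)).q.map (s.hom (Fin.last n))) := by
  obtain ⟨k, -, h₂, h₃⟩ := hs
  have key (m : Fin (n + 1)) (hm : m ≠ k.castSucc) : IsIdMor ((P.H m).q.map (s.hom m)) := by
    by_cases hm' : m = k.succ
    · subst hm'
      exact (P.H k.succ).cleavage.isIdMor_map_of_isLam h₂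
    · exact (h₃ m hm hm').map _
  exact key (Fin.last n) (Fin.castSucc_ne_last k).symm

lemma IsStartLam₂.isIdCell_q (hσ : IsStartLam₂ σ) (m : Fin (n + 1)) :
    IsIdCell ((P.H m).q.map₂ (σ.cell m)) := by
  by_cases hm : m = 0
  · subst hm
    exact (P.H 0).cleavage.isIdCell_map₂_of_isLam₂ hσ.1
  · exact (hσ.2 m hm).map₂ _

lemma IsFinishRho₂.isIdCell_p (hσ : IsFinishRho₂ σ) (m : Fin (n + 1)) :
    IsIdCell ((P.H m).p.map₂ (σ.cell m)) := by
  by_cases hm : m = Fin.last n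
  · subst hm
    exact (P.H (Fin.last n)).cleavage.isIdCell_map₂_of_isRho₂ hσ.1
  · exact (hσ.2 m hm).map₂ _

lemma IsInner₂.isIdCell_p (hσ : IsInner₂ σ) : IsIdCell ((P.H 0).p.map₂ (σ.cell 0)) := by
  obtain ⟨k, h₁, -, h₃⟩ := hσ
  have key (m : Fin (n + 1)) (hm : m ≠ k.succ) : IsIdCell ((P.H m).p.map₂ (σ.cell m)) := by
    by_cases hm' : m = k.castSucc
    · subst hm'
      exact (P.H k.castSucc).cleavage.isIdCell_map₂_of_isRho₂ h₁
    · exact (h₃ m hm' hm).map₂ _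
  exact key 0 (Fin.succ_ne_zero k).symm

lemma IsInner₂.isIdCell_q (hσ : IsInner₂ σ) :
    IsIdCell ((P.H (Fin.last n)).q.map₂ (σ.cell (Fin.last n))) := by
  obtain ⟨k, -, h₂, h₃⟩ := hσ
  have key (m : Fin (n + 1)) (hm : m ≠ k.castSucc) : IsIdCell ((P.H m).q.map₂ (σ.cell m)) := by
    by_cases hm' : m = k.succ
    · subst hm'
      exact (P.H k.succ).cleavage.isIdCell_map₂_of_isLam₂ h₂
    · exact (h₃ m hm hm').map₂ _
  exact key (Fin.last n) (Fin.castSucc_ne_last k).symm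

end FibrationPath

/-! ### Cartesianness of invertible comparison cells. -/

section Cartesian

variable {A : Type u₁} [Bicategory.{w₁, v₁} A] [Strict A] {B : Type u₂} [Bicategory.{w₂, v₂} B]
  [Strict B] {C : Type u₃} [Bicategory.{w₃, v₃} C] {J : Type u₄} [Bicategory.{w₄, v₄} J] [Strict J]
  {f : StrictPseudofunctor A C} {g : StrictPseudofunctor B C}
  {p : StrictPseudofunctor J A} {q : StrictPseudofunctor J B}

/-- A lax comma object of a locally discrete split two-sided 2-fibration is a cartesian nullary
cell as soon as its identity components are those at the composites of lifts `λ ∘ ρ`. -/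
theorem isNullaryCartesian_of_isInvertible (K : SplitTwoSidedTwoFibration p q)
    (D : JointlyReflectsIdCells p q) {χ : LaxNat (p.comp f) (q.comp g)}
    (hχ : IsInvertible (LaxComma.lift p q χ))
    (hK : ∀ {i j : J} (s : i ⟶ j), IsIdCell (χ.naturality s) ↔ K.IsRhoLam s) :
    IsNullaryCartesian.{w, v, u} K χ where
  cm s hs := (hK s).2 (K.isRhoLam_of_isLam hs)
  om s hs := (hK s).2 (K.isRhoLam_of_isRho hs)
  factor {n} P h k ψ hψ := by
    obtain ⟨T, hT, hu⟩ := existsUnique_factorises hχ ψ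
    -- The factorisation is unique even among all 2-functors, so it remains to show that it respects
    -- the cleavages.
    refine ⟨T, ⟨hT, ?_⟩, fun T' hT' => hu T' hT'.1⟩
    have hp {x y : P.Total} {s : x ⟶ y} (hs : IsIdMor ((P.H 0).p.map (s.hom 0))) :
        IsIdMor (p.map (T.map s)) :=
      isIdMor_map_of_eq hT.left (f := s) (hs.map h)
    have hq {x y : P.Total} {s : x ⟶ y}
        (hs : IsIdMor ((P.H (Fin.last n)).q.map (s.hom (Fin.last n)))) :
        IsIdMor (q.map (T.map s)) :=
      isIdMor_map_of_eq hT.right (f := s) (hs.map k)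
    have hp₂ {x y : P.Total} {s t : x ⟶ y} {σ : s ⟶ t}
        (hσ : IsIdCell ((P.H 0).p.map₂ (σ.cell 0))) : IsIdCell (p.map₂ (T.map₂ σ)) :=
      isIdCell_map₂_of_eq hT.left (σ := σ) (hσ.map₂ h)
    have hq₂ {x y : P.Total} {s t : x ⟶ y} {σ : s ⟶ t}
        (hσ : IsIdCell ((P.H (Fin.last n)).q.map₂ (σ.cell (Fin.last n)))) :
        IsIdCell (q.map₂ (T.map₂ σ)) :=
      isIdCell_map₂_of_eq hT.right (σ := σ) (hσ.map₂ k)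
    -- For morphisms, the marking of `ψ` makes `T s` a composite `λ ∘ ρ`, and the outer projections
    -- of `s` tell which of the two lifts are trivial. For cells no marking is needed: local
    -- discreteness suffices once the projections are known.
    exact {
      pcm := fun s hs =>
        ((hK _).1 (hT.isIdCell (hψ.cm s hs))).isLam K (hq (hs.isIdMor_q _))
      poc := fun σ hσ => K.isLam₂_of_isIdCell D (hq₂ (hσ.isIdCell_q _))
      iem := fun s hs =>
        ((hK _).1 (hT.isIdCell (hψ.im s hs))).isIdMor K (hp hs.isIdMor_p) (hq hs.isIdMor_q)
      iec := fun σ hσ => D _ (hp₂ hσ.isIdCell_p) (hq₂ hσ.isIdCell_q)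
      pom := fun s hs =>
        ((hK _).1 (hT.isIdCell (hψ.om s hs))).isRho K (hp (hs.isIdMor_p _))
      pcc := fun σ hσ => K.isRho₂_of_isIdCell D (hp₂ (hσ.isIdCell_p _)) }
  factor₀ X h k ψ hψ := by
    obtain ⟨T, hT, hu⟩ := existsUnique_factorises hχ ψ
    exact ⟨T, ⟨hT, fun s => (hK _).1 (hT.isIdCell (hψ s)), fun σ => K.push₂_eq_pull₂ D _⟩,
      fun T' hT' => hu T' hT'.1⟩

end Cartesian

end TwoFib

namespace TwoFib

/-! ### Bijectivity of the induced 2-functor and the main theorem. -/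

section Main

variable {J : Type u} [Bicategory.{u, u} J] [Strict J] {A : Type u} [Bicategory.{u, u} A] [Strict A]
  {B : Type u} [Bicategory.{u, u} B] [Strict B]
  {p : StrictPseudofunctor J A} {q : StrictPseudofunctor J B}

namespace SplitTwoSidedTwoFibration

open Fibre

variable (hA : ∀ a b : A, IsSmallCat.{w} (a ⟶ b))
  (K : SplitTwoSidedTwoFibration p q) (D : JointlyReflectsIdCells p q)
  (hJ : ∀ (a : A) (b : B), IsSmallCat.{w} (Fibre p q a b))

/-- With variables for the base objects, the two fibres can be identified before the injectivity of
Yoneda on objects is applied. -/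
lemma obj_eq_of_laxComma_eq {a a' : A} {b b' : B} (x : Fibre p q a b) (y : Fibre p q a' b')
    (h : (⟨a, b, (K.fibreYoneda hA D hJ a b).obj x⟩ : LaxComma (yonedaTwo hA) (K.curry D hJ)) =
      ⟨a', b', (K.fibreYoneda hA D hJ a' b').obj y⟩) : x.obj = y.obj := by
  rw [LaxComma.mk.injEq] at h
  obtain ⟨rfl, rfl, h⟩ := h
  rw [(K.fibreYoneda_obj_bijective hA D hJ).1 (eq_of_heq h)]

/-- On objects this is Yoneda; on morphisms, Yoneda together with the bijection between fibre
morphisms and glued morphisms; on cells, local discreteness. -/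
theorem lift_chi_isBijective : IsBijective (LaxComma.lift p q (K.chi hA D hJ)) where
  obj := by
    refine ⟨fun i j h => K.obj_eq_of_laxComma_eq hA D hJ (fibreObj p q i) (fibreObj p q j) h, ?_⟩
    rintro ⟨a, b, m⟩
    obtain ⟨⟨i, rfl, rfl⟩, rfl⟩ := (K.fibreYoneda_obj_bijective hA D hJ).2 m
    exact ⟨i, rfl⟩
  map i j := by
    constructor
    · intro s t h
      obtain ⟨hp, hq, hc⟩ := (LaxComma.Hom.mk.injEq ..).mp h
      have key {u u' : p.obj i ⟶ p.obj j} {v v' : q.obj i ⟶ q.obj j} (hu : u = u') (hv : v = v')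
          (f : K.pushObj v (fibreObj p q i) ⟶ K.pullObj u (fibreObj p q j))
          (f' : K.pushObj v' (fibreObj p q i) ⟶ K.pullObj u' (fibreObj p q j))
          (h : K.glueCell hA D hJ f ≍ K.glueCell hA D hJ f') : K.glue f = K.glue f' := by
        subst hu hv
        rw [(K.glueCell_bijective hA D hJ).1 (eq_of_heq h)]
      exact (K.glue_hat s).symm.trans ((key hp hq _ _ hc).trans (K.glue_hat t))
    · rintro ⟨u, v, m⟩
      obtain ⟨f, rfl⟩ := (K.glueCell_bijective hA D hJ (x := fibreObj p q i)
        (y := fibreObj p q j)).2 m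
      -- The preimage is the morphism glued from `f`. Naming it as a variable allows `u` and `v` to
      -- be replaced by its images under `p` and `q`.
      obtain ⟨s, hs⟩ : ∃ s : i ⟶ j, K.glue f = s := ⟨_, rfl⟩
      have ho := K.over_glue f
      rw [hs] at ho
      obtain ⟨rfl, rfl⟩ := over_iff.1 ho
      refine ⟨s, ?_⟩
      rw [K.glue_injective (hs.trans (K.glue_hat s).symm)]
      rfl
  map₂ {i j} s t := by
    constructor
    · intro σ τ h
      obtain ⟨hp, hq⟩ := (LaxComma.Hom₂.mk.injEq ..).mp h
      exact K.cell_ext D hp hq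
    · rintro ⟨α, β, h⟩
      -- The compatibility condition on a cell of the lax comma 2-category, read in the fibre
      -- through the bijection `glueCell`.
      have e : K.hat s ≫ K.pullCell D α (fibreObj p q j) =
          K.pushCell D β (fibreObj p q i) ≫ K.hat t :=
        (K.glueCell_bijective hA D hJ).1 ((K.glueCell_comp_map₂ hA D hJ (K.hat s) α).symm.trans
          (h.trans (K.map₂_comp_glueCell hA D hJ β (K.hat t))))
      obtain ⟨σ, rfl, rfl⟩ := K.exists_cell_of_glue_pullCell_eq D α β (K.hat s) (K.hat t)
        (K.glue_hat s) (K.glue_hat t) e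
      exact ⟨σ, rfl⟩

lemma hasComponents_chi : K.HasComponents hA D hJ (K.chi hA D hJ) where
  app _ := rfl
  naturality {i j} s := ⟨K.hat s, K.glue_hat s,
    fun _ ht => K.glue_injective (ht.trans (K.glue_hat s).symm), _, _, rfl⟩

end SplitTwoSidedTwoFibration

end Main

end TwoFib

theorem mainTheorem3
    {A : Type u} [Bicategory.{u, u} A] [Strict A] {B : Type u} [Bicategory.{u, u} B] [Strict B]
    {J : Type u} [Bicategory.{u, u} J] [Strict J]
    (hA : ∀ a b : A, IsSmallCat.{w} (a ⟶ b))
    (p : StrictPseudofunctor J A) (q : StrictPseudofunctor J B)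
    (K : SplitTwoSidedTwoFibration p q) (D : JointlyReflectsIdCells p q)
    (hJ : ∀ (a : A) (b : B), IsSmallCat.{w} (Fibre p q a b)) :
    ∃ χ : LaxNat (p.comp (yonedaTwo hA)) (q.comp (K.curry D hJ)),
      K.HasComponents hA D hJ χ ∧
      IsInvertible (LaxComma.lift p q χ) ∧
      (LaxComma.lift p q χ).comp (LaxComma.projLeft (yonedaTwo hA) (K.curry D hJ)) = p ∧
      (LaxComma.lift p q χ).comp (LaxComma.projRight (yonedaTwo hA) (K.curry D hJ)) = q ∧
      IsLaxComma χ ∧ IsNullaryCartesian K χ := by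
  have h := (K.lift_chi_isBijective hA D hJ).isInvertible
  exact ⟨K.chi hA D hJ, K.hasComponents_chi hA D hJ, h, LaxComma.lift_projLeft _,
    LaxComma.lift_projRight _, fun X _ _ ψ => existsUnique_factorises h ψ,
    isNullaryCartesian_of_isInvertible K D h fun s => K.isIdCell_glueCell_hat_iff hA D hJ s⟩
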